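/- Let $\beta>0$, $\mu=\frac{\beta}{2\sqrt2}$ and $\Lambda\in\mathbb C\setminus\mathbb R$. For $b\ge 0$ let $\mathbf H_b$ be the closure in $L^2(\mathbb R^2)$ of the operator $$\Psi\mapsto -\frac{\partial^2\Psi}{\partial x^2}+\frac12\Big(-\frac{\partial^2\Psi}{\partial y^2}+y^2\Psi\Big)\quad(x\neq0)$$ defined on all $\Psi\in H^2((0,\infty)\times\mathbb R)\oplus H^2((-\infty,0)\times\mathbb R)$ with $y^2\Psi\in L^2(\mathbb R^2)$ that satisfy, in the sense of traces and for almost every $y\in\mathbb R$, $$\Psi(0+,y)-\Psi(0-,y)=\frac{b}{y}\,\frac{\partial\Psi}{\partial x}(0+,y),\qquad \frac{\partial\Psi}{\partial x}(0+,y)=\frac{\partial\Psi}{\partial x}(0-,y).$$ For $n\in\mathbb N_0$ let $\chi_n$ be the normalized Hermite functions, $\chi_n(y)=(2^n n!\sqrt\pi)^{-1/2}H_n(y)\,\mathrm e^{-y^2/2}$, and for $z\in\mathbb C\setminus\mathbb R$ let $\zeta_n(z)=\sqrt{n+\tfrac12-z}$ with $\mathrm{Re}\,\zeta_n(z)>0$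 and $$\eta_n(x,z)=\pm\big(n+\tfrac12\big)^{1/4}\mathrm e^{\mp\zeta_n(z)x}\quad\text{for } \pm x>0 .$$ Let $\mathbf T(z):\ell^2(\mathbb N_0)\to L^2(\mathbb R^2)$ be the bounded operator $$\mathbf T(z)\{X_n\}=\sum_{n\in\mathbb N_0}X_n\,\eta_n(x,z)\,\chi_n(y).$$ Let $\mathcal J(\Lambda,\mu)$ be the Jacobi operator in $\ell^2(\mathbb N_0)$, $$(\mathcal J(\Lambda,\mu)X)_n=d_{n+1}X_{n+1}+2\mu\,y_n(\Lambda)X_n+d_nX_{n-1},$$ where $d_0X_{-1}:=0$, $d_n=n^{1/2}(n+\tfrac12)^{1/4}(n-\tfrac12)^{1/4}$ for $n\ge1$ and $y_n(\Lambda)=(n+\tfrac12)^{1/2}\zeta_n(\Lambda)$, on its maximal domain, that is, on all $X\in\ell^2(\mathbb N_0)$ for which the right-hand side belongs to $\ell^2(\mathbb N_0)$. Then $\Lambda$ belongs to the resolvent sets of $\mathbf H_\beta$ and $\mathbf H_0$, the operator $\mathcal J(\Lambda,\mu)$ is a bijection of its domain onto $\ell^2(\mathbb N_0)$ with bounded inverse,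 and $$(\mathbf H_\beta-\Lambda)^{-1}-(\mathbf H_0-\Lambda)^{-1}=\mathbf T(\Lambda)\,\mu\,\mathcal J(\Lambda,\mu)^{-1}\,\mathbf T(\bar\Lambda)^{*}.$$ -/

import Mathlib

open MeasureTheory Filter Topology
open scoped ComplexConjugate

namespace SmilanskyDeltaPrime

noncomputable section

/-- The `n`-th Hermite function, `χₙ(y) = (2ⁿ n! √π)^(-1/2) Hₙ(y) exp(-y²/2)`, written with the
monic (probabilists') Hermite polynomials, `Hₙ(y) = 2^(n/2) Heₙ(√2 y)`. -/
def hermiteFun (n : ℕ) (y : ℝ) : ℝ :=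
  (Real.sqrt (n.factorial * Real.sqrt Real.pi))⁻¹ *
    Polynomial.aeval (Real.sqrt 2 * y) (Polynomial.hermite n) * Real.exp (-(y ^ 2) / 2)

lemma continuous_hermiteFun (n : ℕ) : Continuous (hermiteFun n) := by
  unfold hermiteFun
  have := (Polynomial.hermite n).continuous_aeval (A := ℝ)
  fun_prop

/-- A polynomial times the Gaussian weight is integrable. -/
lemma integrable_poly_gaussian (p : Polynomial ℝ) :
    Integrable (fun x : ℝ => p.eval x * Real.exp (-(x ^ 2) / 2)) := by
  have hw : ∀ n : ℕ, Integrable (fun x : ℝ => x ^ n * Real.exp (-(x ^ 2) / 2)) := by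
    intro n
    have := integrable_rpow_mul_exp_neg_mul_sq (b := 1 / 2) (by norm_num) (s := (n : ℝ))
      (by have : (0 : ℝ) ≤ n := n.cast_nonneg
          linarith)
    refine this.congr (ae_of_all _ fun x => ?_)
    simp only [Real.rpow_natCast]
    congr 2
    ring
  induction p using Polynomial.induction_on' with
  | add p q hp hq =>
    refine (hp.add hq).congr (ae_of_all _ fun x => ?_)
    simp only [Pi.add_apply, Polynomial.eval_add]
    ring
  | monomial n a =>
    refine ((hw n).const_mul a).congr (ae_of_all _ fun x => ?_)
    simp only [Polynomial.eval_monomial]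
    ring

lemma integral_hermite_succ (n : ℕ) (p : Polynomial ℝ) :
    ∫ x : ℝ, (Polynomial.aeval x (Polynomial.hermite (n + 1)) * p.eval x) *
        Real.exp (-(x ^ 2) / 2) =
      ∫ x : ℝ, (Polynomial.aeval x (Polynomial.hermite n) * p.derivative.eval x) *
        Real.exp (-(x ^ 2) / 2) := by
  set h : Polynomial ℝ := (Polynomial.hermite n).map (Int.castRingHom ℝ) with hh
  have e0 : ∀ x : ℝ, Polynomial.aeval x (Polynomial.hermite n) = h.eval x := by
    intro x; rw [hh, Polynomial.eval_map]; rfl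
  have e1 : ∀ x : ℝ, Polynomial.aeval x (Polynomial.hermite (n + 1)) =
      x * h.eval x - h.derivative.eval x := by
    intro x
    rw [Polynomial.hermite_succ, map_sub, map_mul, Polynomial.aeval_X, e0, hh,
      Polynomial.derivative_map, Polynomial.eval_map, Polynomial.eval_map]
    rfl
  simp_rw [e0, e1]
  have hv : ∀ x : ℝ, HasDerivAt (fun x => h.eval x * Real.exp (-(x ^ 2) / 2))
      (-((x * h.eval x - h.derivative.eval x) * Real.exp (-(x ^ 2) / 2))) x := by
    intro x
    have hx : HasDerivAt (fun x : ℝ => -(x ^ 2) / 2) (-x) x := by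
      exact (((hasDerivAt_pow 2 x).neg).div_const 2).congr_deriv (by push_cast; ring)
    exact ((h.hasDerivAt x).mul hx.exp).congr_deriv (by ring)
  have key := integral_mul_deriv_eq_deriv_mul_of_integrable
    (u := fun x => p.eval x) (u' := fun x => p.derivative.eval x)
    (v := fun x => h.eval x * Real.exp (-(x ^ 2) / 2))
    (v' := fun x => -((x * h.eval x - h.derivative.eval x) * Real.exp (-(x ^ 2) / 2)))
    (fun x _ => p.hasDerivAt x) (fun x _ => hv x)
    ((integrable_poly_gaussian (-(p * (Polynomial.X * h - h.derivative)))).congr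
      (ae_of_all _ fun x => by simp; ring))
    ((integrable_poly_gaussian (p.derivative * h)).congr
      (ae_of_all _ fun x => by simp; ring))
    ((integrable_poly_gaussian (p * h)).congr (ae_of_all _ fun x => by simp; ring))
  have k2 := congrArg Neg.neg key
  rw [neg_neg, ← integral_neg] at k2
  calc _ = ∫ x : ℝ, -(p.eval x * -((x * h.eval x - h.derivative.eval x) *
        Real.exp (-(x ^ 2) / 2))) := by congr 1; ext x; ring
    _ = _ := by rw [k2]; congr 1; ext x; ring

lemma integral_hermite_mul (n : ℕ) (p : Polynomial ℝ) :
    ∫ x : ℝ, (Polynomial.aeval x (Polynomial.hermite n) * p.eval x) * Real.exp (-(x ^ 2) / 2) =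
      ∫ x : ℝ, (Polynomial.derivative^[n] p).eval x * Real.exp (-(x ^ 2) / 2) := by
  induction n generalizing p with
  | zero => simp
  | succ n ih => rw [integral_hermite_succ, ih, Function.iterate_succ_apply]

lemma integral_hermite_hermite_of_lt {m n : ℕ} (hmn : m < n) :
    ∫ x : ℝ, (Polynomial.aeval x (Polynomial.hermite n) *
      Polynomial.aeval x (Polynomial.hermite m)) * Real.exp (-(x ^ 2) / 2) = 0 := by
  have e0 : ∀ x : ℝ, Polynomial.aeval x (Polynomial.hermite m) =
      ((Polynomial.hermite m).map (Int.castRingHom ℝ)).eval x := by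
    intro x; rw [Polynomial.eval_map]; rfl
  simp_rw [e0 _]
  rw [integral_hermite_mul, Polynomial.iterate_derivative_eq_zero]
  · simp
  · exact lt_of_le_of_lt Polynomial.natDegree_map_le (by simpa using hmn)

lemma integral_hermite_sq (n : ℕ) :
    ∫ x : ℝ, (Polynomial.aeval x (Polynomial.hermite n) *
      Polynomial.aeval x (Polynomial.hermite n)) * Real.exp (-(x ^ 2) / 2) =
      n.factorial * Real.sqrt (2 * Real.pi) := by
  have e0 : ∀ x : ℝ, Polynomial.aeval x (Polynomial.hermite n) =
      ((Polynomial.hermite n).map (Int.castRingHom ℝ)).eval x := by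
    intro x; rw [Polynomial.eval_map]; rfl
  have hd : ((Polynomial.hermite n).map (Int.castRingHom ℝ)).natDegree = n := by
    rw [Polynomial.Monic.natDegree_map (Polynomial.hermite_monic n), Polynomial.natDegree_hermite]
  have hc : Polynomial.derivative^[n] ((Polynomial.hermite n).map (Int.castRingHom ℝ)) =
      Polynomial.C (n.factorial : ℝ) := by
    have h0 : (Polynomial.derivative^[n]
        ((Polynomial.hermite n).map (Int.castRingHom ℝ))).natDegree = 0 := by
      have := Polynomial.natDegree_iterate_derivative
        ((Polynomial.hermite n).map (Int.castRingHom ℝ)) n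
      omega
    rw [Polynomial.eq_C_of_natDegree_eq_zero h0, Polynomial.coeff_iterate_derivative]
    simp [Nat.descFactorial_self]
  have hg := integral_gaussian (1 / 2)
  calc _ = ∫ x : ℝ, (Polynomial.aeval x (Polynomial.hermite n) *
        ((Polynomial.hermite n).map (Int.castRingHom ℝ)).eval x) * Real.exp (-(x ^ 2) / 2) := by
        simp_rw [e0]
    _ = ∫ x : ℝ, (n.factorial : ℝ) * Real.exp (-(1 / 2) * x ^ 2) := by
        rw [integral_hermite_mul, hc]
        congr 1; ext x
        rw [Polynomial.eval_C]; congr 2; ring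
    _ = _ := by
        rw [integral_const_mul, hg]; congr 2; ring

lemma hermiteFun_mul (m n : ℕ) (y : ℝ) : hermiteFun n y * hermiteFun m y =
    ((Real.sqrt (n.factorial * Real.sqrt Real.pi))⁻¹ *
      (Real.sqrt (m.factorial * Real.sqrt Real.pi))⁻¹) *
    ((Polynomial.aeval (Real.sqrt 2 * y) (Polynomial.hermite n) *
      Polynomial.aeval (Real.sqrt 2 * y) (Polynomial.hermite m)) *
      Real.exp (-((Real.sqrt 2 * y) ^ 2) / 2)) := by
  have : Real.exp (-((Real.sqrt 2 * y) ^ 2) / 2) =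
      Real.exp (-(y ^ 2) / 2) * Real.exp (-(y ^ 2) / 2) := by
    rw [← Real.exp_add, mul_pow, Real.sq_sqrt (by norm_num)]; congr 1; ring
  rw [this]; unfold hermiteFun; ring

lemma integrable_hermiteFun_mul (m n : ℕ) :
    Integrable (fun y => hermiteFun n y * hermiteFun m y) := by
  simp_rw [hermiteFun_mul]
  refine Integrable.const_mul ?_ _
  have h := integrable_poly_gaussian (((Polynomial.hermite n).map (Int.castRingHom ℝ)) *
    ((Polynomial.hermite m).map (Int.castRingHom ℝ)))
  have h2 := h.comp_mul_left' (R := Real.sqrt 2) (by positivity)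
  refine h2.congr (ae_of_all _ fun x => ?_)
  simp only [Polynomial.eval_mul, Polynomial.eval_map]
  rfl

/-- The Hermite functions are orthonormal in `L²(ℝ)`. -/
lemma integral_hermiteFun_mul (m n : ℕ) :
    ∫ y, hermiteFun n y * hermiteFun m y = if n = m then 1 else 0 := by
  simp_rw [hermiteFun_mul]
  rw [integral_const_mul]
  have hs := Measure.integral_comp_mul_left (fun x : ℝ =>
    (Polynomial.aeval x (Polynomial.hermite n) * Polynomial.aeval x (Polynomial.hermite m)) *
      Real.exp (-(x ^ 2) / 2)) (Real.sqrt 2)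
  rw [hs]
  split_ifs with h
  · subst h
    rw [integral_hermite_sq, abs_of_pos (by positivity), Real.sqrt_mul (by norm_num) Real.pi, smul_eq_mul,
      ← mul_inv, Real.mul_self_sqrt (by positivity)]
    have h1 : Real.sqrt 2 ≠ 0 := by positivity
    have h2 : Real.sqrt Real.pi ≠ 0 := by have := Real.pi_pos; positivity
    have h3 : (n.factorial : ℝ) ≠ 0 := by positivity
    field_simp
  · rcases lt_or_gt_of_ne h with h | h
    · have := integral_hermite_hermite_of_lt h
      simp_rw [mul_comm (Polynomial.aeval _ (Polynomial.hermite n))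
        (Polynomial.aeval _ (Polynomial.hermite m))]
      rw [this]; simp
    · rw [integral_hermite_hermite_of_lt h]; simp

/-- The Hilbert space `L²(ℝ²)`. -/
abbrev L2Plane : Type := Lp ℂ 2 (volume : Measure (ℝ × ℝ))

/-- The Hilbert space `ℓ²(ℕ₀)`. -/
abbrev SeqL2 : Type := lp (fun _ : ℕ => ℂ) 2

/-- `ζₙ(Λ) = √(n + 1/2 - Λ)`, principal branch (so that `Re ζₙ(Λ) > 0` for nonreal `Λ`). -/
def zeta (n : ℕ) (Λ : ℂ) : ℂ := ((n : ℂ) + 1 / 2 - Λ) ^ (1 / 2 : ℂ)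

/-- `ηₙ(x, Λ) = ± (n + 1/2)^(1/4) exp(∓ ζₙ(Λ) x)` for `± x > 0`. -/
def eta (n : ℕ) (Λ : ℂ) (x : ℝ) : ℂ :=
  if 0 < x then (((n : ℝ) + 1 / 2) ^ (1 / 4 : ℝ) : ℝ) * Complex.exp (-(zeta n Λ * x))
  else -((((n : ℝ) + 1 / 2) ^ (1 / 4 : ℝ) : ℝ) * Complex.exp (zeta n Λ * x))

lemma zeta_mul_self {Λ : ℂ} (hΛ : Λ.im ≠ 0) (n : ℕ) :
    zeta n Λ * zeta n Λ = (n : ℂ) + 1 / 2 - Λ := by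
  have hz : (n : ℂ) + 1 / 2 - Λ ≠ 0 := by
    intro h
    have := congrArg Complex.im h
    simp at this
    exact hΛ this
  unfold zeta
  rw [← Complex.cpow_add _ _ hz]
  norm_num

lemma zeta_re_pos {Λ : ℂ} (hΛ : Λ.im ≠ 0) (n : ℕ) : 0 < (zeta n Λ).re := by
  have him : ((n : ℂ) + 1 / 2 - Λ).im ≠ 0 := by simpa using hΛ
  have hz : (n : ℂ) + 1 / 2 - Λ ≠ 0 := fun h => him (by rw [h]; rfl)
  unfold zeta
  rw [Complex.cpow_def_of_ne_zero hz, Complex.exp_re]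
  have e : (Complex.log ((n : ℂ) + 1 / 2 - Λ) * (1 / 2)).im =
      ((n : ℂ) + 1 / 2 - Λ).arg / 2 := by
    have h2 : (1 / 2 : ℂ) = ((1 / 2 : ℝ) : ℂ) := by push_cast; rfl
    conv_lhs => rw [show Complex.log ((n : ℂ) + 1 / 2 - Λ) * (1 / 2) =
      ((1 / 2 : ℝ) : ℂ) * Complex.log ((n : ℂ) + 1 / 2 - Λ) by rw [← h2]; ring]
    rw [Complex.im_ofReal_mul, Complex.log_im]
    ring
  rw [e]
  have hne : ((n : ℂ) + 1 / 2 - Λ).arg ≠ Real.pi := by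
    intro h
    exact him (Complex.arg_eq_pi_iff.1 h).2
  have h1 := Complex.neg_pi_lt_arg ((n : ℂ) + 1 / 2 - Λ)
  have h2 := lt_of_le_of_ne (Complex.arg_le_pi ((n : ℂ) + 1 / 2 - Λ)) hne
  exact mul_pos (Real.exp_pos _)
    (Real.cos_pos_of_mem_Ioo ⟨by linarith, by linarith⟩)

lemma zeta_re_lower {Λ : ℂ} (hΛ : Λ.im ≠ 0) :
    BddAbove (Set.range fun n : ℕ => ((n : ℝ) + 1 / 2) ^ (1 / 2 : ℝ) / (zeta n Λ).re) := by
  refine Filter.IsBoundedUnder.bddAbove_range ⟨2, ?_⟩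
  rw [Filter.eventually_map]
  filter_upwards [(tendsto_natCast_atTop_atTop (R := ℝ)).eventually_ge_atTop (2 * Λ.re)] with n hn
  have hp := zeta_re_pos hΛ n
  rw [div_le_iff₀ hp, ← Real.sqrt_eq_rpow]
  refine Real.sqrt_le_iff.2 ⟨by positivity, ?_⟩
  have h := congrArg Complex.re (zeta_mul_self hΛ n)
  simp only [Complex.mul_re, Complex.sub_re, Complex.add_re, Complex.natCast_re] at h
  have h12 : (1 / 2 : ℂ).re = 1 / 2 := by norm_num
  rw [h12] at h
  nlinarith [mul_self_nonneg (zeta n Λ).im]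

lemma measurable_eta (n : ℕ) (Λ : ℂ) : Measurable (eta n Λ) := by
  unfold eta
  refine Measurable.ite measurableSet_Ioi ?_ ?_ <;> fun_prop

lemma norm_eta (n : ℕ) (Λ : ℂ) (x : ℝ) :
    ‖eta n Λ x‖ ^ 2 = ((n : ℝ) + 1 / 2) ^ (1 / 2 : ℝ) *
      Real.exp (-(2 * (zeta n Λ).re) * |x|) := by
  have hc : (((n : ℝ) + 1 / 2) ^ (1 / 4 : ℝ)) ^ 2 = ((n : ℝ) + 1 / 2) ^ (1 / 2 : ℝ) := by
    rw [← Real.rpow_natCast, ← Real.rpow_mul (by positivity)]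
    norm_num
  unfold eta
  split_ifs with h
  · rw [norm_mul, Complex.norm_exp, mul_pow, Complex.norm_real, Real.norm_of_nonneg (by positivity),
      hc, ← Real.exp_nat_mul, abs_of_pos h]
    congr 2; simp; ring
  · rw [norm_neg, norm_mul, Complex.norm_exp, mul_pow, Complex.norm_real,
      Real.norm_of_nonneg (by positivity), hc, ← Real.exp_nat_mul, abs_of_nonpos (not_lt.1 h)]
    congr 2; simp; ring

lemma integrable_norm_eta {Λ : ℂ} (hΛ : Λ.im ≠ 0) (n : ℕ) :
    Integrable (fun x => ‖eta n Λ x‖ ^ 2) := by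
  simp_rw [norm_eta]
  refine Integrable.const_mul ?_ _
  have ha : -(2 * (zeta n Λ).re) < 0 := by have := zeta_re_pos hΛ n; linarith
  rw [← integrableOn_univ, ← Set.Iic_union_Ioi (a := (0 : ℝ))]
  refine IntegrableOn.union ?_ ?_
  · refine (integrableOn_exp_mul_Iic (neg_pos.2 ha) 0).congr_fun (fun x hx => ?_) measurableSet_Iic
    simp only [Set.mem_Iic] at hx
    simp only [abs_of_nonpos hx]; congr 1; ring
  · refine (integrableOn_exp_mul_Ioi ha 0).congr_fun (fun x hx => ?_) measurableSet_Ioi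
    simp only [Set.mem_Ioi] at hx
    simp only [abs_of_pos hx]

lemma integral_norm_eta {Λ : ℂ} (hΛ : Λ.im ≠ 0) (n : ℕ) :
    ∫ x, ‖eta n Λ x‖ ^ 2 = ((n : ℝ) + 1 / 2) ^ (1 / 2 : ℝ) / (zeta n Λ).re := by
  have hp := zeta_re_pos hΛ n
  have ha : -(2 * (zeta n Λ).re) < 0 := by linarith
  simp_rw [norm_eta]
  rw [integral_const_mul, integral_comp_abs (f := fun x => Real.exp (-(2 * (zeta n Λ).re) * x)),
    integral_exp_mul_Ioi ha]
  have := hp.ne'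
  simp
  field_simp

/-- `ηₙ(x, Λ) χₙ(y)`. -/
def modeFun (n : ℕ) (Λ : ℂ) (p : ℝ × ℝ) : ℂ := eta n Λ p.1 * (hermiteFun n p.2 : ℂ)

lemma measurable_modeFun (n : ℕ) (Λ : ℂ) : Measurable (modeFun n Λ) := by
  have h1 := measurable_eta n Λ
  have h2 := (continuous_hermiteFun n).measurable
  unfold modeFun
  fun_prop

lemma norm_modeFun_sq (n : ℕ) (Λ : ℂ) (p : ℝ × ℝ) :
    ‖modeFun n Λ p‖ ^ 2 = ‖eta n Λ p.1‖ ^ 2 * (hermiteFun n p.2 * hermiteFun n p.2) := by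
  unfold modeFun
  rw [norm_mul, mul_pow, Complex.norm_real, Real.norm_eq_abs, sq_abs]
  ring

lemma memLp_modeFun {Λ : ℂ} (hΛ : Λ.im ≠ 0) (n : ℕ) :
    MemLp (modeFun n Λ) 2 (volume : Measure (ℝ × ℝ)) := by
  rw [memLp_two_iff_integrable_sq_norm (measurable_modeFun n Λ).aestronglyMeasurable]
  simp_rw [norm_modeFun_sq]
  exact (integrable_norm_eta hΛ n).mul_prod (integrable_hermiteFun_mul n n)

/-- `ηₙ(·, Λ) χₙ` as an element of `L²(ℝ²)`. -/
def mode {Λ : ℂ} (hΛ : Λ.im ≠ 0) (n : ℕ) : L2Plane := (memLp_modeFun hΛ n).toLp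

lemma inner_mode {Λ : ℂ} (hΛ : Λ.im ≠ 0) {m n : ℕ} (hmn : m ≠ n) :
    inner ℂ (mode hΛ m) (mode hΛ n) = 0 := by
  rw [L2.inner_def]
  have : ∫ p : ℝ × ℝ, inner ℂ (mode hΛ m p) (mode hΛ n p) =
      ∫ p : ℝ × ℝ, (eta n Λ p.1 * conj (eta m Λ p.1)) *
        ((hermiteFun n p.2 * hermiteFun m p.2 : ℝ) : ℂ) := by
    refine integral_congr_ae ?_
    filter_upwards [(memLp_modeFun hΛ m).coeFn_toLp, (memLp_modeFun hΛ n).coeFn_toLp] with p h1 h2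
    unfold mode
    rw [h1, h2]
    simp only [modeFun, RCLike.inner_apply, map_mul, Complex.conj_ofReal, Complex.ofReal_mul]
    ring
  rw [this, Measure.volume_eq_prod,
    integral_prod_mul (fun x => eta n Λ x * conj (eta m Λ x))
      (fun y => ((hermiteFun n y * hermiteFun m y : ℝ) : ℂ)),
    integral_complex_ofReal, integral_hermiteFun_mul, if_neg hmn.symm]
  simp

lemma norm_mode_sq {Λ : ℂ} (hΛ : Λ.im ≠ 0) (n : ℕ) :
    ‖mode hΛ n‖ ^ 2 = ((n : ℝ) + 1 / 2) ^ (1 / 2 : ℝ) / (zeta n Λ).re := by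
  have h := @inner_self_eq_norm_sq_to_K ℂ L2Plane _ _ _ (mode hΛ n)
  rw [L2.inner_def] at h
  have h2 : ∫ p : ℝ × ℝ, inner ℂ (mode hΛ n p) (mode hΛ n p) =
      ((∫ p : ℝ × ℝ, ‖eta n Λ p.1‖ ^ 2 * (hermiteFun n p.2 * hermiteFun n p.2) : ℝ) : ℂ) := by
    rw [← integral_complex_ofReal]
    refine integral_congr_ae ?_
    filter_upwards [(memLp_modeFun hΛ n).coeFn_toLp] with p h1
    unfold mode
    rw [h1, inner_self_eq_norm_sq_to_K, ← norm_modeFun_sq]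
    push_cast
    rfl
  have h3 : ∫ p : ℝ × ℝ, ‖eta n Λ p.1‖ ^ 2 * (hermiteFun n p.2 * hermiteFun n p.2) =
      ((n : ℝ) + 1 / 2) ^ (1 / 2 : ℝ) / (zeta n Λ).re := by
    rw [Measure.volume_eq_prod, integral_prod_mul (fun x => ‖eta n Λ x‖ ^ 2)
      (fun y => hermiteFun n y * hermiteFun n y), integral_norm_eta hΛ,
      integral_hermiteFun_mul, if_pos rfl, mul_one]
  rw [h2, h3] at h
  rw [← RCLike.ofReal_pow] at h
  exact (Complex.ofReal_injective h).symm

lemma norm_sum_mode {Λ : ℂ} (hΛ : Λ.im ≠ 0) (s : Finset ℕ) (X : ℕ → ℂ) :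
    ‖∑ n ∈ s, X n • mode hΛ n‖ ^ 2 = ∑ n ∈ s, ‖X n‖ ^ 2 * ‖mode hΛ n‖ ^ 2 := by
  classical
  induction s using Finset.induction_on with
  | empty => simp
  | insert a s ha ih =>
    rw [Finset.sum_insert ha, Finset.sum_insert ha, ← ih, sq, sq ‖∑ n ∈ s, X n • mode hΛ n‖,
      norm_add_sq_eq_norm_sq_add_norm_sq_of_inner_eq_zero (𝕜 := ℂ), norm_smul]
    · ring
    · rw [inner_sum]
      refine Finset.sum_eq_zero fun i hi => ?_
      rw [inner_smul_left, inner_smul_right, inner_mode hΛ (by rintro rfl; exact ha hi)]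
      simp

lemma exists_bound_mode {Λ : ℂ} (hΛ : Λ.im ≠ 0) :
    ∃ C : ℝ, 0 ≤ C ∧ ∀ (s : Finset ℕ) (X : ℕ → ℂ),
      ‖∑ n ∈ s, X n • mode hΛ n‖ ^ 2 ≤ C ^ 2 * ∑ n ∈ s, ‖X n‖ ^ 2 := by
  obtain ⟨C, hC⟩ := zeta_re_lower hΛ
  have hC' : ∀ n, ‖mode hΛ n‖ ^ 2 ≤ C := fun n => by
    rw [norm_mode_sq]; exact hC ⟨n, rfl⟩
  have hC0 : 0 ≤ C := (sq_nonneg _).trans (hC' 0)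
  refine ⟨Real.sqrt C, Real.sqrt_nonneg _, fun s X => ?_⟩
  rw [norm_sum_mode, Real.sq_sqrt hC0, Finset.mul_sum]
  refine Finset.sum_le_sum fun n _ => ?_
  rw [mul_comm]
  exact mul_le_mul_of_nonneg_right (hC' n) (sq_nonneg _)

lemma summable_sq (X : SeqL2) : Summable fun n => ‖X n‖ ^ 2 := by
  have := (lp.memℓp X).summable (by norm_num)
  simpa using this

lemma summable_mode {Λ : ℂ} (hΛ : Λ.im ≠ 0) (X : SeqL2) :
    Summable fun n => X n • mode hΛ n := by
  obtain ⟨C, hC0, hC⟩ := exists_bound_mode hΛ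
  rw [summable_iff_vanishing_norm]
  intro ε hε
  obtain ⟨s, hs⟩ := summable_iff_vanishing_norm.1 (summable_sq X) ((ε / (C + 1)) ^ 2)
    (by positivity)
  refine ⟨s, fun t ht => ?_⟩
  have h1 := hs t ht
  rw [Real.norm_of_nonneg (Finset.sum_nonneg fun _ _ => sq_nonneg _)] at h1
  refine lt_of_pow_lt_pow_left₀ 2 hε.le ((hC t X).trans_lt ?_)
  calc C ^ 2 * ∑ n ∈ t, ‖X n‖ ^ 2 ≤ (C + 1) ^ 2 * ∑ n ∈ t, ‖X n‖ ^ 2 := by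
        refine mul_le_mul_of_nonneg_right ?_ (Finset.sum_nonneg fun _ _ => sq_nonneg _)
        exact pow_le_pow_left₀ hC0 (by linarith) 2
    _ < (C + 1) ^ 2 * (ε / (C + 1)) ^ 2 := by
        refine mul_lt_mul_of_pos_left h1 (by positivity)
    _ = ε ^ 2 := by field_simp

/-- The bounded operator `T(Λ) : ℓ²(ℕ₀) → L²(ℝ²)`, `T(Λ){Xₙ} = ∑ₙ Xₙ ηₙ(·, Λ) χₙ`, for
nonreal `Λ`. -/
def opT {Λ : ℂ} (hΛ : Λ.im ≠ 0) : SeqL2 →L[ℂ] L2Plane :=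
  LinearMap.mkContinuousOfExistsBound
    { toFun := fun X => ∑' n, X n • mode hΛ n
      map_add' := fun X Y => by
        rw [← (summable_mode hΛ X).tsum_add (summable_mode hΛ Y)]
        simp only [lp.coeFn_add, Pi.add_apply, add_smul]
      map_smul' := fun c X => by
        rw [RingHom.id_apply, ← (summable_mode hΛ X).tsum_const_smul c]
        simp only [lp.coeFn_smul, Pi.smul_apply, smul_assoc] }
    (by
      obtain ⟨C, hC0, hC⟩ := exists_bound_mode hΛ
      refine ⟨C, fun X => ?_⟩
      have hX : ‖X‖ ^ 2 = ∑' n, ‖X n‖ ^ 2 := by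
        have := lp.norm_rpow_eq_tsum (p := 2) (by norm_num) X
        simpa using this
      refine le_of_tendsto (summable_mode hΛ X).hasSum.norm (Eventually.of_forall fun s => ?_)
      refine le_of_sq_le_sq ?_ (by positivity)
      rw [mul_pow, hX]
      refine (hC s X).trans (mul_le_mul_of_nonneg_left ?_ (sq_nonneg _))
      exact (summable_sq X).sum_le_tsum s fun _ _ => sq_nonneg _)

/-- The plane without the line `x = 0`: the disjoint union of the two open half-planes. -/
def offLine : Set (ℝ × ℝ) := {p | p.1 ≠ 0}

lemma isOpen_offLine : IsOpen offLine := isOpen_ne_fun continuous_fst continuous_const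

lemma ae_mem_offLine : ∀ᵐ p : ℝ × ℝ, p ∈ offLine := by
  rw [Measure.volume_eq_prod]
  exact Measure.quasiMeasurePreserving_fst.ae (Measure.ae_ne volume (0 : ℝ))

/-- `g` is the weak derivative of `f` in the direction `v` on `ℝ² ∖ {x = 0}`, that is, on both open
half-planes. -/
def HasWeakDeriv (v : ℝ × ℝ) (f g : ℝ × ℝ → ℂ) : Prop :=
  ∀ φ : ℝ × ℝ → ℝ, ContDiff ℝ ((⊤ : ℕ∞) : WithTop ℕ∞) φ → HasCompactSupport φ →
    tsupport φ ⊆ offLine → ∫ p, (fderiv ℝ φ p v) • f p = -∫ p, φ p • g p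

/-- `f ∈ H²((0,∞) × ℝ) ⊕ H²((-∞,0) × ℝ)`, with its weak derivatives of order at most two (a
function on `ℝ²` being identified with the pair of its restrictions to the half-planes). -/
structure IsH2 (f fx fy fxx fxy fyy : ℝ × ℝ → ℂ) : Prop where
  memLp : MemLp f 2
  memLp_x : MemLp fx 2
  memLp_y : MemLp fy 2
  memLp_xx : MemLp fxx 2
  memLp_xy : MemLp fxy 2
  memLp_yy : MemLp fyy 2
  deriv_x : HasWeakDeriv (1, 0) f fx
  deriv_y : HasWeakDeriv (0, 1) f fy
  deriv_xx : HasWeakDeriv (1, 0) fx fxx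
  deriv_xy : HasWeakDeriv (0, 1) fx fxy
  deriv_yy : HasWeakDeriv (0, 1) fy fyy

/-- `u ∈ L²(ℝ)` is the limit of `f(x, ·)` in `L²(ℝ)`, in the sense of averages over the strips
`I ε × ℝ` of width `ε → 0+` (so that the choice of a representative of `f` does not matter). -/
def IsStripTrace (I : ℝ → Set ℝ) (f : ℝ × ℝ → ℂ) (u : ℝ → ℂ) : Prop :=
  MemLp u 2 ∧
    Tendsto (fun ε : ℝ => ENNReal.ofReal ε⁻¹ *
      ∫⁻ p in I ε ×ˢ (Set.univ : Set ℝ), ‖f p - u p.2‖ₑ ^ 2) (𝓝[>] 0) (𝓝 0)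

/-- `u = f(0+, ·)`, the trace of `f` on the line `x = 0` from the right. -/
def IsRightTrace (f : ℝ × ℝ → ℂ) (u : ℝ → ℂ) : Prop :=
  IsStripTrace (fun ε => Set.Ioo 0 ε) f u

/-- `u = f(0-, ·)`, the trace of `f` on the line `x = 0` from the left. -/
def IsLeftTrace (f : ℝ × ℝ → ℂ) (u : ℝ → ℂ) : Prop :=
  IsStripTrace (fun ε => Set.Ioo (-ε) 0) f u

/-- `Ψ` belongs to `H²((0,∞) × ℝ) ⊕ H²((-∞,0) × ℝ)` and satisfies the matching conditions
`Ψ(0+,y) - Ψ(0-,y) = (β/y) ∂ₓΨ(0+,y)` and `∂ₓΨ(0+,y) = ∂ₓΨ(0-,y)`, the function `y²Ψ` is square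
integrable, and `G = -∂ₓ²Ψ + (1/2)(-∂ᵧ²Ψ + y²Ψ)` off the line `x = 0`. -/
def IsHamiltonianPair (β : ℝ) (Ψ G : L2Plane) : Prop :=
  ∃ fx fy fxx fxy fyy : ℝ × ℝ → ℂ, ∃ ur ul dr dl : ℝ → ℂ,
    IsH2 Ψ fx fy fxx fxy fyy ∧
    MemLp (fun p : ℝ × ℝ => (p.2 : ℂ) ^ 2 * Ψ p) 2 ∧
    IsRightTrace Ψ ur ∧ IsLeftTrace Ψ ul ∧ IsRightTrace fx dr ∧ IsLeftTrace fx dl ∧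
    (∀ᵐ y : ℝ, ur y - ul y = (β / y : ℂ) * dr y) ∧
    (∀ᵐ y : ℝ, dr y = dl y) ∧
    ∀ᵐ p : ℝ × ℝ, G p = -fxx p + 1 / 2 * (-fyy p + (p.2 : ℂ) ^ 2 * Ψ p)

lemma integrable_test_smul {φ : ℝ × ℝ → ℝ} (hφ : Continuous φ) (hc : HasCompactSupport φ)
    {f : ℝ × ℝ → ℂ} (hf : MemLp f 2) : Integrable (fun p => φ p • f p) :=
  (hf.locallyIntegrable (by norm_num)).integrable_smul_left_of_hasCompactSupport hφ hc

lemma integrable_fderiv_smul {φ : ℝ × ℝ → ℝ} (hφ : ContDiff ℝ ((⊤ : ℕ∞) : WithTop ℕ∞) φ)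
    (hc : HasCompactSupport φ) (v : ℝ × ℝ) {f : ℝ × ℝ → ℂ} (hf : MemLp f 2) :
    Integrable (fun p => (fderiv ℝ φ p v) • f p) := by
  refine integrable_test_smul ?_ ?_ hf
  · exact (hφ.continuous_fderiv (by simp)).clm_apply continuous_const
  · exact hc.fderiv_apply (𝕜 := ℝ) v

lemma HasWeakDeriv.congr {v : ℝ × ℝ} {f f' g g' : ℝ × ℝ → ℂ} (h : HasWeakDeriv v f g)
    (hf : f =ᵐ[volume] f') (hg : g =ᵐ[volume] g') : HasWeakDeriv v f' g' := by
  intro φ h1 h2 h3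
  have e1 : ∫ p, (fderiv ℝ φ p v) • f' p = ∫ p, (fderiv ℝ φ p v) • f p :=
    integral_congr_ae (hf.mono fun p hp => by simp only [hp])
  have e2 : ∫ p, φ p • g' p = ∫ p, φ p • g p :=
    integral_congr_ae (hg.mono fun p hp => by simp only [hp])
  rw [e1, e2, h φ h1 h2 h3]

lemma HasWeakDeriv.add {v : ℝ × ℝ} {f f' g g' : ℝ × ℝ → ℂ} (h : HasWeakDeriv v f g)
    (h' : HasWeakDeriv v f' g') (hf : MemLp f 2) (hf' : MemLp f' 2) (hg : MemLp g 2)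
    (hg' : MemLp g' 2) : HasWeakDeriv v (f + f') (g + g') := by
  intro φ h1 h2 h3
  simp only [Pi.add_apply, smul_add]
  rw [integral_add (integrable_fderiv_smul h1 h2 v hf) (integrable_fderiv_smul h1 h2 v hf'),
    integral_add (integrable_test_smul h1.continuous h2 hg)
      (integrable_test_smul h1.continuous h2 hg'), h φ h1 h2 h3, h' φ h1 h2 h3]
  ring

lemma HasWeakDeriv.const_smul {v : ℝ × ℝ} {f g : ℝ × ℝ → ℂ} (h : HasWeakDeriv v f g) (c : ℂ) :
    HasWeakDeriv v (c • f) (c • g) := by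
  intro φ h1 h2 h3
  simp only [Pi.smul_apply, smul_comm _ c]
  rw [integral_smul, integral_smul, h φ h1 h2 h3, smul_neg]

/-- The weak derivative of the zero function vanishes. -/
lemma HasWeakDeriv.eq_zero {v : ℝ × ℝ} {f g : ℝ × ℝ → ℂ} (h : HasWeakDeriv v f g)
    (hg : MemLp g 2) (hf : f =ᵐ[volume] 0) : g =ᵐ[volume] 0 := by
  have := isOpen_offLine.ae_eq_zero_of_integral_contDiff_smul_eq_zero (μ := volume)
    ((hg.locallyIntegrable (by norm_num)).locallyIntegrableOn offLine) (fun φ h1 h2 h3 => by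
      have e := h φ h1 h2 h3
      rw [integral_eq_zero_of_ae (hf.mono fun p hp => by simp [hp])] at e
      exact (neg_eq_zero.1 e.symm))
  filter_upwards [this, ae_mem_offLine] with p h1 h2 using h1 h2

lemma IsH2.add {f fx fy fxx fxy fyy g gx gy gxx gxy gyy : ℝ × ℝ → ℂ}
    (h : IsH2 f fx fy fxx fxy fyy) (k : IsH2 g gx gy gxx gxy gyy) :
    IsH2 (f + g) (fx + gx) (fy + gy) (fxx + gxx) (fxy + gxy) (fyy + gyy) where
  memLp := h.memLp.add k.memLp
  memLp_x := h.memLp_x.add k.memLp_x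
  memLp_y := h.memLp_y.add k.memLp_y
  memLp_xx := h.memLp_xx.add k.memLp_xx
  memLp_xy := h.memLp_xy.add k.memLp_xy
  memLp_yy := h.memLp_yy.add k.memLp_yy
  deriv_x := h.deriv_x.add k.deriv_x h.memLp k.memLp h.memLp_x k.memLp_x
  deriv_y := h.deriv_y.add k.deriv_y h.memLp k.memLp h.memLp_y k.memLp_y
  deriv_xx := h.deriv_xx.add k.deriv_xx h.memLp_x k.memLp_x h.memLp_xx k.memLp_xx
  deriv_xy := h.deriv_xy.add k.deriv_xy h.memLp_x k.memLp_x h.memLp_xy k.memLp_xy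
  deriv_yy := h.deriv_yy.add k.deriv_yy h.memLp_y k.memLp_y h.memLp_yy k.memLp_yy

lemma IsH2.const_smul {f fx fy fxx fxy fyy : ℝ × ℝ → ℂ} (h : IsH2 f fx fy fxx fxy fyy) (c : ℂ) :
    IsH2 (c • f) (c • fx) (c • fy) (c • fxx) (c • fxy) (c • fyy) where
  memLp := h.memLp.const_smul c
  memLp_x := h.memLp_x.const_smul c
  memLp_y := h.memLp_y.const_smul c
  memLp_xx := h.memLp_xx.const_smul c
  memLp_xy := h.memLp_xy.const_smul c
  memLp_yy := h.memLp_yy.const_smul c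
  deriv_x := h.deriv_x.const_smul c
  deriv_y := h.deriv_y.const_smul c
  deriv_xx := h.deriv_xx.const_smul c
  deriv_xy := h.deriv_xy.const_smul c
  deriv_yy := h.deriv_yy.const_smul c

lemma IsH2.congr {f f' fx fy fxx fxy fyy : ℝ × ℝ → ℂ} (h : IsH2 f fx fy fxx fxy fyy)
    (hf : f =ᵐ[volume] f') : IsH2 f' fx fy fxx fxy fyy where
  memLp := h.memLp.ae_eq hf
  memLp_x := h.memLp_x
  memLp_y := h.memLp_y
  memLp_xx := h.memLp_xx
  memLp_xy := h.memLp_xy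
  memLp_yy := h.memLp_yy
  deriv_x := h.deriv_x.congr hf .rfl
  deriv_y := h.deriv_y.congr hf .rfl
  deriv_xx := h.deriv_xx
  deriv_xy := h.deriv_xy
  deriv_yy := h.deriv_yy

lemma IsH2.zero : IsH2 0 0 0 0 0 0 := by
  have h0 : MemLp (0 : ℝ × ℝ → ℂ) 2 := MemLp.zero
  have hd : ∀ v, HasWeakDeriv v 0 0 := fun v φ _ _ _ => by simp
  exact ⟨h0, h0, h0, h0, h0, h0, hd _, hd _, hd _, hd _, hd _⟩

lemma IsStripTrace.congr {I : ℝ → Set ℝ} {f f' : ℝ × ℝ → ℂ} {u : ℝ → ℂ} (h : IsStripTrace I f u)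
    (hf : f =ᵐ[volume] f') : IsStripTrace I f' u := by
  refine ⟨h.1, h.2.congr fun ε => ?_⟩
  congr 1
  exact lintegral_congr_ae ((ae_restrict_of_ae hf).mono fun p hp => by simp only [hp])

lemma IsStripTrace.zero (I : ℝ → Set ℝ) : IsStripTrace I 0 0 := by
  refine ⟨MemLp.zero, ?_⟩
  simp

lemma IsStripTrace.add {I : ℝ → Set ℝ} {f g : ℝ × ℝ → ℂ} {u w : ℝ → ℂ} (h : IsStripTrace I f u)
    (k : IsStripTrace I g w) (hf : MemLp f 2) : IsStripTrace I (f + g) (u + w) := by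
  refine ⟨h.1.add k.1, ?_⟩
  have hlim := ENNReal.Tendsto.const_mul (a := (2 : ENNReal)) (h.2.add k.2) (Or.inr (by simp))
  rw [add_zero, mul_zero] at hlim
  refine tendsto_of_tendsto_of_tendsto_of_le_of_le tendsto_const_nhds hlim (fun _ => zero_le)
    fun ε => ?_
  have hu : AEStronglyMeasurable (fun p : ℝ × ℝ => u p.2) volume := by
    rw [Measure.volume_eq_prod]
    exact h.1.aestronglyMeasurable.comp_quasiMeasurePreserving
      Measure.quasiMeasurePreserving_snd
  have hm : AEMeasurable (fun p : ℝ × ℝ => ‖f p - u p.2‖ₑ ^ 2)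
      (volume.restrict (I ε ×ˢ (Set.univ : Set ℝ))) :=
    ((hf.aestronglyMeasurable.sub hu).enorm.pow_const 2).restrict
  simp only
  rw [← mul_add, ← lintegral_add_left' hm, mul_left_comm,
    ← lintegral_const_mul' (2 : ENNReal) _ (by simp)]
  refine mul_le_mul_right (lintegral_mono fun p => ?_) _
  calc ‖(f + g) p - (u + w) p.2‖ₑ ^ 2 = ‖(f p - u p.2) + (g p - w p.2)‖ₑ ^ 2 := by
        simp only [Pi.add_apply]; congr 2; ring
    _ ≤ (‖f p - u p.2‖ₑ + ‖g p - w p.2‖ₑ) ^ 2 := by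
        gcongr; exact enorm_add_le _ _
    _ ≤ _ := by
        have := ENNReal.rpow_add_le_mul_rpow_add_rpow (‖f p - u p.2‖ₑ) (‖g p - w p.2‖ₑ)
          (p := 2) (by norm_num)
        norm_num at this
        exact this

lemma IsStripTrace.const_smul {I : ℝ → Set ℝ} {f : ℝ × ℝ → ℂ} {u : ℝ → ℂ}
    (h : IsStripTrace I f u) (c : ℂ) : IsStripTrace I (c • f) (c • u) := by
  refine ⟨h.1.const_smul c, ?_⟩
  have hlim := ENNReal.Tendsto.const_mul (a := ‖c‖ₑ ^ 2) h.2 (Or.inr (by simp))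
  rw [mul_zero] at hlim
  refine hlim.congr fun ε => ?_
  rw [mul_left_comm, ← lintegral_const_mul' _ _ (by simp)]
  congr 2
  ext p
  rw [← mul_pow, ← enorm_mul]
  simp only [Pi.smul_apply, smul_eq_mul, mul_sub]

/-- The graph of the Hamiltonian on its `H²` domain. -/
def hamiltonianGraph (β : ℝ) : Submodule ℂ (L2Plane × L2Plane) where
  carrier := {q | IsHamiltonianPair β q.1 q.2}
  zero_mem' := by
    have h0 : (0 : ℝ × ℝ → ℂ) =ᵐ[volume] ((0 : L2Plane) : ℝ × ℝ → ℂ) := (Lp.coeFn_zero _ _ _).symm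
    refine ⟨0, 0, 0, 0, 0, 0, 0, 0, 0, IsH2.zero.congr h0, ?_, (IsStripTrace.zero _).congr h0,
      (IsStripTrace.zero _).congr h0, IsStripTrace.zero _, IsStripTrace.zero _, by simp, by simp,
      ?_⟩
    · exact (MemLp.zero (ε := ℂ)).ae_eq (h0.mono fun p hp => by simp)
    · filter_upwards with p
      simp
  add_mem' := by
    rintro ⟨Ψ, G⟩ ⟨Ψ', G'⟩ ⟨fx, fy, fxx, fxy, fyy, ur, ul, dr, dl, h, hy, t1, t2, t3, t4, c1, c2, e⟩
      ⟨fx', fy', fxx', fxy', fyy', ur', ul', dr', dl', h', hy', t1', t2', t3', t4', c1', c2', e'⟩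
    have ha := (Lp.coeFn_add Ψ Ψ').symm
    refine ⟨fx + fx', fy + fy', fxx + fxx', fxy + fxy', fyy + fyy', ur + ur', ul + ul', dr + dr',
      dl + dl', (h.add h').congr ha, ?_, (t1.add t1' h.memLp).congr ha,
      (t2.add t2' h.memLp).congr ha, t3.add t3' h.memLp_x, t4.add t4' h.memLp_x, ?_, ?_, ?_⟩
    · refine (hy.add hy').ae_eq (ha.mono fun p hp => ?_)
      simp only [Prod.mk_add_mk, ← hp, Pi.add_apply]
      ring
    · filter_upwards [c1, c1'] with y h1 h2
      simp only [Pi.add_apply]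
      linear_combination h1 + h2
    · filter_upwards [c2, c2'] with y h1 h2
      simp only [Pi.add_apply, h1, h2]
    · filter_upwards [e, e', ha, Lp.coeFn_add G G'] with p h1 h2 h3 h4
      simp only [Prod.mk_add_mk] at *
      rw [← h3, h4]
      simp only [Pi.add_apply, h1, h2]
      ring
  smul_mem' := by
    rintro c ⟨Ψ, G⟩ ⟨fx, fy, fxx, fxy, fyy, ur, ul, dr, dl, h, hy, t1, t2, t3, t4, c1, c2, e⟩
    have ha := (Lp.coeFn_smul c Ψ).symm
    refine ⟨c • fx, c • fy, c • fxx, c • fxy, c • fyy, c • ur, c • ul, c • dr, c • dl,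
      (h.const_smul c).congr ha, ?_, (t1.const_smul c).congr ha, (t2.const_smul c).congr ha,
      t3.const_smul c, t4.const_smul c, ?_, ?_, ?_⟩
    · refine (hy.const_smul c).ae_eq (ha.mono fun p hp => ?_)
      simp only [Prod.smul_mk, ← hp, Pi.smul_apply, smul_eq_mul]
      ring
    · filter_upwards [c1] with y h1
      simp only [Pi.smul_apply, smul_eq_mul]
      linear_combination c * h1
    · filter_upwards [c2] with y h1
      simp only [Pi.smul_apply, h1]
    · filter_upwards [e, ha, Lp.coeFn_smul c G] with p h1 h3 h4
      simp only [Prod.smul_mk] at *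
      rw [← h3, h4]
      simp only [Pi.smul_apply, smul_eq_mul, h1]
      ring

lemma hamiltonianGraph_snd_eq_zero (β : ℝ) :
    ∀ q ∈ hamiltonianGraph β, q.1 = 0 → q.2 = 0 := by
  rintro ⟨Ψ, G⟩ ⟨fx, fy, fxx, fxy, fyy, ur, ul, dr, dl, h, -, -, -, -, -, -, -, e⟩ h0
  simp only at h0
  subst h0
  have hz : ((0 : L2Plane) : ℝ × ℝ → ℂ) =ᵐ[volume] 0 := Lp.coeFn_zero _ _ _
  have hx := h.deriv_x.eq_zero h.memLp_x hz
  have hy := h.deriv_y.eq_zero h.memLp_y hz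
  have hxx := h.deriv_xx.eq_zero h.memLp_xx hx
  have hyy := h.deriv_yy.eq_zero h.memLp_yy hy
  refine Lp.eq_zero_iff_ae_eq_zero.2 ?_
  filter_upwards [e, hz, hxx, hyy] with p h1 h2 h3 h4
  rw [h1, h2, h3, h4]
  simp

/-- The differential operator `-∂ₓ² + (1/2)(-∂ᵧ² + y²)` in `L²(ℝ²)` on the functions from
`H²((0,∞) × ℝ) ⊕ H²((-∞,0) × ℝ)` with `y²Ψ ∈ L²(ℝ²)` that satisfy the matching conditions. -/
def hamiltonianCore (β : ℝ) : L2Plane →ₗ.[ℂ] L2Plane := (hamiltonianGraph β).toLinearPMap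

lemma mem_graph_hamiltonianCore (β : ℝ) (Ψ G : L2Plane) :
    (Ψ, G) ∈ (hamiltonianCore β).graph ↔ IsHamiltonianPair β Ψ G := by
  unfold hamiltonianCore
  rw [Submodule.toLinearPMap_graph_eq _ fun q hq => hamiltonianGraph_snd_eq_zero β q hq]
  rfl

/-- The operator `H_β`, the closure of the differential operator `hamiltonianCore β`: for small
`β > 0` the `H²` domain is not closed, and the self-adjoint operator is the closure. For `β = 0` the
matching conditions say that `Ψ` and `∂ₓΨ` have no jump, and `H_0` is the free operator. -/
def hamiltonian (β : ℝ) : L2Plane →ₗ.[ℂ] L2Plane := (hamiltonianCore β).closure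

/-- `dₙ = n^(1/2) (n + 1/2)^(1/4) (n - 1/2)^(1/4)` for `n ≥ 1`, and `d₀ = 0`. -/
def jacobiD (n : ℕ) : ℝ :=
  if n = 0 then 0
  else (n : ℝ) ^ (1 / 2 : ℝ) * ((n : ℝ) + 1 / 2) ^ (1 / 4 : ℝ) * ((n : ℝ) - 1 / 2) ^ (1 / 4 : ℝ)

/-- `yₙ(Λ) = (n + 1/2)^(1/2) ζₙ(Λ)`. -/
def jacobiY (n : ℕ) (Λ : ℂ) : ℂ := ((((n : ℝ) + 1 / 2) ^ (1 / 2 : ℝ) : ℝ) : ℂ) * zeta n Λ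

/-- The sequence `dₙ₊₁ Xₙ₊₁ + 2 μ yₙ(Λ) Xₙ + dₙ Xₙ₋₁`; for `n = 0` the last term is absent
(`d₀ = 0`). -/
def jacobiSeq (Λ : ℂ) (μ : ℝ) (X : ℕ → ℂ) (n : ℕ) : ℂ :=
  jacobiD (n + 1) * X (n + 1) + 2 * μ * jacobiY n Λ * X n + jacobiD n * X (n - 1)

lemma jacobiSeq_add (Λ : ℂ) (μ : ℝ) (X Y : ℕ → ℂ) :
    jacobiSeq Λ μ (X + Y) = jacobiSeq Λ μ X + jacobiSeq Λ μ Y := by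
  ext n; simp only [jacobiSeq, Pi.add_apply]; ring

lemma jacobiSeq_smul (Λ : ℂ) (μ : ℝ) (c : ℂ) (X : ℕ → ℂ) :
    jacobiSeq Λ μ (c • X) = c • jacobiSeq Λ μ X := by
  ext n; simp only [jacobiSeq, Pi.smul_apply, smul_eq_mul]; ring

/-- The Jacobi operator `J(Λ, μ)` in `ℓ²(ℕ₀)`, on its natural (maximal) domain of all `X ∈ ℓ²(ℕ₀)`
that the Jacobi matrix maps into `ℓ²(ℕ₀)`. -/
def jacobi (Λ : ℂ) (μ : ℝ) : SeqL2 →ₗ.[ℂ] SeqL2 where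
  domain :=
    { carrier := {X | Memℓp (jacobiSeq Λ μ X) 2}
      zero_mem' := by
        have : jacobiSeq Λ μ ((0 : SeqL2) : ℕ → ℂ) = 0 := by
          ext n; simp [jacobiSeq]
        rw [Set.mem_ofPred_eq, this]
        exact zero_memℓp
      add_mem' := fun {X Y} hX hY => by
        rw [Set.mem_ofPred_eq, lp.coeFn_add, jacobiSeq_add]
        exact hX.add hY
      smul_mem' := fun c X hX => by
        rw [Set.mem_ofPred_eq, lp.coeFn_smul, jacobiSeq_smul]
        exact hX.const_smul c }
  toFun :=
    { toFun := fun X => ⟨jacobiSeq Λ μ (X : SeqL2), X.2⟩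
      map_add' := fun X Y => by
        ext n
        exact congrFun (jacobiSeq_add Λ μ (X : SeqL2) (Y : SeqL2)) n
      map_smul' := fun c X => by
        ext n
        exact congrFun (jacobiSeq_smul Λ μ c (X : SeqL2)) n }

/-- The bounded operator `R` is `(A - z)⁻¹`: it maps into the domain of `A`, and it is a two-sided
inverse of `A - z`. In particular `A - z` is a bijection from the domain of `A` onto the space. -/
def IsResolventAt {E : Type*} [NormedAddCommGroup E] [NormedSpace ℂ E] (A : E →ₗ.[ℂ] E) (z : ℂ)
    (R : E →L[ℂ] E) : Prop :=
  (∀ v : E, ∃ h : R v ∈ A.domain, A ⟨R v, h⟩ - z • R v = v) ∧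
    ∀ u : A.domain, R (A u - z • (u : E)) = u

lemma conj_im_ne_zero {Λ : ℂ} (hΛ : Λ.im ≠ 0) : (conj Λ).im ≠ 0 := by simpa using hΛ

end

end SmilanskyDeltaPrime

namespace SmilanskyDeltaPrime

noncomputable section

/-! Let `w` solve `(H_0 - Λ) w = v`, and look for the solution at coupling `β` in the form `w + T(Λ)
C`. Each mode solves the homogeneous equation off the line `x = 0`. With `a_n = (n + 1/2)^(1/4)`,
the `n`-th mode jumps by `2 a_n`, while its `x`-derivative has the common value `-a_n ζ_n` on both
sides. If `q` is the sequence of Hermite coefficients of `∂ₓw` on the line, the matching condition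
says that multiplication by `y` maps `(2 a_n C_n)` to `β (q_n - a_n ζ_n C_n)`. In the Hermite basis
multiplication by `y` is a Jacobi matrix. Multiplying row `n` by `a_n / √2` and putting `β = 2√2 μ`
turns the condition into `(J(Λ,μ) C)_n = 2 μ a_n q_n`. Green's formula against the modes at `conj Λ`
gives `(T(conj Λ)* v)_n = 2 a_n q_n`, hence `C = μ J⁻¹ T(conj Λ)* v`.

To avoid regularity questions, this computation is done only for finite combinations of products of
half-line exponentials and Hermite functions (`finiteGraph`). These lie in the `H²` domain and
satisfy Green's formula against every element of it (`finiteGraph_symmetric`). By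
`exists_isResolventAt_closure`, a symmetric relation of this kind determines the resolvent of the
closure as soon as its ranges at all nonreal points are dense, so no elliptic estimate is needed.

Density for `H_0` holds because the free equation is solved explicitly for exponentials
(`expMode_mem_freeRange_of_sq_eq`) and these are complete (`ae_eq_zero_of_halfExp_hermite`). For
`H_β` the Jacobi equation must moreover have a finite solution. A small change of `v` achieves this
(`dense_jacobiRange`), since `J` maps finite sequences onto a dense set.

The Jacobi operator is bounded below because `Im y_n(Λ)` has constant sign and stays away from zero
(`exists_jacobi_bound`). The boundary term of the partial summation vanishes along a subsequence
since `d_n` grows at most linearly. -/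

/-! ### Resolvents of closures of symmetric relations. -/

/-- A submodule of `E × E` on which `g - z u` controls `u`, and on which `g - z u` takes a dense set
of values, has a closure that is the graph of an operator whose resolvent at `z` is bounded. -/
theorem exists_resolvent_of_bound {E : Type*} [NormedAddCommGroup E] [NormedSpace ℂ E]
    [CompleteSpace E] (S : Submodule ℂ (E × E)) (z : ℂ) (c : ℝ)
    (hb : ∀ q ∈ S, ‖q.1‖ ≤ c * ‖q.2 - z • q.1‖)
    (hd : Dense ((fun q : E × E => q.2 - z • q.1) '' (S : Set (E × E)))) :
    ∃ R : E →L[ℂ] E, (∀ v, (R v, v + z • R v) ∈ S.topologicalClosure) ∧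
      ∀ q ∈ S.topologicalClosure, R (q.2 - z • q.1) = q.1 := by
  let L : E × E →L[ℂ] E := ContinuousLinearMap.snd ℂ E E - z • ContinuousLinearMap.fst ℂ E E
  have hL : ∀ q, L q = q.2 - z • q.1 := fun q => rfl
  have hb' : ∀ q ∈ S.topologicalClosure, ‖q.1‖ ≤ c * ‖L q‖ := by
    intro q hq
    have hc : IsClosed {q : E × E | ‖q.1‖ ≤ c * ‖L q‖} :=
      isClosed_le (by fun_prop) (by fun_prop)
    have : (S.topologicalClosure : Set (E × E)) ⊆ {q : E × E | ‖q.1‖ ≤ c * ‖L q‖} := by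
      rw [Submodule.topologicalClosure_coe]
      exact closure_minimal (fun q hq => hb q hq) hc
    exact this hq
  let P : S.topologicalClosure →L[ℂ] E := L.comp S.topologicalClosure.subtypeL
  have hP : ∀ q : S.topologicalClosure, P q = L q := fun q => rfl
  -- In the graph norm both components must be controlled; the second is recovered from `g = (g - z
  -- u) + z u`. The absolute value of `c` is taken because its sign is not assumed.
  have hnorm : ∀ q : S.topologicalClosure, ‖q‖ ≤ (1 + (1 + ‖z‖) * |c|) * ‖P q‖ := by
    intro q
    have h1 : ‖(q : E × E).1‖ ≤ |c| * ‖P q‖ := (hb' q q.2).trans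
      (mul_le_mul_of_nonneg_right (le_abs_self c) (norm_nonneg _))
    have h2 : (q : E × E).2 = P q + z • (q : E × E).1 := by rw [hP, hL]; abel
    have h3 : ‖(q : E × E).2‖ ≤ ‖P q‖ + ‖z‖ * ‖(q : E × E).1‖ := by
      rw [h2]; exact (norm_add_le _ _).trans (by rw [norm_smul])
    have h4 : ‖z‖ * ‖(q : E × E).1‖ ≤ ‖z‖ * (|c| * ‖P q‖) :=
      mul_le_mul_of_nonneg_left h1 (norm_nonneg _)
    have h5 : 0 ≤ ‖z‖ * (|c| * ‖P q‖) := by positivity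
    have h6 : 0 ≤ |c| * ‖P q‖ := by positivity
    refine (Prod.norm_def (q : E × E)).le.trans (max_le ?_ ?_)
    · nlinarith [norm_nonneg (P q)]
    · nlinarith [norm_nonneg (P q)]
  have : CompleteSpace S.topologicalClosure :=
    S.isClosed_topologicalClosure.completeSpace_coe
  have hanti : AntilipschitzWith (1 + (1 + ‖z‖) * |c|).toNNReal P :=
    P.antilipschitz_of_bound fun q => by
      rw [Real.coe_toNNReal _ (by positivity)]; exact hnorm q
  -- A map bounded below on a complete space has closed range, so density of the range already gives
  -- surjectivity.
  have hclosed : IsClosed (Set.range P) := hanti.isClosed_range P.uniformContinuous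
  have hrange : LinearMap.range P.toLinearMap = ⊤ := by
    rw [eq_top_iff]
    rintro v -
    have hv : v ∈ closure (Set.range P) := by
      refine closure_mono ?_ (hd v)
      rintro _ ⟨q, hq, rfl⟩
      exact ⟨⟨q, S.le_topologicalClosure hq⟩, rfl⟩
    rw [hclosed.closure_eq] at hv
    exact hv
  have hker : LinearMap.ker P.toLinearMap = ⊥ := LinearMap.ker_eq_bot.2 hanti.injective
  let e := ContinuousLinearEquiv.ofBijective P hker hrange
  let F : S.topologicalClosure →L[ℂ] E :=
    (ContinuousLinearMap.fst ℂ E E).comp S.topologicalClosure.subtypeL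
  refine ⟨F.comp (e.symm : E →L[ℂ] S.topologicalClosure), fun v => ?_, fun q hq => ?_⟩
  · have h1 : P (e.symm v) = v := e.apply_symm_apply v
    have h2 : ((e.symm v : S.topologicalClosure) : E × E) =
        ((e.symm v : E × E).1, v + z • (e.symm v : E × E).1) := by
      exact Prod.ext rfl (sub_eq_iff_eq_add.1 h1)
    have h3 := (e.symm v).2
    rw [h2] at h3
    exact h3
  · have : e.symm (q.2 - z • q.1) = ⟨q, hq⟩ := by
      rw [ContinuousLinearEquiv.symm_apply_eq]; rfl
    change F (e.symm _) = _
    rw [this]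
    rfl

/-- A symmetric relation satisfies `|Im z| ‖u‖ ≤ ‖g - z u‖`. -/
lemma norm_le_of_symmetric {E : Type*} [NormedAddCommGroup E] [InnerProductSpace ℂ E] {u g : E}
    (h : inner ℂ u g = inner ℂ g u) {z : ℂ} (hz : z.im ≠ 0) :
    ‖u‖ ≤ |z.im|⁻¹ * ‖g - z • u‖ := by
  have h0 : (inner ℂ u g : ℂ).im = 0 := by
    have h1 : conj (inner ℂ u g : ℂ) = inner ℂ u g := by
      rw [inner_conj_symm]; exact h.symm
    exact Complex.conj_eq_iff_im.1 h1
  have h2 : (inner ℂ u (g - z • u) : ℂ).im = -(z.im * ‖u‖ ^ 2) := by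
    rw [inner_sub_right, inner_smul_right, inner_self_eq_norm_sq_to_K, Complex.sub_im, h0]
    simp [← Complex.ofReal_pow]
  have h3 : |z.im| * ‖u‖ ^ 2 ≤ ‖u‖ * ‖g - z • u‖ := by
    have := (Complex.abs_im_le_norm _).trans (norm_inner_le_norm (𝕜 := ℂ) u (g - z • u))
    rwa [h2, abs_neg, abs_mul, abs_of_nonneg (sq_nonneg ‖u‖)] at this
  have hz' : 0 < |z.im| := abs_pos.2 hz
  rw [inv_mul_eq_div, le_div_iff₀ hz']
  rcases (norm_nonneg u).eq_or_lt with h4 | h4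
  · rw [← h4]; simp
  · exact le_of_mul_le_mul_left (by nlinarith) h4

/-- If a densely defined relation `S` below the graph of `A` is symmetric with respect to `A`, and
the ranges of `S - z` and `S - conj z` are dense, then `z` is in the resolvent set of the closure
of `A`. -/
theorem exists_isResolventAt_closure {E : Type*} [NormedAddCommGroup E] [InnerProductSpace ℂ E]
    [CompleteSpace E] (A : E →ₗ.[ℂ] E) (S : Submodule ℂ (E × E)) (hS : S ≤ A.graph)
    (hsym : ∀ q ∈ A.graph, ∀ p ∈ S, inner ℂ p.1 q.2 = inner ℂ p.2 q.1)
    (hdom : ∀ g : E, (∀ p ∈ S, inner ℂ p.1 g = (0 : ℂ)) → g = 0)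
    (hran : ∀ z : ℂ, z.im ≠ 0 → Dense ((fun q : E × E => q.2 - z • q.1) '' (S : Set (E × E))))
    {z : ℂ} (hz : z.im ≠ 0) :
    ∃ R : E →L[ℂ] E, IsResolventAt A.closure z R ∧
      ∀ q ∈ A.graph, R (q.2 - z • q.1) = q.1 := by
  obtain ⟨R, hR1, hR2⟩ := exists_resolvent_of_bound S z |z.im|⁻¹
    (fun q hq => norm_le_of_symmetric (hsym q (hS hq) q hq) hz) (hran z hz)
  have hclo : ∀ (T : Submodule ℂ (E × E)),
      (∀ q ∈ T, ∀ p ∈ S, inner ℂ p.1 q.2 = inner ℂ p.2 q.1) →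
      ∀ q ∈ T.topologicalClosure, ∀ p ∈ S, inner ℂ p.1 q.2 = inner ℂ p.2 q.1 := by
    intro T hT q hq p hp
    have hc : IsClosed {q : E × E | (inner ℂ p.1 q.2 : ℂ) = inner ℂ p.2 q.1} :=
      isClosed_eq (by fun_prop) (by fun_prop)
    have : (T.topologicalClosure : Set (E × E)) ⊆
        {q : E × E | (inner ℂ p.1 q.2 : ℂ) = inner ℂ p.2 q.1} := by
      rw [Submodule.topologicalClosure_coe]
      exact closure_minimal (fun q hq => hT q hq p hp) hc
    exact this hq
  have hsymA := hclo _ hsym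
  have hSA : S.topologicalClosure ≤ A.graph.topologicalClosure :=
    Submodule.topologicalClosure_mono hS
  have hRA : ∀ q ∈ A.graph.topologicalClosure, R (q.2 - z • q.1) = q.1 := by
    intro q hq
    set v := q.2 - z • q.1 with hv
    have h1 := hSA (hR1 v)
    have h2 := A.graph.topologicalClosure.sub_mem hq h1
    have h3 : q.2 - (v + z • R v) = z • (q.1 - R v) := by rw [hv, smul_sub]; abel
    -- The difference of the two elements of the closed graph has the form `(d, z d)`. Symmetry
    -- makes `d` orthogonal to all `p.2 - conj z • p.1` with `p ∈ S`, a dense set. Hence the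
    -- closures of `S` and of the graph of `A` have the same resolvent.
    have h4 : q.1 - R v = 0 := by
      have hz' : (conj z).im ≠ 0 := by simpa using hz
      refine (hran _ hz').eq_zero_of_inner_left ℂ ?_
      rintro _ ⟨p, hp, rfl⟩
      have h5 := hsymA _ h2 p hp
      simp only [Prod.fst_sub, Prod.snd_sub] at h5
      rw [h3, inner_smul_right] at h5
      rw [← inner_conj_symm, inner_sub_left, inner_smul_left, Complex.conj_conj, ← h5, sub_self,
        map_zero]
    exact (sub_eq_zero.1 h4).symm
  -- This has to be proved, because `LinearPMap.closure` returns a non-closable operator unchanged.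
  -- If `(0, g)` is a limit of the graph, symmetry gives `⟨p.1, g⟩ = 0` for all `p ∈ S`, and first
  -- components of `S` separate points.
  have hcl : A.IsClosable := by
    refine ⟨A.graph.topologicalClosure.toLinearPMap, ?_⟩
    rw [Submodule.toLinearPMap_graph_eq]
    intro q hq h0
    refine hdom _ fun p hp => ?_
    rw [hsymA q hq p hp, h0, inner_zero_right]
  have hgr := hcl.graph_closure_eq_closure_graph
  refine ⟨R, ⟨fun v => ?_, fun u => ?_⟩, fun q hq => hRA q (A.graph.le_topologicalClosure hq)⟩
  · have h1 := hSA (hR1 v)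
    rw [hgr, LinearPMap.mem_graph_iff] at h1
    obtain ⟨y, hy1, hy2⟩ := h1
    simp only at hy1 hy2
    have hm : R v ∈ A.closure.domain := hy1 ▸ y.2
    refine ⟨hm, ?_⟩
    have : (⟨R v, hm⟩ : A.closure.domain) = y := Subtype.ext hy1.symm
    rw [this, hy2]
    abel
  · have h1 : ((u : E), A.closure u) ∈ A.graph.topologicalClosure := by
      rw [hgr]; exact A.closure.mem_graph u
    exact hRA _ h1

/-! ### The Jacobi operator: lower bound and bounded inverse. -/

/-- For nonreal `Λ` the radicand stays off the branch cut, where the principal root commutes with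
conjugation. -/
lemma zeta_conj {Λ : ℂ} (hΛ : Λ.im ≠ 0) (n : ℕ) : zeta n (conj Λ) = conj (zeta n Λ) := by
  have harg : ((n : ℂ) + 1 / 2 - Λ).arg ≠ Real.pi := by
    intro h
    have := (Complex.arg_eq_pi_iff.1 h).2
    simp at this
    exact hΛ this
  have h2 : conj (2 : ℂ) = 2 := Complex.conj_ofNat 2
  have h := Complex.conj_cpow ((n : ℂ) + 1 / 2 - Λ) (1 / 2) harg
  rw [map_div₀, map_one, h2] at h
  rw [zeta, zeta, ← h]
  simp [h2]

lemma jacobiY_conj {Λ : ℂ} (hΛ : Λ.im ≠ 0) (n : ℕ) :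
    jacobiY n (conj Λ) = conj (jacobiY n Λ) := by
  simp [jacobiY, zeta_conj hΛ]

@[simp]
lemma jacobiD_zero : jacobiD 0 = 0 := by simp [jacobiD]

lemma jacobiD_nonneg (n : ℕ) : 0 ≤ jacobiD n := by
  unfold jacobiD
  split_ifs with h
  · rfl
  · have : (1 : ℝ) ≤ n := by exact_mod_cast Nat.one_le_iff_ne_zero.2 h
    have : 0 ≤ (n : ℝ) - 1 / 2 := by linarith
    positivity

/-- Linear growth is what lets the divergence of the harmonic series kill the boundary term in
`exists_jacobi_bound`. -/
lemma jacobiD_le (n : ℕ) : jacobiD n ≤ n + 1 := by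
  unfold jacobiD
  split_ifs with h
  · positivity
  · have h1 : (1 : ℝ) ≤ n := by exact_mod_cast Nat.one_le_iff_ne_zero.2 h
    have h2 : (0 : ℝ) ≤ (n : ℝ) - 1 / 2 := by linarith
    have h3 : ((n : ℝ) + 1) ^ (1 / 2 : ℝ) * ((n : ℝ) + 1) ^ (1 / 4 : ℝ) *
        ((n : ℝ) + 1) ^ (1 / 4 : ℝ) = n + 1 := by
      rw [← Real.rpow_add (by positivity), ← Real.rpow_add (by positivity)]
      norm_num
    rw [← h3]
    gcongr <;> linarith

lemma two_mul_zeta_re_mul_im {Λ : ℂ} (hΛ : Λ.im ≠ 0) (n : ℕ) :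
    2 * (zeta n Λ).re * (zeta n Λ).im = -Λ.im := by
  have h := congrArg Complex.im (zeta_mul_self hΛ n)
  simp only [Complex.mul_im, Complex.sub_im, Complex.add_im, Complex.natCast_im] at h
  have h12 : (1 / 2 : ℂ).im = 0 := by norm_num
  rw [h12] at h
  linarith

/-- `Re ζₙ(Λ)` grows at most like `(n + 1/2)^(1/2)`. -/
lemma zeta_re_upper {Λ : ℂ} (hΛ : Λ.im ≠ 0) :
    ∃ K : ℝ, 0 < K ∧ ∀ n : ℕ, (zeta n Λ).re ≤ K * ((n : ℝ) + 1 / 2) ^ (1 / 2 : ℝ) := by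
  -- `|ζ_n|² ≤ (n + 1/2) + ‖Λ‖`, and `‖Λ‖ ≤ 2‖Λ‖ (n + 1/2)` because `n + 1/2 ≥ 1/2`.
  refine ⟨Real.sqrt (1 + 2 * ‖Λ‖), by positivity, fun n => ?_⟩
  rw [← Real.sqrt_eq_rpow, ← Real.sqrt_mul (by positivity)]
  refine (Complex.re_le_norm _).trans (Real.le_sqrt_of_sq_le ?_)
  rw [sq, ← norm_mul, zeta_mul_self hΛ]
  have h1 : ‖(n : ℂ) + 1 / 2 - Λ‖ ≤ (n + 1 / 2 : ℝ) + ‖Λ‖ := by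
    refine (norm_sub_le _ _).trans (add_le_add_left ?_ _)
    refine (norm_add_le _ _).trans ?_
    simp
  have h2 : 0 ≤ ‖Λ‖ * n := by positivity
  nlinarith

/-- `Im yₙ(Λ)` is of constant sign and bounded away from zero. -/
lemma exists_jacobiY_im_bound {Λ : ℂ} (hΛ : Λ.im ≠ 0) :
    ∃ c : ℝ, 0 < c ∧ ∀ n, c ≤ -Λ.im * (jacobiY n Λ).im := by
  obtain ⟨K, hK, h⟩ := zeta_re_upper hΛ
  -- From `2 Re ζ Im ζ = -Im Λ`, the product `-Im Λ · Im y_n` equals `(Im Λ)² (n + 1/2)^(1/2) / (2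
  -- Re ζ_n)`, and `K` bounds the growth of the denominator.
  refine ⟨Λ.im ^ 2 / (2 * K), by positivity, fun n => ?_⟩
  have h1 := two_mul_zeta_re_mul_im hΛ n
  have hp := zeta_re_pos hΛ n
  have h2 : (jacobiY n Λ).im = ((n : ℝ) + 1 / 2) ^ (1 / 2 : ℝ) * (zeta n Λ).im := by
    rw [jacobiY, Complex.im_ofReal_mul]
  have h3 : (zeta n Λ).im = -Λ.im / (2 * (zeta n Λ).re) := by
    field_simp
    linarith
  have h4 := h n
  rw [h2, h3, show -Λ.im * (((n : ℝ) + 1 / 2) ^ (1 / 2 : ℝ) * (-Λ.im / (2 * (zeta n Λ).re))) =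
    Λ.im ^ 2 * ((n : ℝ) + 1 / 2) ^ (1 / 2 : ℝ) / (2 * (zeta n Λ).re) by ring,
    div_le_div_iff₀ (by positivity) (by positivity)]
  nlinarith [sq_nonneg Λ.im, mul_le_mul_of_nonneg_left h4 (sq_nonneg Λ.im)]

/-- Partial summation for the quadratic form of the Jacobi operator. -/
lemma im_sum_conj_mul_jacobiSeq (Λ : ℂ) (μ : ℝ) (X : ℕ → ℂ) (N : ℕ) :
    (∑ n ∈ Finset.range (N + 1), conj (X n) * jacobiSeq Λ μ X n).im =
      ∑ n ∈ Finset.range (N + 1), 2 * μ * (jacobiY n Λ).im * ‖X n‖ ^ 2 +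
        jacobiD (N + 1) * (conj (X N) * X (N + 1)).im := by
  have hsq : ∀ n, ‖X n‖ ^ 2 = (X n).re * (X n).re + (X n).im * (X n).im := fun n => by
    rw [Complex.sq_norm, Complex.normSq_apply]
  -- The `d_n` are real, so the two off-diagonal terms joining `n` and `n + 1` are conjugate and
  -- their sum is real; only the term leaving the range at `N` remains unpaired.
  induction N with
  | zero =>
    simp [jacobiSeq, hsq]
    ring
  | succ N ih =>
    rw [Finset.sum_range_succ, Finset.sum_range_succ _ (N + 1), Complex.add_im, ih, hsq (N + 1)]
    simp [jacobiSeq]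
    ring

/-- Otherwise `b n ≥ ε / (n + 2)` from `N` on, and the harmonic series would converge. -/
lemma exists_mul_lt_of_summable {b : ℕ → ℝ} (hs : Summable b) {ε : ℝ} (hε : 0 < ε) (N : ℕ) :
    ∃ M ≥ N, ((M : ℝ) + 2) * b M < ε := by
  by_contra! h
  have h1 : Summable fun n : ℕ => ε / ((n + N : ℕ) + 2 : ℝ) := by
    refine Summable.of_nonneg_of_le (fun n => by positivity) (fun n => ?_)
      ((summable_nat_add_iff N).2 hs)
    rw [div_le_iff₀ (by positivity), mul_comm]
    exact h (n + N) (by omega)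
  have h2 := (summable_nat_add_iff (f := fun n : ℕ => ε / ((n : ℝ) + 2)) N).1 h1
  have h3 : Summable fun n : ℕ => ((n + 2 : ℕ) : ℝ)⁻¹ := by
    refine (h2.mul_left ε⁻¹).congr fun n => ?_
    push_cast
    field_simp
  exact Real.not_summable_natCast_inv ((summable_nat_add_iff 2).1 h3)

lemma norm_sum_conj_mul_le (X V : SeqL2) (s : Finset ℕ) :
    ‖∑ n ∈ s, conj (X n) * V n‖ ≤ ‖X‖ * ‖V‖ := by
  have hX : ∀ X : SeqL2, ∑ n ∈ s, ‖X n‖ ^ 2 ≤ ‖X‖ ^ 2 := fun X => by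
    have h := lp.sum_rpow_le_norm_rpow (p := 2) (by norm_num) X s
    simpa using h
  refine (norm_sum_le _ _).trans ?_
  refine le_of_sq_le_sq ?_ (by positivity)
  calc (∑ n ∈ s, ‖conj (X n) * V n‖) ^ 2 = (∑ n ∈ s, ‖X n‖ * ‖V n‖) ^ 2 := by simp
    _ ≤ (∑ n ∈ s, ‖X n‖ ^ 2) * ∑ n ∈ s, ‖V n‖ ^ 2 := Finset.sum_mul_sq_le_sq_mul_sq _ _ _
    _ ≤ ‖X‖ ^ 2 * ‖V‖ ^ 2 := mul_le_mul (hX X) (hX V)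
        (Finset.sum_nonneg fun _ _ => sq_nonneg _) (sq_nonneg _)
    _ = _ := by ring

/-- The Jacobi operator is bounded below. -/
theorem exists_jacobi_bound {Λ : ℂ} (hΛ : Λ.im ≠ 0) {μ : ℝ} (hμ : 0 < μ) :
    ∃ K : ℝ, ∀ X V : SeqL2, (V : ℕ → ℂ) = jacobiSeq Λ μ X → ‖X‖ ≤ K * ‖V‖ := by
  obtain ⟨c, hc, h⟩ := exists_jacobiY_im_bound hΛ
  refine ⟨|Λ.im| / (2 * μ * c), fun X V hV => ?_⟩
  have key : ∀ (N : ℕ) (ε : ℝ), 0 < ε →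
      2 * μ * c * ∑ n ∈ Finset.range N, ‖X n‖ ^ 2 ≤ |Λ.im| * (‖X‖ * ‖V‖ + ε) := by
    intro N ε hε
    -- The boundary term at `M` is at most `(M + 2) |X_M| |X_(M+1)|`, so `M` is chosen where the sum
    -- of both squares, weighted with `M + 2`, is small.
    have hb : Summable fun n => (‖X n‖ ^ 2 + ‖X (n + 1)‖ ^ 2) :=
      (summable_sq X).add ((summable_nat_add_iff 1).2 (summable_sq X))
    obtain ⟨M, hM, hlt⟩ := exists_mul_lt_of_summable hb hε N
    have h1 := im_sum_conj_mul_jacobiSeq Λ μ X M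
    rw [← hV] at h1
    have h2 := (Complex.abs_im_le_norm _).trans
      (norm_sum_conj_mul_le X V (Finset.range (M + 1)))
    have h3 : |jacobiD (M + 1) * (conj (X M) * X (M + 1)).im| ≤ ε := by
      rw [abs_mul, abs_of_nonneg (jacobiD_nonneg _)]
      have h4 := Complex.abs_im_le_norm (conj (X M) * X (M + 1))
      rw [norm_mul, RCLike.norm_conj] at h4
      have h5 := jacobiD_le (M + 1)
      push_cast at h5
      calc jacobiD (M + 1) * |(conj (X M) * X (M + 1)).im|
          ≤ ((M : ℝ) + 2) * (‖X M‖ ^ 2 + ‖X (M + 1)‖ ^ 2) := by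
            refine mul_le_mul (by linarith) (h4.trans ?_) (abs_nonneg _) (by positivity)
            nlinarith [sq_nonneg (‖X M‖ - ‖X (M + 1)‖), sq_nonneg ‖X M‖, sq_nonneg ‖X (M + 1)‖]
        _ ≤ ε := hlt.le
    -- The factor `-Im Λ` makes every summand on the right nonnegative, which permits restricting
    -- the sum to the first `N` terms.
    have h6 : 2 * μ * c * ∑ n ∈ Finset.range N, ‖X n‖ ^ 2 ≤
        -Λ.im * ∑ n ∈ Finset.range (M + 1), 2 * μ * (jacobiY n Λ).im * ‖X n‖ ^ 2 := by
      rw [Finset.mul_sum, Finset.mul_sum]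
      refine (Finset.sum_le_sum_of_subset_of_nonneg
        (Finset.range_mono (by omega : N ≤ M + 1)) fun _ _ _ => by positivity).trans
        (Finset.sum_le_sum fun n _ => ?_)
      have := mul_le_mul_of_nonneg_right (h n) (by positivity : 0 ≤ 2 * μ * ‖X n‖ ^ 2)
      linarith
    refine h6.trans ((le_abs_self _).trans ?_)
    rw [abs_mul, abs_neg]
    refine mul_le_mul_of_nonneg_left ?_ (abs_nonneg _)
    rw [show ∑ n ∈ Finset.range (M + 1), 2 * μ * (jacobiY n Λ).im * ‖X n‖ ^ 2 =
      (∑ n ∈ Finset.range (M + 1), conj (X n) * V n).im -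
        jacobiD (M + 1) * (conj (X M) * X (M + 1)).im by rw [h1]; ring]
    exact (abs_sub _ _).trans (add_le_add h2 h3)
  have key2 : 2 * μ * c * ‖X‖ ^ 2 ≤ |Λ.im| * (‖X‖ * ‖V‖) := by
    have hX : ‖X‖ ^ 2 = ∑' n, ‖X n‖ ^ 2 := by
      have := lp.norm_rpow_eq_tsum (p := 2) (by norm_num) X
      simpa using this
    rw [hX]
    refine le_of_tendsto ((summable_sq X).hasSum.tendsto_sum_nat.const_mul _)
      (Eventually.of_forall fun N => ?_)
    refine ge_of_tendsto (x := 𝓝[>] (0 : ℝ)) (f := fun ε => |Λ.im| * (‖X‖ * ‖V‖ + ε)) ?_ ?_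
    · have : Tendsto (fun ε : ℝ => |Λ.im| * (‖X‖ * ‖V‖ + ε)) (𝓝 0)
          (𝓝 (|Λ.im| * (‖X‖ * ‖V‖ + 0))) := Continuous.tendsto (by fun_prop) 0
      rw [add_zero] at this
      exact this.mono_left nhdsWithin_le_nhds
    · filter_upwards [self_mem_nhdsWithin] with ε hε using key N ε hε
  rw [div_mul_eq_mul_div, le_div_iff₀ (by positivity)]
  rcases (norm_nonneg X).eq_or_lt with h0 | h0
  · rw [← h0]; simp only [zero_mul]; positivity
  · exact le_of_mul_le_mul_left (by nlinarith) h0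

/-- A finitely supported sequence as an element of `ℓ²`. -/
def finSeq : (ℕ →₀ ℂ) →ₗ[ℂ] SeqL2 :=
  Finsupp.linearCombination ℂ fun n => lp.single 2 n (1 : ℂ)

lemma finSeq_single (n : ℕ) (a : ℂ) : finSeq (Finsupp.single n a) = lp.single 2 n a := by
  rw [finSeq, Finsupp.linearCombination_single, ← lp.single_smul, smul_eq_mul, mul_one]

lemma finSeq_apply (C : ℕ →₀ ℂ) (n : ℕ) : finSeq C n = C n := by
  induction C using Finsupp.induction_linear with
  | zero => simp
  | add f g hf hg => simp [hf, hg]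
  | single m a =>
    rw [finSeq_single, lp.single_apply, Pi.single_apply, Finsupp.single_apply]
    simp [eq_comm]

/-- The Jacobi matrix acting on finitely supported sequences. -/
def jacobiFin (Λ : ℂ) (μ : ℝ) : (ℕ →₀ ℂ) →ₗ[ℂ] (ℕ →₀ ℂ) :=
  Finsupp.linearCombination ℂ fun n => Finsupp.single (n - 1) (jacobiD n : ℂ) +
    Finsupp.single n (2 * μ * jacobiY n Λ) + Finsupp.single (n + 1) (jacobiD (n + 1) : ℂ)

lemma jacobiFin_apply (Λ : ℂ) (μ : ℝ) (C : ℕ →₀ ℂ) (n : ℕ) :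
    jacobiFin Λ μ C n = jacobiSeq Λ μ C n := by
  induction C using Finsupp.induction_linear with
  | zero => simp [jacobiSeq]
  | add f g hf hg =>
    rw [map_add, Finsupp.add_apply, hf, hg, Finsupp.coe_add, jacobiSeq_add]
    rfl
  | single m a =>
    rw [jacobiFin, Finsupp.linearCombination_single]
    simp only [jacobiSeq, Finsupp.smul_apply, Finsupp.add_apply, Finsupp.single_apply, smul_eq_mul]
    -- The indices `m - 1` and `n - 1` are truncated at zero, hence the separate cases; the spurious
    -- entries carry the coefficient `d_0 = 0`.
    rcases Nat.eq_zero_or_pos m with rfl | hm <;> rcases Nat.eq_zero_or_pos n with rfl | hn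
    · simp; ring
    · have h1 : n ≠ 0 := hn.ne'
      rcases eq_or_ne n 1 with rfl | h2
      · simp; ring
      · have h3 : n - 1 ≠ 0 := by omega
        simp [h1.symm, h2.symm, h3.symm]
    · rcases eq_or_ne m 1 with rfl | h2
      · simp; ring
      · have h3 : m - 1 ≠ 0 := by omega
        simp [hm.ne', h2, h3]
    · by_cases e1 : m - 1 = n
      · obtain rfl : m = n + 1 := by omega
        simp [show n + 1 ≠ n - 1 by omega, show n + 1 + 1 ≠ n by omega]
        ring
      · by_cases e2 : m = n
        · subst e2
          simp [e1, show m ≠ m - 1 by omega]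
          ring
        · by_cases e3 : m + 1 = n
          · subst e3
            simp [show m - 1 ≠ m + 1 by omega, show m ≠ m + 1 + 1 by omega]
            ring
          · simp [e1, e2, e3, show m ≠ n + 1 by omega, show m ≠ n - 1 by omega]

/-- The finitely supported sequences have a dense image under the Jacobi operator. -/
theorem denseRange_jacobiFin {Λ : ℂ} (hΛ : Λ.im ≠ 0) {μ : ℝ} (hμ : 0 < μ) :
    DenseRange fun C : ℕ →₀ ℂ => finSeq (jacobiFin Λ μ C) := by
  have h : (LinearMap.range (finSeq ∘ₗ jacobiFin Λ μ)).topologicalClosure = ⊤ := by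
    rw [Submodule.topologicalClosure_eq_top_iff, Submodule.eq_bot_iff]
    intro Y hY
    have hΛ' := conj_im_ne_zero hΛ
    -- Orthogonality to the image of the `n`-th unit vector is the `n`-th row of the homogeneous
    -- equation at `conj Λ`. The lower bound holds there too, and for every `ℓ²` solution, so `Y =
    -- 0`.
    have h0 : ((0 : SeqL2) : ℕ → ℂ) = jacobiSeq (conj Λ) μ Y := by
      funext n
      have h1 := hY _ ⟨Finsupp.single n 1, rfl⟩
      rw [LinearMap.comp_apply, jacobiFin, Finsupp.linearCombination_single, one_smul, map_add,
        map_add, inner_add_left, inner_add_left, finSeq_single, finSeq_single, finSeq_single,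
        lp.inner_single_left, lp.inner_single_left, lp.inner_single_left] at h1
      simp only [RCLike.inner_apply, map_mul, Complex.conj_ofReal, ← jacobiY_conj hΛ] at h1
      have h2 : conj (2 : ℂ) = 2 := Complex.conj_ofNat 2
      rw [h2] at h1
      simp only [jacobiSeq, lp.coeFn_zero, Pi.zero_apply]
      linear_combination -h1
    obtain ⟨K, hK⟩ := exists_jacobi_bound hΛ' hμ
    have h1 := hK Y 0 h0
    rw [norm_zero, mul_zero] at h1
    exact norm_le_zero_iff.1 h1
  intro V
  have hV : V ∈ (LinearMap.range (finSeq ∘ₗ jacobiFin Λ μ)).topologicalClosure := by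
    rw [h]; trivial
  rw [← SetLike.mem_coe, Submodule.topologicalClosure_coe] at hV
  exact closure_mono (by rintro _ ⟨C, rfl⟩; exact ⟨C, rfl⟩) hV

lemma mem_graph_jacobi (Λ : ℂ) (μ : ℝ) (X V : SeqL2) :
    (X, V) ∈ (jacobi Λ μ).graph ↔ (V : ℕ → ℂ) = jacobiSeq Λ μ X := by
  rw [LinearPMap.mem_graph_iff]
  constructor
  · rintro ⟨y, rfl, rfl⟩
    rfl
  · intro h
    have hX : Memℓp (jacobiSeq Λ μ X) 2 := h ▸ V.2
    exact ⟨⟨X, hX⟩, rfl, lp.ext h.symm⟩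

/-- On the maximal domain the graph is cut out by one condition per row, and each row involves at
most three coordinates, which are continuous. -/
lemma isClosed_graph_jacobi (Λ : ℂ) (μ : ℝ) :
    IsClosed ((jacobi Λ μ).graph : Set (SeqL2 × SeqL2)) := by
  have hev : ∀ n : ℕ, Continuous fun X : SeqL2 => X n := fun n =>
    (lp.uniformContinuous_coe.continuous.comp continuous_id |> continuous_pi_iff.1) n
  have : ((jacobi Λ μ).graph : Set (SeqL2 × SeqL2)) =
      ⋂ n, {q : SeqL2 × SeqL2 | q.2 n = jacobiSeq Λ μ q.1 n} := by
    ext q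
    rw [SetLike.mem_coe, mem_graph_jacobi, Set.mem_iInter]
    exact funext_iff
  rw [this]
  refine isClosed_iInter fun n => isClosed_eq ((hev n).comp continuous_snd) ?_
  unfold jacobiSeq
  have h1 := (hev n).comp (continuous_fst (X := SeqL2) (Y := SeqL2))
  have h2 := (hev (n + 1)).comp (continuous_fst (X := SeqL2) (Y := SeqL2))
  have h3 := (hev (n - 1)).comp (continuous_fst (X := SeqL2) (Y := SeqL2))
  exact ((continuous_const.mul h2).add (continuous_const.mul h1)).add (continuous_const.mul h3)

/-- The Jacobi operator has a bounded inverse. -/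
theorem exists_jacobi_inverse {Λ : ℂ} (hΛ : Λ.im ≠ 0) {μ : ℝ} (hμ : 0 < μ) :
    ∃ Jinv : SeqL2 →L[ℂ] SeqL2, IsResolventAt (jacobi Λ μ) 0 Jinv ∧
      ∀ C : ℕ →₀ ℂ, Jinv (finSeq (jacobiFin Λ μ C)) = finSeq C := by
  have hfin : ∀ C : ℕ →₀ ℂ, (finSeq C, finSeq (jacobiFin Λ μ C)) ∈ (jacobi Λ μ).graph := by
    intro C
    rw [mem_graph_jacobi]
    funext n
    rw [finSeq_apply, jacobiFin_apply]
    congr 1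
    funext m
    rw [finSeq_apply]
  obtain ⟨K, hK⟩ := exists_jacobi_bound hΛ hμ
  -- Density of the range comes from finite sequences alone; as the graph is already closed, passing
  -- to its closure adds nothing.
  obtain ⟨R, hR1, hR2⟩ := exists_resolvent_of_bound (jacobi Λ μ).graph 0 K
    (fun q hq => by
      rw [zero_smul, sub_zero]
      exact hK _ _ ((mem_graph_jacobi Λ μ q.1 q.2).1 hq))
    ((denseRange_jacobiFin hΛ hμ).mono (by
      rintro _ ⟨C, rfl⟩
      exact ⟨_, hfin C, by simp⟩))
  rw [(isClosed_graph_jacobi Λ μ).submodule_topologicalClosure_eq] at hR1 hR2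
  refine ⟨R, ⟨fun v => ?_, fun u => hR2 _ ((jacobi Λ μ).mem_graph u)⟩, fun C => ?_⟩
  · have h1 := hR1 v
    rw [zero_smul, add_zero, LinearPMap.mem_graph_iff] at h1
    obtain ⟨y, hy1, hy2⟩ := h1
    simp only at hy1 hy2
    have hm : R v ∈ (jacobi Λ μ).domain := hy1 ▸ y.2
    refine ⟨hm, ?_⟩
    have : (⟨R v, hm⟩ : (jacobi Λ μ).domain) = y := Subtype.ext hy1.symm
    rw [this, hy2, zero_smul, sub_zero]
  · have := hR2 _ (hfin C)
    simpa using this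

/-! ### Hermite functions: differential equation, recurrence and completeness. -/

/-- The function `p(y) exp(-y²/2)`. -/
def polyGauss (p : Polynomial ℝ) (y : ℝ) : ℂ := ((p.eval y * Real.exp (-(y ^ 2) / 2) : ℝ) : ℂ)

lemma contDiff_polyGauss (p : Polynomial ℝ) {m : WithTop ℕ∞} : ContDiff ℝ m (polyGauss p) := by
  have h1 : ContDiff ℝ m fun y : ℝ => p.eval y := by
    simpa [Polynomial.coe_aeval_eq_eval] using p.contDiff_aeval (𝕜 := ℝ) (m : WithTop ℕ∞)
  have h2 : ContDiff ℝ m fun y : ℝ => p.eval y * Real.exp (-(y ^ 2) / 2) := by fun_prop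
  exact Complex.ofRealCLM.contDiff.comp h2

lemma continuous_polyGauss (p : Polynomial ℝ) : Continuous (polyGauss p) :=
  (contDiff_polyGauss p (m := 0)).continuous

/-- The polynomial factor of the derivative of `p(y) exp(-y²/2)`. -/
def gaussDeriv (p : Polynomial ℝ) : Polynomial ℝ := p.derivative - Polynomial.X * p

lemma hasDerivAt_polyGauss (p : Polynomial ℝ) (y : ℝ) :
    HasDerivAt (polyGauss p) (polyGauss (gaussDeriv p) y) y := by
  have hx : HasDerivAt (fun x : ℝ => -(x ^ 2) / 2) (-y) y :=
    (((hasDerivAt_pow 2 y).neg).div_const 2).congr_deriv (by push_cast; ring)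
  refine (((p.hasDerivAt y).mul hx.exp).ofReal_comp).congr_deriv ?_
  simp [polyGauss, gaussDeriv]
  ring

lemma memLp_polyGauss (p : Polynomial ℝ) : MemLp (polyGauss p) 2 := by
  rw [memLp_two_iff_integrable_sq_norm (continuous_polyGauss p).aestronglyMeasurable]
  refine (integrable_poly_gaussian (p * p)).mono'
    ((continuous_polyGauss p).norm.pow 2).aestronglyMeasurable (ae_of_all _ fun y => ?_)
  rw [Real.norm_of_nonneg (sq_nonneg _), polyGauss, Complex.norm_real, Real.norm_eq_abs, sq_abs,
    Polynomial.eval_mul, mul_pow, sq, sq (Real.exp _)]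
  have h1 : Real.exp (-(y ^ 2) / 2) ≤ 1 := Real.exp_le_one_iff.2 (by nlinarith [sq_nonneg y])
  have h2 := Real.exp_pos (-(y ^ 2) / 2)
  exact mul_le_mul_of_nonneg_left (by nlinarith) (mul_self_nonneg _)

/-- The polynomial factor of the `n`-th Hermite function. -/
def hermitePoly (n : ℕ) : Polynomial ℝ :=
  Polynomial.C (Real.sqrt (n.factorial * Real.sqrt Real.pi))⁻¹ *
    ((Polynomial.hermite n).map (Int.castRingHom ℝ)).comp
      (Polynomial.C (Real.sqrt 2) * Polynomial.X)

lemma polyGauss_hermitePoly (n : ℕ) (y : ℝ) :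
    polyGauss (hermitePoly n) y = (hermiteFun n y : ℂ) := by
  rw [hermiteFun, Polynomial.aeval_def, algebraMap_int_eq, ← Polynomial.eval_map]
  simp only [polyGauss, hermitePoly, Polynomial.eval_mul, Polynomial.eval_C, Polynomial.eval_comp,
    Polynomial.eval_X]

lemma polyGauss_X_pow_mul (k : ℕ) (p : Polynomial ℝ) (y : ℝ) :
    polyGauss (Polynomial.X ^ k * p) y = (y : ℂ) ^ k * polyGauss p y := by
  simp [polyGauss, mul_assoc]

/-- The lowering relation; combined with the defining recursion of `Polynomial.hermite` it yields
both the differential equation and the three-term recurrence. -/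
lemma derivative_hermite_succ (n : ℕ) :
    Polynomial.derivative (Polynomial.hermite (n + 1)) =
      ((n : Polynomial ℤ) + 1) * Polynomial.hermite n := by
  induction n with
  | zero => simp
  | succ n ih =>
    rw [Polynomial.hermite_succ (n + 1), ih, Polynomial.derivative_sub, Polynomial.derivative_mul,
      Polynomial.derivative_X, ih, Polynomial.derivative_mul, Polynomial.derivative_add,
      Polynomial.derivative_natCast, Polynomial.derivative_one, Polynomial.hermite_succ n]
    push_cast
    ring

lemma derivative_derivative_hermite (n : ℕ) :
    Polynomial.derivative (Polynomial.derivative (Polynomial.hermite n)) =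
      Polynomial.X * Polynomial.derivative (Polynomial.hermite n) -
        (n : Polynomial ℤ) * Polynomial.hermite n := by
  cases n with
  | zero => simp
  | succ n =>
    rw [derivative_hermite_succ, Polynomial.derivative_mul, Polynomial.derivative_add,
      Polynomial.derivative_natCast, Polynomial.derivative_one, Polynomial.hermite_succ n]
    push_cast
    ring

/-- The differential equation of the Hermite functions. -/
lemma gaussDeriv_gaussDeriv_hermitePoly (n : ℕ) :
    gaussDeriv (gaussDeriv (hermitePoly n)) =
      (Polynomial.X ^ 2 - (2 * (n : Polynomial ℝ) + 1)) * hermitePoly n := by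
  have h := congrArg (Polynomial.map (Int.castRingHom ℝ)) (derivative_derivative_hermite n)
  simp only [Polynomial.map_sub, Polynomial.map_mul, Polynomial.map_X, Polynomial.map_natCast,
    ← Polynomial.derivative_map] at h
  -- The Hermite functions use the monic polynomials at `√2 y`; two derivatives of the composite
  -- produce the factor `(√2)² = 2`.
  have hc := congrArg (fun q : Polynomial ℝ => q.comp (Polynomial.C (Real.sqrt 2) * Polynomial.X)) h
  simp only [Polynomial.sub_comp, Polynomial.mul_comp, Polynomial.X_comp,
    Polynomial.natCast_comp] at hc
  have h2 : (Polynomial.C (Real.sqrt 2) : Polynomial ℝ) * Polynomial.C (Real.sqrt 2) = 2 := by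
    rw [← Polynomial.C_mul, Real.mul_self_sqrt (by norm_num)]
    rfl
  simp only [gaussDeriv, hermitePoly, Polynomial.derivative_mul, Polynomial.derivative_C,
    Polynomial.derivative_comp, Polynomial.derivative_X, Polynomial.derivative_sub,
    zero_mul, zero_add, mul_one, one_mul]
  rw [hc]
  linear_combination (Polynomial.C (Real.sqrt (n.factorial * Real.sqrt Real.pi))⁻¹ *
    (Polynomial.C (Real.sqrt 2) * Polynomial.X *
      (Polynomial.derivative ((Polynomial.hermite n).map (Int.castRingHom ℝ))).comp
        (Polynomial.C (Real.sqrt 2) * Polynomial.X) - n *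
      ((Polynomial.hermite n).map (Int.castRingHom ℝ)).comp
        (Polynomial.C (Real.sqrt 2) * Polynomial.X))) * h2

/-- The three-term recurrence of the Hermite functions. -/
lemma mul_hermiteFun (n : ℕ) (y : ℝ) :
    y * hermiteFun n y = Real.sqrt ((n + 1) / 2) * hermiteFun (n + 1) y +
      Real.sqrt (n / 2) * hermiteFun (n - 1) y := by
  have hpi : 0 < Real.sqrt Real.pi := Real.sqrt_pos.2 Real.pi_pos
  have h2 : Real.sqrt 2 ≠ 0 := by positivity
  have e1 : ∀ m : ℕ, (Real.sqrt ((m + 1).factorial * Real.sqrt Real.pi))⁻¹ =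
      (Real.sqrt (m + 1))⁻¹ * (Real.sqrt (m.factorial * Real.sqrt Real.pi))⁻¹ := by
    intro m
    rw [Nat.factorial_succ, ← mul_inv, ← Real.sqrt_mul (by positivity)]
    push_cast
    ring_nf
  have e2 : ∀ m : ℕ, Real.sqrt (m + 1) * (Real.sqrt (m + 1))⁻¹ = 1 := fun m =>
    mul_inv_cancel₀ (by positivity)
  have h22 : Real.sqrt 2 * Real.sqrt 2 = 2 := Real.mul_self_sqrt (by norm_num)
  have hX : ∀ m : ℕ, Real.sqrt 2 * y * Polynomial.aeval (Real.sqrt 2 * y) (Polynomial.hermite m) =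
      Polynomial.aeval (Real.sqrt 2 * y) (Polynomial.hermite (m + 1)) +
        Polynomial.aeval (Real.sqrt 2 * y) (Polynomial.derivative (Polynomial.hermite m)) := by
    intro m
    rw [Polynomial.hermite_succ, map_sub, map_mul, Polynomial.aeval_X]
    ring
  have hXn := hX n
  rw [Real.sqrt_div (by positivity), Real.sqrt_div (by positivity)]
  -- For `n = 0` the index `n - 1` is again `0`, but its coefficient `√(n/2)` vanishes.
  cases n with
  | zero =>
    simp only [hermiteFun, e1]
    simp
    field_simp
  | succ n =>
    rw [derivative_hermite_succ, map_mul, map_add, map_natCast, map_one] at hXn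
    simp only [hermiteFun, e1, Nat.add_sub_cancel]
    have e3 := e1 (n + 1)
    have e4 := e2 (n + 1)
    have e5 := e2 n
    push_cast at e3 e4 ⊢
    have e6 : Real.sqrt (n + 1) = (n + 1) * (Real.sqrt (n + 1))⁻¹ := by
      rw [← div_eq_mul_inv, Real.div_sqrt]
    set a := (Real.sqrt (n.factorial * Real.sqrt Real.pi))⁻¹
    set r := (Real.sqrt ((n : ℝ) + 1))⁻¹
    set h₀ := Polynomial.aeval (Real.sqrt 2 * y) (Polynomial.hermite n)
    set h₁ := Polynomial.aeval (Real.sqrt 2 * y) (Polynomial.hermite (n + 1))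
    set h₂ := Polynomial.aeval (Real.sqrt 2 * y) (Polynomial.hermite (n + 1 + 1))
    set g := Real.exp (-y ^ 2 / 2)
    rw [e6]
    set q := Real.sqrt ((n : ℝ) + 1 + 1)
    have hi : (Real.sqrt 2)⁻¹ * Real.sqrt 2 = 1 := inv_mul_cancel₀ h2
    simp only [div_eq_mul_inv]
    linear_combination (Real.sqrt 2)⁻¹ * r * a * g * hXn - (y * (r * a * h₁ * g)) * hi -
      (Real.sqrt 2)⁻¹ * r * a * h₂ * g * e4

/-- Completing the square gives `2|t||y| ≤ 2t² + y²/2`. This makes `exp(-y²/2 + |t||y|)` square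
integrable, the weight dominating the exponential series below. -/
lemma integrable_exp_gauss (t : ℝ) :
    Integrable fun y : ℝ => Real.exp (-(y ^ 2) + 2 * |t| * |y|) := by
  have h : Integrable fun y : ℝ => Real.exp (2 * t ^ 2) * Real.exp (-(1 / 2) * y ^ 2) :=
    (integrable_exp_neg_mul_sq (by norm_num)).const_mul _
  refine h.mono' (by fun_prop) (ae_of_all _ fun y => ?_)
  rw [Real.norm_of_nonneg (Real.exp_pos _).le, ← Real.exp_add]
  refine Real.exp_le_exp.2 ?_
  nlinarith [sq_nonneg (2 * |t| - |y|), sq_abs t, sq_abs y]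

/-- A function in `L²(ℝ)` whose product with the Gaussian has vanishing moments is zero. -/
theorem ae_eq_zero_of_gauss_moments {f : ℝ → ℂ} (hf : MemLp f 2)
    (h : ∀ k : ℕ, ∫ y : ℝ, f y * ((y ^ k * Real.exp (-(y ^ 2) / 2) : ℝ) : ℂ) = 0) :
    f =ᵐ[volume] 0 := by
  set g : ℝ → ℂ := fun y => (Real.exp (-(y ^ 2) / 2) : ℂ) * f y with hg
  have hbound : ∀ t : ℝ, Integrable fun y => ‖f y‖ * Real.exp (-(y ^ 2) / 2 + |t| * |y|) := by
    intro t
    have h1 : MemLp (fun y : ℝ => Real.exp (-(y ^ 2) / 2 + |t| * |y|)) 2 := by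
      rw [memLp_two_iff_integrable_sq (by fun_prop)]
      refine (integrable_exp_gauss t).congr (ae_of_all _ fun y => ?_)
      simp only
      rw [← Real.exp_nat_mul]
      congr 1
      push_cast
      ring
    exact hf.norm.integrable_mul h1
  have hgi : Integrable g := by
    refine (hbound 0).mono' ?_ (ae_of_all _ fun y => ?_)
    · exact (Continuous.aestronglyMeasurable (by fun_prop)).mul hf.aestronglyMeasurable
    · simp only [hg, norm_mul, abs_zero, zero_mul, add_zero]
      rw [mul_comm, Complex.norm_real,
        Real.norm_of_nonneg (Real.exp_pos _).le]
  -- The exponential is expanded in its power series; each term is a multiple of a vanishing moment.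
  -- The absolute series sums to `|f| exp(-y²/2 + |t||y|)`, which justifies the exchange.
  have hF : ∀ t : ℝ, ∫ y : ℝ, Complex.exp (Complex.I * t * y) * g y = 0 := by
    intro t
    have hs := hasSum_integral_of_dominated_convergence (μ := (volume : Measure ℝ))
      (F := fun (k : ℕ) (y : ℝ) => ((Complex.I * t * y) ^ k / k.factorial) * g y)
      (f := fun y => Complex.exp (Complex.I * t * y) * g y)
      (fun k y => ‖f y‖ * Real.exp (-(y ^ 2) / 2) * ((|t| * |y|) ^ k / k.factorial))
      (fun k => (Continuous.aestronglyMeasurable (by fun_prop)).mul hgi.aestronglyMeasurable)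
      (fun k => ae_of_all _ fun y => by
        refine le_of_eq ?_
        simp only [hg, norm_mul, norm_div, norm_pow, Complex.norm_I, one_mul, Complex.norm_real,
          Complex.norm_natCast, Real.norm_of_nonneg (Real.exp_pos _).le,
          Real.norm_eq_abs]
        ring)
      (ae_of_all _ fun y => (Real.summable_pow_div_factorial _).mul_left _)
      (by
        refine (hbound t).congr (ae_of_all _ fun y => ?_)
        simp only
        rw [tsum_mul_left, Real.exp_add, ← mul_assoc, Real.exp_eq_exp_ℝ,
          NormedSpace.exp_eq_tsum_div])
      (ae_of_all _ fun y => by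
        have := NormedSpace.expSeries_div_hasSum_exp (𝔸 := ℂ) (Complex.I * t * y)
        rw [← Complex.exp_eq_exp_ℂ] at this
        exact this.mul_right _)
    have h0 : ∀ k : ℕ, ∫ y : ℝ, ((Complex.I * t * y) ^ k / k.factorial) * g y = 0 := by
      intro k
      have e : ∀ y : ℝ, ((Complex.I * t * y) ^ k / k.factorial) * g y =
          ((Complex.I * t) ^ k / k.factorial) *
            (f y * ((y ^ k * Real.exp (-(y ^ 2) / 2) : ℝ) : ℂ)) := by
        intro y
        simp only [hg]
        push_cast
        ring
      simp_rw [e]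
      rw [integral_const_mul, h k, mul_zero]
    simp_rw [h0] at hs
    exact hs.unique hasSum_zero
  have hFg : ∀ ξ : ℝ, FourierTransform.fourier g ξ = 0 := by
    intro ξ
    rw [Real.fourier_real_eq_integral_exp_smul, ← hF (-2 * Real.pi * ξ)]
    refine integral_congr_ae (ae_of_all _ fun y => ?_)
    simp only [smul_eq_mul]
    congr 2
    push_cast
    ring
  have hg0 : g =ᵐ[volume] 0 := by
    refine ae_eq_zero_of_integral_contDiff_smul_eq_zero hgi.locallyIntegrable fun φ h1 h2 => ?_
    have hφ1 : HasCompactSupport (Complex.ofRealCLM ∘ φ) := h2.comp_left rfl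
    have hφ2 : ContDiff ℝ ((⊤ : ℕ∞) : WithTop ℕ∞) (Complex.ofRealCLM ∘ φ) := by fun_prop
    set Φ : SchwartzMap ℝ ℂ := hφ1.toSchwartzMap hφ2
    -- Writing the test function as the Fourier transform of a Schwartz function moves the transform
    -- onto `g`, where it vanishes, so no inversion formula for `g` is needed.
    set Θ : SchwartzMap ℝ ℂ := FourierTransformInv.fourierInv Φ
    have h3 : ∀ y, FourierTransform.fourier (Θ : ℝ → ℂ) y = φ y := by
      intro y
      have : FourierTransform.fourier Θ = Φ := by simp [Θ]
      rw [← SchwartzMap.fourier_coe, this]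
      rfl
    have h4 := VectorFourier.integral_fourierIntegral_smul_eq_flip (L := innerₗ ℝ)
      (μ := volume) (ν := volume) Real.continuous_fourierChar continuous_inner Θ.integrable hgi
    have h5 : ∫ y, FourierTransform.fourier (Θ : ℝ → ℂ) y • g y =
        ∫ y, Θ y • FourierTransform.fourier g y := by simpa using! h4
    simp only [hFg, h3, smul_zero, integral_zero] at h5
    simpa using h5
  filter_upwards [hg0] with y hy
  have : (Real.exp (-(y ^ 2) / 2) : ℂ) ≠ 0 := by exact_mod_cast (Real.exp_pos _).ne'
  exact (mul_eq_zero.1 hy).resolve_left this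

/-- The Hermite functions are complete in `L²(ℝ)`. -/
theorem ae_eq_zero_of_hermite {f : ℝ → ℂ} (hf : MemLp f 2)
    (h : ∀ n : ℕ, ∫ y, f y * (hermiteFun n y : ℂ) = 0) : f =ᵐ[volume] 0 := by
  have hint : ∀ p : Polynomial ℝ, Integrable fun y => f y * polyGauss p y := fun p =>
    hf.integrable_mul (memLp_polyGauss p)
  -- The recurrence trades a power of `y` for neighbouring indices. The case `n = 0` then says that
  -- all Gaussian moments vanish.
  have key : ∀ (k n : ℕ), ∫ y : ℝ, f y * ((y ^ k * hermiteFun n y : ℝ) : ℂ) = 0 := by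
    intro k
    induction k with
    | zero => simpa using h
    | succ k ih =>
      intro n
      have hi' : ∀ n, Integrable fun y : ℝ => f y * ((y ^ k * hermiteFun n y : ℝ) : ℂ) := by
        intro n
        refine (hint (Polynomial.X ^ k * hermitePoly n)).congr (ae_of_all _ fun y => ?_)
        simp only [polyGauss_X_pow_mul, polyGauss_hermitePoly]
        push_cast
        rfl
      have e : ∀ y : ℝ, f y * ((y ^ (k + 1) * hermiteFun n y : ℝ) : ℂ) =
          (Real.sqrt ((n + 1) / 2) : ℂ) * (f y * ((y ^ k * hermiteFun (n + 1) y : ℝ) : ℂ)) +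
          (Real.sqrt (n / 2) : ℂ) * (f y * ((y ^ k * hermiteFun (n - 1) y : ℝ) : ℂ)) := by
        intro y
        rw [pow_succ, mul_assoc, mul_hermiteFun]
        push_cast
        ring
      simp_rw [e]
      rw [integral_add ((hi' _).const_mul _) ((hi' _).const_mul _), integral_const_mul,
        integral_const_mul, ih, ih, mul_zero, mul_zero, add_zero]
  refine ae_eq_zero_of_gauss_moments hf fun k => ?_
  have h0 := key k 0
  set c : ℝ := (Real.sqrt (Nat.factorial 0 * Real.sqrt Real.pi))⁻¹ with hc
  have hc0 : (c : ℂ) ≠ 0 := by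
    have : 0 < Real.sqrt Real.pi := Real.sqrt_pos.2 Real.pi_pos
    have : c ≠ 0 := by rw [hc]; simp; positivity
    exact_mod_cast this
  have e : ∀ y : ℝ, f y * ((y ^ k * hermiteFun 0 y : ℝ) : ℂ) =
      (c : ℂ) * (f y * ((y ^ k * Real.exp (-(y ^ 2) / 2) : ℝ) : ℂ)) := by
    intro y
    simp only [hermiteFun, ← hc, Polynomial.hermite_zero, map_one]
    push_cast
    ring
  simp_rw [e] at h0
  rw [integral_const_mul] at h0
  exact (mul_eq_zero.1 h0).resolve_left hc0

/-! ### Completeness of half-line exponentials times Hermite functions. -/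

/-- The product function `a(x) b(y)`. -/
def tensor (a b : ℝ → ℂ) (p : ℝ × ℝ) : ℂ := a p.1 * b p.2

lemma aestronglyMeasurable_tensor {a b : ℝ → ℂ} (ha : AEStronglyMeasurable a)
    (hb : AEStronglyMeasurable b) : AEStronglyMeasurable (tensor a b) (volume : Measure (ℝ × ℝ)) := by
  rw [Measure.volume_eq_prod]
  exact (ha.comp_quasiMeasurePreserving Measure.quasiMeasurePreserving_fst).mul
    (hb.comp_quasiMeasurePreserving Measure.quasiMeasurePreserving_snd)

lemma memLp_tensor {a b : ℝ → ℂ} (ha : MemLp a 2) (hb : MemLp b 2) : MemLp (tensor a b) 2 := by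
  rw [memLp_two_iff_integrable_sq_norm
    (aestronglyMeasurable_tensor ha.aestronglyMeasurable hb.aestronglyMeasurable)]
  have h1 := (memLp_two_iff_integrable_sq_norm ha.aestronglyMeasurable).1 ha
  have h2 := (memLp_two_iff_integrable_sq_norm hb.aestronglyMeasurable).1 hb
  refine (h1.mul_prod h2).congr (ae_of_all _ fun p => ?_)
  simp only [tensor, norm_mul, mul_pow]

lemma integrable_exp_neg_mul_abs {c : ℝ} (hc : 0 < c) :
    Integrable fun x : ℝ => Real.exp (-c * |x|) := by
  have ha : -c < 0 := by linarith
  rw [← integrableOn_univ, ← Set.Iic_union_Ioi (a := (0 : ℝ))]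
  refine IntegrableOn.union ?_ ?_
  · refine (integrableOn_exp_mul_Iic hc 0).congr_fun (fun x hx => ?_) measurableSet_Iic
    simp only [Set.mem_Iic] at hx
    simp only [abs_of_nonpos hx]; congr 1; ring
  · refine (integrableOn_exp_mul_Ioi ha 0).congr_fun (fun x hx => ?_) measurableSet_Ioi
    simp only [Set.mem_Ioi] at hx
    simp only [abs_of_pos hx]

/-- The exponential `exp(-sσx)` on the half-line `σx > 0`, extended by zero. -/
def halfExp (σ : ℝ) (s : ℂ) (x : ℝ) : ℂ :=
  if 0 < σ * x then Complex.exp (-(s * (σ * x : ℝ))) else 0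

lemma measurable_halfExp (σ : ℝ) (s : ℂ) : Measurable (halfExp σ s) := by
  unfold halfExp
  refine Measurable.ite (measurableSet_lt measurable_const (by fun_prop)) ?_ measurable_const
  fun_prop

lemma norm_halfExp_le {σ : ℝ} (hσ : |σ| = 1) (s : ℂ) (x : ℝ) :
    ‖halfExp σ s x‖ ≤ Real.exp (-s.re * |x|) := by
  unfold halfExp
  split_ifs with h
  · rw [Complex.norm_exp]
    refine Real.exp_le_exp.2 (le_of_eq ?_)
    rw [Complex.neg_re, Complex.re_mul_ofReal, ← abs_of_pos h, abs_mul, hσ]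
    ring
  · rw [norm_zero]
    positivity

lemma memLp_halfExp {σ : ℝ} (hσ : |σ| = 1) {s : ℂ} (hs : 0 < s.re) : MemLp (halfExp σ s) 2 := by
  rw [memLp_two_iff_integrable_sq_norm (measurable_halfExp σ s).aestronglyMeasurable]
  refine (integrable_exp_neg_mul_abs (by positivity : 0 < 2 * s.re)).mono'
    ((measurable_halfExp σ s).norm.pow_const 2).aestronglyMeasurable (ae_of_all _ fun x => ?_)
  rw [Real.norm_of_nonneg (sq_nonneg _)]
  refine (pow_le_pow_left₀ (norm_nonneg _) (norm_halfExp_le hσ s x) 2).trans (le_of_eq ?_)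
  rw [← Real.exp_nat_mul]
  congr 1
  push_cast
  ring

lemma conj_halfExp (σ : ℝ) (s : ℂ) (x : ℝ) : conj (halfExp σ s x) = halfExp σ (conj s) x := by
  unfold halfExp
  split_ifs
  · rw [← Complex.exp_conj, map_neg, map_mul, Complex.conj_ofReal]
  · simp

/-- A function on the half-line all of whose Laplace moments `∫ exp(-kx) f(x) dx`, `k ≥ 1`, vanish
is zero. -/
theorem ae_eq_zero_of_laplace {f : ℝ → ℂ}
    (hf : IntegrableOn (fun x => (Real.exp (-x) : ℂ) * f x) (Set.Ioi 0))
    (h : ∀ k : ℕ, ∫ x in Set.Ioi (0 : ℝ), (Real.exp (-((k + 1) * x)) : ℂ) * f x = 0) :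
    ∀ᵐ x : ℝ, 0 < x → f x = 0 := by
  set g : ℝ → ℂ := fun x => (Real.exp (-x) : ℂ) * f x with hg
  have hmeas : ∀ w : ℝ → ℝ, Continuous w → (∃ B : ℝ, ∀ x ∈ Set.Ioi (0 : ℝ), ‖w x‖ ≤ B) →
      IntegrableOn (fun x => (w x : ℂ) * g x) (Set.Ioi 0) := by
    rintro w hw ⟨B, hB⟩
    refine Integrable.bdd_mul (c := B) hf (Continuous.aestronglyMeasurable (by fun_prop)) ?_
    filter_upwards [ae_restrict_mem measurableSet_Ioi] with x hx
    rw [Complex.norm_real]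
    exact hB x hx
  have hexp : ∀ x ∈ Set.Ioi (0 : ℝ), Real.exp (-x) ∈ Set.Icc (0 : ℝ) 1 := fun x hx =>
    ⟨(Real.exp_pos _).le, Real.exp_le_one_iff.2 (by simpa using (le_of_lt hx))⟩
  have hpi : ∀ p : Polynomial ℝ,
      IntegrableOn (fun x => ((p.eval (Real.exp (-x)) : ℝ) : ℂ) * g x) (Set.Ioi 0) := by
    intro p
    refine hmeas _ (p.continuous.comp (by fun_prop)) ?_
    obtain ⟨B, hB⟩ := isCompact_Icc.exists_bound_of_continuousOn
      (s := Set.Icc (0 : ℝ) 1) p.continuous.continuousOn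
    exact ⟨B, fun x hx => hB _ (hexp x hx)⟩
  -- In the variable `t = exp(-x)` the Laplace moments are polynomial moments of `g`; the first
  -- factor `exp(-x)` is kept in `g` to make it integrable.
  have hpoly : ∀ p : Polynomial ℝ,
      ∫ x in Set.Ioi (0 : ℝ), ((p.eval (Real.exp (-x)) : ℝ) : ℂ) * g x = 0 := by
    intro p
    induction p using Polynomial.induction_on' with
    | add p q hp hq =>
      simp only [Polynomial.eval_add, Complex.ofReal_add, add_mul]
      rw [integral_add (hpi p) (hpi q), hp, hq, add_zero]
    | monomial n a =>
      have e : ∀ x : ℝ, (((Polynomial.monomial n a).eval (Real.exp (-x)) : ℝ) : ℂ) * g x =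
          (a : ℂ) * ((Real.exp (-((n + 1) * x)) : ℂ) * f x) := by
        intro x
        rw [Polynomial.eval_monomial, ← Real.exp_nat_mul, hg]
        simp only
        rw [show -(((n : ℝ) + 1) * x) = n * -x + -x by ring, Real.exp_add]
        push_cast
        ring
      simp_rw [e]
      rw [integral_const_mul, h n, mul_zero]
  have hg0 : ∀ᵐ x : ℝ, x ∈ Set.Ioi (0 : ℝ) → g x = 0 := by
    refine isOpen_Ioi.ae_eq_zero_of_integral_contDiff_smul_eq_zero
      hf.locallyIntegrableOn fun φ h1 h2 h3 => ?_
    have hφ0 : ∀ x ≤ 0, φ x = 0 := fun x hx =>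
      image_eq_zero_of_notMem_tsupport fun hm => absurd (h3 hm) (by simpa using hx)
    have hset : ∫ x, φ x • g x = ∫ x in Set.Ioi (0 : ℝ), (φ x : ℂ) * g x := by
      rw [setIntegral_eq_integral_of_forall_compl_eq_zero]
      · rfl
      · intro x hx
        rw [hφ0 x (by simpa using hx)]
        simp
    obtain ⟨R, hR⟩ := h2.isCompact.isBounded.subset_closedBall 0
    have hφR : ∀ x, R < x → φ x = 0 := fun x hx =>
      image_eq_zero_of_notMem_tsupport fun hm => by
        have := hR hm
        rw [Metric.mem_closedBall, dist_zero_right, Real.norm_eq_abs] at this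
        linarith [le_abs_self x]
    -- Near `t = 0` the function vanishes because `φ` has bounded support. The convention `Real.log
    -- 0 = 0` is harmless, as `φ 0 = 0`.
    have hcont : ContinuousOn (fun t => φ (-Real.log t)) (Set.Icc 0 1) := by
      intro t ht
      rcases ht.1.eq_or_lt with rfl | ht0
      · have hev : ∀ᶠ t in 𝓝[Set.Icc 0 1] (0 : ℝ), φ (-Real.log t) = 0 := by
          have : ∀ᶠ t in 𝓝[Set.Icc 0 1] (0 : ℝ), t < Real.exp (-R) :=
            nhdsWithin_le_nhds (Iio_mem_nhds (Real.exp_pos _))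
          filter_upwards [this, self_mem_nhdsWithin] with t ht1 ht2
          rcases ht2.1.eq_or_lt with rfl | ht0
          · simpa using hφ0 0 le_rfl
          · exact hφR _ (by have := (Real.log_lt_iff_lt_exp ht0).2 ht1; linarith)
        refine ContinuousWithinAt.congr_of_eventuallyEq continuousWithinAt_const hev ?_
        simpa using hφ0 0 le_rfl
      · exact (h1.continuous.continuousAt.comp
          (Real.continuousAt_log ht0.ne').neg).continuousWithinAt
    rw [hset]
    have hle : ∀ ε : ℝ, 0 < ε → ‖∫ x in Set.Ioi (0 : ℝ), (φ x : ℂ) * g x‖ ≤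
        ε * ∫ x in Set.Ioi (0 : ℝ), ‖g x‖ := by
      intro ε hε
      -- Weierstrass approximation on `[0, 1]`: the polynomial pairs to zero with `g`, and the error
      -- costs at most `ε ∫ |g|`.
      obtain ⟨p, hp⟩ := exists_polynomial_near_of_continuousOn 0 1 _ hcont ε hε
      have hφi : IntegrableOn (fun x => (φ x : ℂ) * g x) (Set.Ioi 0) := by
        obtain ⟨B, hB⟩ := h1.continuous.bounded_above_of_compact_support h2
        exact hmeas φ h1.continuous ⟨B, fun x _ => hB x⟩
      rw [← sub_zero (∫ x in Set.Ioi (0 : ℝ), (φ x : ℂ) * g x), ← hpoly p,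
        ← integral_sub hφi (hpi p), ← integral_const_mul]
      refine norm_integral_le_of_norm_le (hf.norm.const_mul ε) ?_
      filter_upwards [ae_restrict_mem measurableSet_Ioi] with x hx
      rw [← sub_mul, norm_mul, ← Complex.ofReal_sub, Complex.norm_real, norm_sub_rev]
      refine mul_le_mul_of_nonneg_right ?_ (norm_nonneg _)
      have := hp _ (hexp x hx)
      rw [Real.log_exp, neg_neg] at this
      exact this.le
    refine norm_le_zero_iff.1 ?_
    refine ge_of_tendsto (x := 𝓝[>] (0 : ℝ))
      (f := fun ε => ε * ∫ x in Set.Ioi (0 : ℝ), ‖g x‖) ?_ ?_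
    · have : Tendsto (fun ε : ℝ => ε * ∫ x in Set.Ioi (0 : ℝ), ‖g x‖) (𝓝 0)
          (𝓝 (0 * ∫ x in Set.Ioi (0 : ℝ), ‖g x‖)) := Continuous.tendsto (by fun_prop) 0
      rw [zero_mul] at this
      exact this.mono_left nhdsWithin_le_nhds
    · filter_upwards [self_mem_nhdsWithin] with ε hε using hle ε hε
  filter_upwards [hg0] with x hx h0
  exact (mul_eq_zero.1 (hx h0)).resolve_left (by exact_mod_cast (Real.exp_pos _).ne')

/-- The second difference factors as `exp(-(k+1)x) (1 - exp(-x))²`, in the coordinate `σ x > 0`. The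
Laplace moments of `(1 - exp(-x))² f(σx)` therefore vanish, and the square is nonzero for `x > 0`.
-/
lemma ae_eq_zero_of_halfExp {f : ℝ → ℂ} {σ : ℝ} (hσ : σ = 1 ∨ σ = -1)
    (hi : ∀ k : ℕ, Integrable fun x => halfExp σ ((k : ℂ) + 1) x * f x)
    (h : ∀ k : ℕ, ∫ x, (halfExp σ ((k : ℂ) + 1) x - 2 * halfExp σ ((k : ℂ) + 2) x +
      halfExp σ ((k : ℂ) + 3) x) * f x = 0) : ∀ᵐ x : ℝ, 0 < σ * x → f x = 0 := by
  have hσσ : σ * σ = 1 := by rcases hσ with rfl | rfl <;> norm_num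
  have hchange : ∀ F : ℝ → ℂ, ∫ x, F (σ * x) = ∫ x, F x := by
    intro F
    rcases hσ with rfl | rfl
    · simp
    · simpa using integral_neg_eq_self F volume
  have hval : ∀ (k : ℂ) (x : ℝ), halfExp σ k (σ * x) =
      if 0 < x then Complex.exp (-(k * x)) else 0 := by
    intro k x
    simp only [halfExp, ← mul_assoc, hσσ, one_mul]
  have hle : ∀ x : ℝ, ‖(1 - Complex.exp (-x)) ^ 2 * (if 0 < x then 1 else 0 : ℂ)‖ ≤ 1 := by
    intro x
    split_ifs with hx
    · rw [mul_one, norm_pow, ← Complex.ofReal_neg, ← Complex.ofReal_exp, ← Complex.ofReal_one,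
        ← Complex.ofReal_sub, Complex.norm_real, Real.norm_eq_abs, sq_abs]
      have h1 := Real.exp_pos (-x)
      have h2 : Real.exp (-x) ≤ 1 := Real.exp_le_one_iff.2 (by linarith)
      nlinarith
    · simp
  have hint : IntegrableOn (fun x : ℝ => (Real.exp (-x) : ℂ) *
      ((1 - Complex.exp (-x)) ^ 2 * f (σ * x))) (Set.Ioi 0) := by
    have h0 : Integrable fun x => halfExp σ ((0 : ℕ) + 1) (σ * x) * f (σ * x) := by
      rcases hσ with rfl | rfl
      · simpa using hi 0
      · simpa using (hi 0).comp_neg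
    refine (Integrable.bdd_mul (c := 1) h0 (f := fun x : ℝ =>
      (1 - Complex.exp (-x)) ^ 2 * (if 0 < x then 1 else 0 : ℂ)) ?_
      (ae_of_all _ hle)).integrableOn.congr_fun (fun x hx => ?_) measurableSet_Ioi
    · refine Measurable.aestronglyMeasurable (Measurable.mul (by fun_prop) ?_)
      exact Measurable.ite (measurableSet_Ioi (a := (0 : ℝ))) measurable_const measurable_const
    · simp only [Set.mem_Ioi] at hx
      simp only [hval, if_pos hx]
      push_cast
      ring_nf
  have hz := ae_eq_zero_of_laplace hint fun k => by
    rw [← h k, ← hchange]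
    refine Eq.trans ?_ (setIntegral_eq_integral_of_forall_compl_eq_zero
      (s := Set.Ioi (0 : ℝ)) ?_)
    · refine setIntegral_congr_fun measurableSet_Ioi fun x hx => ?_
      simp only [Set.mem_Ioi] at hx
      simp only [hval, if_pos hx]
      have e1 : ∀ m : ℕ, Complex.exp (-(((k : ℂ) + (m + 1)) * x)) =
          Complex.exp (-((k + 1) * x)) * Complex.exp (-x) ^ m := by
        intro m
        rw [← Complex.exp_nat_mul, ← Complex.exp_add]
        congr 1
        ring
      have e2 := e1 1
      have e3 := e1 2
      norm_num at e2 e3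
      rw [e2, e3]
      push_cast
      ring
    · intro x hx
      simp only [Set.mem_Ioi] at hx
      simp [hval, if_neg hx]
  have hz' : ∀ᵐ x : ℝ, 0 < x → f (σ * x) = 0 := by
    filter_upwards [hz] with x hx h0
    refine (mul_eq_zero.1 (hx h0)).resolve_left (pow_ne_zero 2 ?_)
    rw [sub_ne_zero, ← Complex.ofReal_neg, ← Complex.ofReal_exp]
    have : Real.exp (-x) < 1 := by rw [← Real.exp_zero]; exact Real.exp_lt_exp.2 (by linarith)
    exact_mod_cast this.ne'
  have hz2 : ∀ᵐ x : ℝ, 0 < σ * x → f (σ * (σ * x)) = 0 := by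
    have hq : Measure.QuasiMeasurePreserving (fun x : ℝ => σ * x) volume volume := by
      rcases hσ with rfl | rfl
      · simpa using! Measure.QuasiMeasurePreserving.id _
      · simpa using (Measure.measurePreserving_neg (volume : Measure ℝ)).quasiMeasurePreserving
    exact hq.ae hz'
  filter_upwards [hz2] with x hx h0
  have := hx h0
  rwa [← mul_assoc, hσσ, one_mul] at this

/-- The products of exponentials on the half-lines and Hermite functions are complete; only second
differences of the exponentials, which vanish to second order at the line, are used. -/
theorem ae_eq_zero_of_halfExp_hermite {F : ℝ × ℝ → ℂ} (hF : MemLp F 2)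
    (h : ∀ σ : ℝ, (σ = 1 ∨ σ = -1) → ∀ n k : ℕ,
      ∫ p, tensor (fun x => halfExp σ ((k : ℂ) + 1) x - 2 * halfExp σ ((k : ℂ) + 2) x +
        halfExp σ ((k : ℂ) + 3) x) (polyGauss (hermitePoly n)) p * F p = 0) :
    F =ᵐ[volume] 0 := by
  -- A strongly measurable representative makes the slices and the zero set measurable, as needed
  -- for Fubini at the end.
  wlog hm : StronglyMeasurable F generalizing F
  · obtain ⟨F', hF', hFF'⟩ := hF.aestronglyMeasurable
    refine hFF'.trans (this (hF.ae_eq hFF') (fun σ hσ n k => ?_) hF')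
    rw [← h σ hσ n k]
    exact integral_congr_ae (hFF'.mono fun p hp => by simp only [hp])
  have habs : ∀ σ : ℝ, (σ = 1 ∨ σ = -1) → |σ| = 1 := by
    rintro σ (rfl | rfl) <;> simp
  -- The `n`-th Hermite coefficient of the slice at `x`. It vanishes on each half-line for almost
  -- every `x`, simultaneously in the countably many `n`; completeness in `y` then kills almost
  -- every slice.
  set Fn : ℕ → ℝ → ℂ := fun n x => ∫ y, polyGauss (hermitePoly n) y * F (x, y) with hFn
  have hmem : ∀ σ : ℝ, (σ = 1 ∨ σ = -1) → ∀ (k m : ℕ), MemLp (halfExp σ ((k : ℂ) + (m + 1))) 2 :=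
    fun σ hσ k m => memLp_halfExp (habs σ hσ) (by simp; positivity)
  have hfub : ∀ (a : ℝ → ℂ), MemLp a 2 → ∀ n, Integrable (fun x => a x * Fn n x) ∧
      ∫ p, tensor a (polyGauss (hermitePoly n)) p * F p = ∫ x, a x * Fn n x := by
    intro a ha n
    have hi : Integrable (fun p => tensor a (polyGauss (hermitePoly n)) p * F p)
        (volume.prod volume) := by
      rw [← Measure.volume_eq_prod]
      exact (memLp_tensor ha (memLp_polyGauss _)).integrable_mul hF
    have e : ∀ x, ∫ y, tensor a (polyGauss (hermitePoly n)) (x, y) * F (x, y) =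
        a x * Fn n x := by
      intro x
      simp only [tensor, mul_assoc, hFn]
      rw [integral_const_mul]
    constructor
    · refine hi.integral_prod_left.congr (ae_of_all _ fun x => e x)
    · rw [Measure.volume_eq_prod, integral_prod _ hi]
      simp_rw [e]
  have hzero : ∀ σ : ℝ, (σ = 1 ∨ σ = -1) → ∀ n, ∀ᵐ x : ℝ, 0 < σ * x → Fn n x = 0 := by
    intro σ hσ n
    refine ae_eq_zero_of_halfExp hσ (fun k => ?_) fun k => ?_
    · have := hmem σ hσ k 0
      norm_num at this
      exact (hfub _ this n).1
    · have h1 := hmem σ hσ k 0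
      have h2 := hmem σ hσ k 1
      have h3 := hmem σ hσ k 2
      norm_num at h1 h2 h3
      rw [← h σ hσ n k]
      exact (hfub _ ((h1.sub (h2.const_mul 2)).add h3) n).2.symm
  have hall : ∀ᵐ x : ℝ, ∀ n, Fn n x = 0 := by
    rw [ae_all_iff]
    intro n
    filter_upwards [hzero 1 (Or.inl rfl) n, hzero (-1) (Or.inr rfl) n,
      Measure.ae_ne volume (0 : ℝ)] with x h1 h2 h3
    rcases lt_or_gt_of_ne h3 with h4 | h4
    · exact h2 (by linarith)
    · exact h1 (by linarith)
  have hslice : ∀ᵐ x : ℝ, MemLp (fun y => F (x, y)) 2 := by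
    have hi := (memLp_two_iff_integrable_sq_norm hF.aestronglyMeasurable).1 hF
    rw [Measure.volume_eq_prod] at hi
    filter_upwards [hi.prod_right_ae] with x hx
    exact (memLp_two_iff_integrable_sq_norm
      (hm.comp_measurable measurable_prodMk_left).aestronglyMeasurable).2 hx
  have hae : ∀ᵐ x : ℝ, ∀ᵐ y : ℝ, (x, y) ∈ {p : ℝ × ℝ | F p = 0} := by
    filter_upwards [hall, hslice] with x h1 h2
    refine ae_eq_zero_of_hermite h2 fun n => ?_
    rw [← h1 n]
    simp only [hFn, polyGauss_hermitePoly, mul_comm]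
  rw [Measure.volume_eq_prod]
  exact (Measure.ae_prod_mem_iff_ae_ae_mem
    (hm.measurable (measurableSet_singleton 0))).2 hae

/-! ### Weak derivatives and one-sided traces of products. -/

/-- A classical derivative off the line `x = 0` is a weak derivative. -/
lemma hasWeakDeriv_of_hasLineDerivAt {v : ℝ × ℝ} {f g : ℝ × ℝ → ℂ} (hf : MemLp f 2)
    (hg : MemLp g 2) (h : ∀ p ∈ offLine, HasLineDerivAt ℝ f (g p) p v) : HasWeakDeriv v f g := by
  intro φ h1 h2 h3
  have key := integral_bilinear_hasLineDerivAt_right_eq_neg_left_of_integrable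
    (μ := (volume : Measure (ℝ × ℝ))) (f := φ) (f' := fun p => fderiv ℝ φ p v)
    (g := f) (g' := g) (v := v) (B := ContinuousLinearMap.lsmul ℝ ℝ)
    (integrable_fderiv_smul h1 h2 v hf) (integrable_test_smul h1.continuous h2 hg)
    (integrable_test_smul h1.continuous h2 hf)
    (fun p _ => ((h1.differentiable (by simp)).differentiableAt (x := p)).hasFDerivAt.hasLineDerivAt
      v) (fun p hp => h p (h3 hp))
  simp only [ContinuousLinearMap.lsmul_apply] at key
  rw [key, neg_neg]

lemma hasWeakDeriv_tensor_fst {a a' b : ℝ → ℂ} (ha : MemLp a 2) (ha' : MemLp a' 2)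
    (hb : MemLp b 2) (h : ∀ x ≠ 0, HasDerivAt a (a' x) x) :
    HasWeakDeriv (1, 0) (tensor a b) (tensor a' b) := by
  refine hasWeakDeriv_of_hasLineDerivAt (memLp_tensor ha hb) (memLp_tensor ha' hb) fun p hp => ?_
  have e : HasDerivAt (fun t : ℝ => a (p.1 + t)) (a' p.1) 0 := by
    have h0 : HasDerivAt a (a' p.1) (p.1 + 0) := by rw [add_zero]; exact h _ hp
    exact h0.comp_const_add p.1 0
  have := e.mul_const (b p.2)
  simpa [HasLineDerivAt, tensor] using this

lemma hasWeakDeriv_tensor_snd {a b b' : ℝ → ℂ} (ha : MemLp a 2) (hb : MemLp b 2)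
    (hb' : MemLp b' 2) (h : ∀ y, HasDerivAt b (b' y) y) :
    HasWeakDeriv (0, 1) (tensor a b) (tensor a b') := by
  refine hasWeakDeriv_of_hasLineDerivAt (memLp_tensor ha hb) (memLp_tensor ha hb') fun p _ => ?_
  have e : HasDerivAt (fun t : ℝ => b (p.2 + t)) (b' p.2) 0 := by
    have h0 : HasDerivAt b (b' p.2) (p.2 + 0) := by rw [add_zero]; exact h _
    exact h0.comp_const_add p.2 0
  have := e.const_mul (a p.1)
  simpa [HasLineDerivAt, tensor] using this

/-- The trace on the line `x = 0` from the side `σx > 0`. -/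
def IsSideTrace (σ : ℝ) (f : ℝ × ℝ → ℂ) (u : ℝ → ℂ) : Prop :=
  IsStripTrace (fun ε => {x | 0 < σ * x ∧ σ * x < ε}) f u

lemma isSideTrace_one {f : ℝ × ℝ → ℂ} {u : ℝ → ℂ} : IsSideTrace 1 f u ↔ IsRightTrace f u := by
  have : (fun ε : ℝ => {x : ℝ | 0 < 1 * x ∧ 1 * x < ε}) = fun ε => Set.Ioo 0 ε := by
    ext ε x
    simp
  rw [IsSideTrace, this, IsRightTrace]

lemma isSideTrace_neg_one {f : ℝ × ℝ → ℂ} {u : ℝ → ℂ} :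
    IsSideTrace (-1) f u ↔ IsLeftTrace f u := by
  have : (fun ε : ℝ => {x : ℝ | 0 < -1 * x ∧ -1 * x < ε}) = fun ε => Set.Ioo (-ε) 0 := by
    ext ε x
    simp only [Set.mem_ofPred_eq, Set.mem_Ioo]
    constructor <;> rintro ⟨h1, h2⟩ <;> constructor <;> linarith
  rw [IsSideTrace, this, IsLeftTrace]

lemma measurableSet_sideStrip (σ ε : ℝ) : MeasurableSet {x : ℝ | 0 < σ * x ∧ σ * x < ε} :=
  (measurable_const_mul σ) (measurableSet_Ioo (a := 0) (b := ε))

lemma volume_sideStrip {σ : ℝ} (hσ : σ = 1 ∨ σ = -1) (ε : ℝ) :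
    volume {x : ℝ | 0 < σ * x ∧ σ * x < ε} = ENNReal.ofReal ε := by
  rcases hσ with rfl | rfl
  · have : {x : ℝ | 0 < 1 * x ∧ 1 * x < ε} = Set.Ioo 0 ε := by ext x; simp
    rw [this, Real.volume_Ioo, sub_zero]
  · have : {x : ℝ | 0 < -1 * x ∧ -1 * x < ε} = Set.Ioo (-ε) 0 := by
      ext x
      simp only [Set.mem_ofPred_eq, Set.mem_Ioo]
      constructor <;> rintro ⟨h1, h2⟩ <;> constructor <;> linarith
    rw [this, Real.volume_Ioo]
    congr 1
    ring

lemma lintegral_strip_snd {σ : ℝ} (hσ : σ = 1 ∨ σ = -1) (ε : ℝ) {g : ℝ → ENNReal}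
    (hg : AEMeasurable g) :
    ∫⁻ p in {x : ℝ | 0 < σ * x ∧ σ * x < ε} ×ˢ (Set.univ : Set ℝ), g p.2 =
      ENNReal.ofReal ε * ∫⁻ y, g y := by
  rw [Measure.volume_eq_prod, ← Measure.prod_restrict, Measure.restrict_univ]
  have := lintegral_prod_mul (μ := volume.restrict {x : ℝ | 0 < σ * x ∧ σ * x < ε})
    (ν := (volume : Measure ℝ)) (f := fun _ => 1) (g := g) aemeasurable_const hg
  simpa [volume_sideStrip hσ] using this

lemma lintegral_enorm_sq_lt_top {b : ℝ → ℂ} (hb : MemLp b 2) : ∫⁻ y, ‖b y‖ₑ ^ 2 < ⊤ := by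
  have := hb.2
  rw [eLpNorm_lt_top_iff_lintegral_rpow_enorm_lt_top (by norm_num) (by norm_num)] at this
  simpa using this

/-- The trace of `a(x) b(y)` is `a(0±) b(y)`. -/
lemma isSideTrace_tensor {σ : ℝ} (hσ : σ = 1 ∨ σ = -1) {a b : ℝ → ℂ} {c : ℂ} (hb : MemLp b 2)
    (ha : Tendsto (fun t => a (σ * t)) (𝓝[>] 0) (𝓝 c)) :
    IsSideTrace σ (tensor a b) (c • b) := by
  refine ⟨hb.const_smul c, ?_⟩
  set K := ∫⁻ y, ‖b y‖ₑ ^ 2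
  have hK : K ≠ ⊤ := (lintegral_enorm_sq_lt_top hb).ne
  have hσσ : σ * σ = 1 := by rcases hσ with rfl | rfl <;> norm_num
  rw [ENNReal.tendsto_nhds_zero]
  intro η hη
  have hlim : Tendsto (fun δ : ENNReal => δ ^ 2 * K) (𝓝 0) (𝓝 0) := by
    have h1 : Tendsto (fun δ : ENNReal => δ ^ 2 * K) (𝓝 0) (𝓝 (0 ^ 2 * K)) :=
      ENNReal.Tendsto.mul_const ((ENNReal.continuous_pow 2).tendsto 0) (Or.inr hK)
    simpa using h1
  have ha' : Tendsto (fun t => ‖a (σ * t) - c‖ₑ ^ 2 * K) (𝓝[>] 0) (𝓝 0) := by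
    refine hlim.comp ?_
    have := (ha.sub_const c).enorm
    simpa using this
  have hev := (ENNReal.tendsto_nhds_zero.1 ha') η hη
  rw [eventually_nhdsWithin_iff, Metric.eventually_nhds_iff] at hev
  obtain ⟨r, hr, hev⟩ := hev
  filter_upwards [self_mem_nhdsWithin, nhdsWithin_le_nhds (Iio_mem_nhds hr)] with ε hε hεr
  simp only [Set.mem_Ioi] at hε
  -- The pointwise bound `η / K` needs `K ≠ 0`; if `K = 0`, then `b` vanishes almost everywhere.
  by_cases hK0 : K = 0
  · have hb0 : ∀ᵐ y, b y = 0 := by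
      have := (lintegral_eq_zero_iff' (hb.aestronglyMeasurable.enorm.pow_const 2)).1 hK0
      filter_upwards [this] with y hy
      simpa using hy
    have hb1 : ∀ᵐ p : ℝ × ℝ, b p.2 = 0 := by
      rw [Measure.volume_eq_prod]
      exact Measure.quasiMeasurePreserving_snd.ae hb0
    rw [lintegral_eq_zero_of_ae_eq_zero]
    · simp
    · refine ae_restrict_of_ae (hb1.mono fun p hp => ?_)
      simp [tensor, hp]
  · have hle : ∀ x ∈ {x : ℝ | 0 < σ * x ∧ σ * x < ε}, ‖a x - c‖ₑ ^ 2 ≤ η / K := by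
      rintro x ⟨h1, h2⟩
      have h3 := hev (y := σ * x) (by
        rw [Real.dist_eq, sub_zero, abs_of_pos h1]
        exact h2.trans hεr) h1
      rw [← mul_assoc, hσσ, one_mul] at h3
      exact (ENNReal.le_div_iff_mul_le (Or.inl hK0) (Or.inl hK)).2 h3
    calc ENNReal.ofReal ε⁻¹ * ∫⁻ p in {x : ℝ | 0 < σ * x ∧ σ * x < ε} ×ˢ (Set.univ : Set ℝ),
          ‖tensor a b p - (c • b) p.2‖ₑ ^ 2
        ≤ ENNReal.ofReal ε⁻¹ * ∫⁻ p in {x : ℝ | 0 < σ * x ∧ σ * x < ε} ×ˢ (Set.univ : Set ℝ),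
          (η / K) * ‖b p.2‖ₑ ^ 2 := by
          refine mul_le_mul_right (setLIntegral_mono_ae' ((measurableSet_sideStrip σ ε).prod
            MeasurableSet.univ) (ae_of_all _ fun p hp => ?_)) _
          rw [show tensor a b p - (c • b) p.2 = (a p.1 - c) * b p.2 by
            simp [tensor]; ring, enorm_mul, mul_pow]
          exact mul_le_mul_left (hle p.1 hp.1) _
      _ = ENNReal.ofReal ε⁻¹ * (ENNReal.ofReal ε * ((η / K) * K)) := by
          rw [lintegral_strip_snd hσ ε (g := fun y => (η / K) * ‖b y‖ₑ ^ 2)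
            ((hb.aestronglyMeasurable.enorm.pow_const 2).const_mul _),
            lintegral_const_mul'' _ (hb.aestronglyMeasurable.enorm.pow_const 2)]
      _ ≤ η := by
          rw [← mul_assoc, ← ENNReal.ofReal_mul (by positivity), inv_mul_cancel₀ hε.ne',
            ENNReal.ofReal_one, one_mul]
          exact (ENNReal.div_mul_cancel hK0 hK).le

lemma hasDerivAt_halfExp {σ : ℝ} (hσ : σ = 1 ∨ σ = -1) (s : ℂ) {x : ℝ} (hx : x ≠ 0) :
    HasDerivAt (halfExp σ s) (((-(s * σ)) • halfExp σ s) x) x := by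
  have hσ0 : σ ≠ 0 := by rcases hσ with rfl | rfl <;> norm_num
  have hcont : ContinuousAt (fun x : ℝ => σ * x) x := by fun_prop
  simp only [Pi.smul_apply, smul_eq_mul]
  rcases lt_or_gt_of_ne (mul_ne_zero hσ0 hx) with h | h
  · have he : halfExp σ s =ᶠ[𝓝 x] fun _ => 0 := by
      filter_upwards [hcont.eventually (Iio_mem_nhds h)] with z hz
      exact if_neg (not_lt.2 (le_of_lt hz))
    rw [he.self_of_nhds, mul_zero]
    exact (hasDerivAt_const x (0 : ℂ)).congr_of_eventuallyEq he
  · have he : halfExp σ s =ᶠ[𝓝 x] fun z => Complex.exp (-(s * (σ * z : ℝ))) := by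
      filter_upwards [hcont.eventually (Ioi_mem_nhds h)] with z hz
      exact if_pos hz
    rw [he.self_of_nhds]
    refine HasDerivAt.congr_of_eventuallyEq ?_ he
    have h1 : HasDerivAt (fun z : ℝ => ((σ * z : ℝ) : ℂ)) (σ : ℂ) x := by
      simpa using ((hasDerivAt_id x).const_mul σ).ofReal_comp
    refine ((h1.const_mul s).neg.cexp).congr_deriv ?_
    simp only [Pi.neg_apply]
    ring

lemma tendsto_halfExp_same {σ : ℝ} (hσ : σ = 1 ∨ σ = -1) (s : ℂ) :
    Tendsto (fun t => halfExp σ s (σ * t)) (𝓝[>] 0) (𝓝 1) := by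
  have hσσ : σ * σ = 1 := by rcases hσ with rfl | rfl <;> norm_num
  have h1 : Tendsto (fun t : ℝ => Complex.exp (-(s * t))) (𝓝 0) (𝓝 (Complex.exp (-(s * (0 : ℝ))))) :=
    Continuous.tendsto (by fun_prop) 0
  simp only [Complex.ofReal_zero, mul_zero, neg_zero, Complex.exp_zero] at h1
  refine (h1.mono_left nhdsWithin_le_nhds).congr' ?_
  filter_upwards [self_mem_nhdsWithin] with t ht
  simp only [halfExp, ← mul_assoc, hσσ, one_mul, if_pos (Set.mem_Ioi.1 ht)]

lemma tendsto_halfExp_neg {σ : ℝ} (hσ : σ = 1 ∨ σ = -1) (s : ℂ) :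
    Tendsto (fun t => halfExp σ s (-σ * t)) (𝓝[>] 0) (𝓝 0) := by
  have hσσ : σ * σ = 1 := by rcases hσ with rfl | rfl <;> norm_num
  refine tendsto_const_nhds.congr' ?_
  filter_upwards [self_mem_nhdsWithin] with t ht
  have : ¬ 0 < σ * (-σ * t) := by
    rw [show σ * (-σ * t) = -(σ * σ * t) by ring, hσσ, one_mul]
    simpa using (Set.mem_Ioi.1 ht).le
  simp only [halfExp, if_neg this]

/-! ### Pairs with arbitrary boundary data; the exponential modes. -/

/-- The conditions of `IsHamiltonianPair` without the matching conditions on the line. -/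
def IsUnmatchedPair (Ψ G : L2Plane) (ur ul dr dl : ℝ → ℂ) : Prop :=
  ∃ fx fy fxx fxy fyy : ℝ × ℝ → ℂ,
    IsH2 Ψ fx fy fxx fxy fyy ∧
    MemLp (fun p : ℝ × ℝ => (p.2 : ℂ) ^ 2 * Ψ p) 2 ∧
    IsSideTrace 1 Ψ ur ∧ IsSideTrace (-1) Ψ ul ∧ IsSideTrace 1 fx dr ∧ IsSideTrace (-1) fx dl ∧
    ∀ᵐ p : ℝ × ℝ, G p = -fxx p + 1 / 2 * (-fyy p + (p.2 : ℂ) ^ 2 * Ψ p)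

lemma isHamiltonianPair_iff {β : ℝ} {Ψ G : L2Plane} : IsHamiltonianPair β Ψ G ↔
    ∃ ur ul dr dl : ℝ → ℂ, IsUnmatchedPair Ψ G ur ul dr dl ∧
      (∀ᵐ y : ℝ, ur y - ul y = (β / y : ℂ) * dr y) ∧ ∀ᵐ y : ℝ, dr y = dl y := by
  simp only [IsHamiltonianPair, IsUnmatchedPair, isSideTrace_one, isSideTrace_neg_one]
  constructor
  · rintro ⟨fx, fy, fxx, fxy, fyy, ur, ul, dr, dl, h1, h2, h3, h4, h5, h6, h7, h8, h9⟩
    exact ⟨ur, ul, dr, dl, ⟨fx, fy, fxx, fxy, fyy, h1, h2, h3, h4, h5, h6, h9⟩, h7, h8⟩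
  · rintro ⟨ur, ul, dr, dl, ⟨fx, fy, fxx, fxy, fyy, h1, h2, h3, h4, h5, h6, h9⟩, h7, h8⟩
    exact ⟨fx, fy, fxx, fxy, fyy, ur, ul, dr, dl, h1, h2, h3, h4, h5, h6, h7, h8, h9⟩

lemma IsUnmatchedPair.memLp_traces {Ψ G : L2Plane} {ur ul dr dl : ℝ → ℂ}
    (h : IsUnmatchedPair Ψ G ur ul dr dl) : MemLp ur 2 ∧ MemLp ul 2 ∧ MemLp dr 2 ∧ MemLp dl 2 := by
  obtain ⟨fx, fy, fxx, fxy, fyy, -, -, t1, t2, t3, t4, -⟩ := h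
  exact ⟨t1.1, t2.1, t3.1, t4.1⟩

lemma IsUnmatchedPair.zero : IsUnmatchedPair 0 0 0 0 0 0 := by
  have h0 : (0 : ℝ × ℝ → ℂ) =ᵐ[volume] ((0 : L2Plane) : ℝ × ℝ → ℂ) := (Lp.coeFn_zero _ _ _).symm
  refine ⟨0, 0, 0, 0, 0, IsH2.zero.congr h0, ?_, (IsStripTrace.zero _).congr h0,
    (IsStripTrace.zero _).congr h0, IsStripTrace.zero _, IsStripTrace.zero _, ?_⟩
  · exact (MemLp.zero (ε := ℂ)).ae_eq (h0.mono fun p hp => by simp)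
  · filter_upwards with p
    simp

lemma IsUnmatchedPair.add {Ψ G Ψ' G' : L2Plane} {ur ul dr dl ur' ul' dr' dl' : ℝ → ℂ}
    (h : IsUnmatchedPair Ψ G ur ul dr dl) (k : IsUnmatchedPair Ψ' G' ur' ul' dr' dl') :
    IsUnmatchedPair (Ψ + Ψ') (G + G') (ur + ur') (ul + ul') (dr + dr') (dl + dl') := by
  obtain ⟨fx, fy, fxx, fxy, fyy, h, hy, t1, t2, t3, t4, e⟩ := h
  obtain ⟨fx', fy', fxx', fxy', fyy', h', hy', t1', t2', t3', t4', e'⟩ := k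
  have ha := (Lp.coeFn_add Ψ Ψ').symm
  refine ⟨fx + fx', fy + fy', fxx + fxx', fxy + fxy', fyy + fyy', (h.add h').congr ha, ?_,
    (IsStripTrace.add t1 t1' h.memLp).congr ha, (IsStripTrace.add t2 t2' h.memLp).congr ha,
    IsStripTrace.add t3 t3' h.memLp_x, IsStripTrace.add t4 t4' h.memLp_x, ?_⟩
  · refine (hy.add hy').ae_eq (ha.mono fun p hp => ?_)
    simp only [← hp, Pi.add_apply]
    ring
  · filter_upwards [e, e', ha, Lp.coeFn_add G G'] with p h1 h2 h3 h4
    rw [← h3, h4]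
    simp only [Pi.add_apply, h1, h2]
    ring

lemma IsUnmatchedPair.const_smul {Ψ G : L2Plane} {ur ul dr dl : ℝ → ℂ}
    (h : IsUnmatchedPair Ψ G ur ul dr dl) (c : ℂ) :
    IsUnmatchedPair (c • Ψ) (c • G) (c • ur) (c • ul) (c • dr) (c • dl) := by
  obtain ⟨fx, fy, fxx, fxy, fyy, h, hy, t1, t2, t3, t4, e⟩ := h
  have ha := (Lp.coeFn_smul c Ψ).symm
  refine ⟨c • fx, c • fy, c • fxx, c • fxy, c • fyy, (h.const_smul c).congr ha, ?_,
    (IsStripTrace.const_smul t1 c).congr ha, (IsStripTrace.const_smul t2 c).congr ha,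
    IsStripTrace.const_smul t3 c, IsStripTrace.const_smul t4 c, ?_⟩
  · refine (hy.const_smul c).ae_eq (ha.mono fun p hp => ?_)
    simp only [← hp, Pi.smul_apply, smul_eq_mul]
    ring
  · filter_upwards [e, ha, Lp.coeFn_smul c G] with p h1 h3 h4
    rw [← h3, h4]
    simp only [Pi.smul_apply, smul_eq_mul, h1]
    ring

lemma abs_eq_one_of_sign {σ : ℝ} (hσ : σ = 1 ∨ σ = -1) : |σ| = 1 := by
  rcases hσ with rfl | rfl <;> simp

/-- The function `exp(-sσx) χₙ(y)` on the half-plane `σx > 0`, extended by zero. -/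
def expMode {σ : ℝ} (hσ : σ = 1 ∨ σ = -1) {s : ℂ} (hs : 0 < s.re) (n : ℕ) : L2Plane :=
  (memLp_tensor (memLp_halfExp (abs_eq_one_of_sign hσ) hs) (memLp_polyGauss (hermitePoly n))).toLp

lemma coeFn_expMode {σ : ℝ} (hσ : σ = 1 ∨ σ = -1) {s : ℂ} (hs : 0 < s.re) (n : ℕ) :
    expMode hσ hs n =ᵐ[volume] tensor (halfExp σ s) (polyGauss (hermitePoly n)) :=
  MemLp.coeFn_toLp _

lemma isH2_tensor {σ : ℝ} (hσ : σ = 1 ∨ σ = -1) {s : ℂ} (hs : 0 < s.re) (q : Polynomial ℝ) :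
    IsH2 (tensor (halfExp σ s) (polyGauss q))
      (tensor (-(s * σ) • halfExp σ s) (polyGauss q))
      (tensor (halfExp σ s) (polyGauss (gaussDeriv q)))
      (tensor (-(s * σ) • -(s * σ) • halfExp σ s) (polyGauss q))
      (tensor (-(s * σ) • halfExp σ s) (polyGauss (gaussDeriv q)))
      (tensor (halfExp σ s) (polyGauss (gaussDeriv (gaussDeriv q)))) := by
  have m0 := memLp_halfExp (abs_eq_one_of_sign hσ) hs
  have m1 := m0.const_smul (-(s * σ))
  have m2 := m1.const_smul (-(s * σ))
  have d0 : ∀ x ≠ 0, HasDerivAt (halfExp σ s) ((-(s * σ) • halfExp σ s) x) x :=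
    fun x hx => hasDerivAt_halfExp hσ s hx
  have d1 : ∀ x ≠ 0, HasDerivAt (-(s * σ) • halfExp σ s)
      ((-(s * σ) • -(s * σ) • halfExp σ s) x) x := fun x hx => (d0 x hx).const_smul _
  have q0 := memLp_polyGauss q
  have q1 := memLp_polyGauss (gaussDeriv q)
  have q2 := memLp_polyGauss (gaussDeriv (gaussDeriv q))
  exact
    { memLp := memLp_tensor m0 q0
      memLp_x := memLp_tensor m1 q0
      memLp_y := memLp_tensor m0 q1
      memLp_xx := memLp_tensor m2 q0
      memLp_xy := memLp_tensor m1 q1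
      memLp_yy := memLp_tensor m0 q2
      deriv_x := hasWeakDeriv_tensor_fst m0 m1 q0 d0
      deriv_y := hasWeakDeriv_tensor_snd m0 q0 q1 fun y => hasDerivAt_polyGauss q y
      deriv_xx := hasWeakDeriv_tensor_fst m1 m2 q0 d1
      deriv_xy := hasWeakDeriv_tensor_snd m1 q0 q1 fun y => hasDerivAt_polyGauss q y
      deriv_yy := hasWeakDeriv_tensor_snd m0 q1 q2 fun y => hasDerivAt_polyGauss _ y }

lemma polyGauss_gaussDeriv_gaussDeriv_hermitePoly (n : ℕ) (y : ℝ) :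
    polyGauss (gaussDeriv (gaussDeriv (hermitePoly n))) y =
      ((y : ℂ) ^ 2 - (2 * n + 1)) * polyGauss (hermitePoly n) y := by
  rw [gaussDeriv_gaussDeriv_hermitePoly]
  simp [polyGauss, mul_assoc]

/-- The oscillator contributes `n + 1/2` and `-∂ₓ²` contributes `-s²`. The derivative of `exp(-sσx)`
at the line is `-sσ`, that is `-s` on the right and `s` on the left. -/
lemma isUnmatchedPair_expMode {σ : ℝ} (hσ : σ = 1 ∨ σ = -1) {s : ℂ} (hs : 0 < s.re) (n : ℕ) :
    IsUnmatchedPair (expMode hσ hs n) (((n : ℂ) + 1 / 2 - s ^ 2) • expMode hσ hs n)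
      ((if σ = 1 then 1 else 0 : ℂ) • polyGauss (hermitePoly n))
      ((if σ = 1 then 0 else 1 : ℂ) • polyGauss (hermitePoly n))
      ((if σ = 1 then -s else 0 : ℂ) • polyGauss (hermitePoly n))
      ((if σ = 1 then 0 else s : ℂ) • polyGauss (hermitePoly n)) := by
  have hc := coeFn_expMode hσ hs n
  have hq := memLp_polyGauss (hermitePoly n)
  have m0 := memLp_halfExp (abs_eq_one_of_sign hσ) hs
  have hne : (-1 : ℝ) ≠ 1 := by norm_num
  have t1 := tendsto_halfExp_same hσ s
  have t2 := tendsto_halfExp_neg hσ s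
  have t3 := t1.const_mul (-(s * σ))
  have t4 := t2.const_mul (-(s * σ))
  have hσσ : (σ : ℂ) ^ 2 = 1 := by rcases hσ with rfl | rfl <;> norm_num
  refine ⟨_, _, _, _, _, (isH2_tensor hσ hs (hermitePoly n)).congr hc.symm, ?_, ?_, ?_, ?_, ?_, ?_⟩
  · refine (memLp_tensor m0 (memLp_polyGauss (Polynomial.X ^ 2 * hermitePoly n))).ae_eq ?_
    filter_upwards [hc] with p hp
    rw [hp, tensor, tensor, polyGauss_X_pow_mul]
    ring
  · refine IsStripTrace.congr (isSideTrace_tensor (Or.inl rfl) hq ?_) hc.symm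
    rcases hσ with rfl | rfl
    · simpa using t1
    · simpa [hne] using t2
  · refine IsStripTrace.congr (isSideTrace_tensor (Or.inr rfl) hq ?_) hc.symm
    rcases hσ with rfl | rfl
    · simpa using t2
    · simpa [hne] using t1
  · refine isSideTrace_tensor (Or.inl rfl) hq ?_
    rcases hσ with rfl | rfl
    · simpa using t3
    · simpa [hne] using t4
  · refine isSideTrace_tensor (Or.inr rfl) hq ?_
    rcases hσ with rfl | rfl
    · simpa using t4
    · simpa [hne] using t3
  · filter_upwards [hc, Lp.coeFn_smul ((n : ℂ) + 1 / 2 - s ^ 2) (expMode hσ hs n)] with p hp h2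
    rw [h2, Pi.smul_apply, hp]
    simp only [tensor, Pi.smul_apply, smul_eq_mul, polyGauss_gaussDeriv_gaussDeriv_hermitePoly]
    linear_combination (s ^ 2 * halfExp σ s p.1 * polyGauss (hermitePoly n) p.2) * hσσ

/-! ### Integration by parts up to the line and Green's formula. -/

/-- Weak derivatives are defined by real test functions; complex ones are handled through their real
and imaginary parts. -/
lemma HasWeakDeriv.integral_mul_of_hasCompactSupport {v : ℝ × ℝ} {f g : ℝ × ℝ → ℂ}
    (h : HasWeakDeriv v f g) (hf : MemLp f 2) (hg : MemLp g 2) {φ : ℝ × ℝ → ℂ}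
    (h1 : ContDiff ℝ ((⊤ : ℕ∞) : WithTop ℕ∞) φ) (h2 : HasCompactSupport φ)
    (h3 : tsupport φ ⊆ offLine) :
    ∫ p, fderiv ℝ φ p v * f p = -∫ p, φ p * g p := by
  have main : ∀ L : ℂ →L[ℝ] ℝ, (∫ p, (L (fderiv ℝ φ p v)) • f p = -∫ p, L (φ p) • g p) ∧
      Integrable (fun p => (L (fderiv ℝ φ p v)) • f p) ∧
      Integrable (fun p => L (φ p) • g p) := by
    intro L
    have c1 : ContDiff ℝ ((⊤ : ℕ∞) : WithTop ℕ∞) (fun p => L (φ p)) := L.contDiff.comp h1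
    have c2 : HasCompactSupport (fun p => L (φ p)) := h2.comp_left (g := L) (map_zero L)
    have c3 : tsupport (fun p => L (φ p)) ⊆ offLine :=
      (closure_mono (Function.support_comp_subset (map_zero L) φ)).trans h3
    have e : ∀ p, fderiv ℝ (fun p => L (φ p)) p v = L (fderiv ℝ φ p v) := by
      intro p
      have h4 := L.hasFDerivAt.comp p ((h1.differentiable (by simp)).differentiableAt (x := p)).hasFDerivAt
      have h5 : fderiv ℝ (fun p => L (φ p)) p = L.comp (fderiv ℝ φ p) := h4.fderiv
      rw [h5]
      rfl
    have h4 := h _ c1 c2 c3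
    have h5 := integrable_fderiv_smul c1 c2 v hf
    have h6 := integrable_test_smul c1.continuous c2 hg
    simp_rw [e] at h4 h5
    exact ⟨h4, h5, h6⟩
  obtain ⟨r1, r2, r3⟩ := main Complex.reCLM
  obtain ⟨i1, i2, i3⟩ := main Complex.imCLM
  have e : ∀ z w : ℂ, z * w = (Complex.reCLM z) • w + Complex.I * ((Complex.imCLM z) • w) := by
    intro z w
    conv_lhs => rw [← Complex.re_add_im z]
    simp only [Complex.reCLM_apply, Complex.imCLM_apply, Complex.real_smul]
    ring
  have e1 : (fun p => fderiv ℝ φ p v * f p) = fun p => (Complex.reCLM (fderiv ℝ φ p v)) • f p +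
      Complex.I * ((Complex.imCLM (fderiv ℝ φ p v)) • f p) := funext fun p => e _ _
  have e2 : (fun p => φ p * g p) = fun p => (Complex.reCLM (φ p)) • g p +
      Complex.I * ((Complex.imCLM (φ p)) • g p) := funext fun p => e _ _
  rw [e1, e2, integral_add r2 (i2.const_mul _), integral_add r3 (i3.const_mul _), integral_const_mul,
    integral_const_mul, r1, i1]
  ring

/-- Weak derivatives can be tested with square integrable smooth functions that vanish near the
line `x = 0`. -/
theorem HasWeakDeriv.integral_mul {v : ℝ × ℝ} {f g : ℝ × ℝ → ℂ}
    (h : HasWeakDeriv v f g) (hf : MemLp f 2) (hg : MemLp g 2) {φ : ℝ × ℝ → ℂ}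
    (h1 : ContDiff ℝ ((⊤ : ℕ∞) : WithTop ℕ∞) φ) (h3 : tsupport φ ⊆ offLine)
    (hφ : MemLp φ 2) (hφ' : MemLp (fun p => fderiv ℝ φ p v) 2) :
    ∫ p, fderiv ℝ φ p v * f p = -∫ p, φ p * g p := by
  -- Cutoff at infinity: the rescaled bumps `κ(p / (k + 1))` tend to `1` and their derivatives are
  -- of order `1 / (k + 1)`.
  let κ : ContDiffBump (0 : ℝ × ℝ) := ⟨1, 2, one_pos, one_lt_two⟩
  have κs : ContDiff ℝ ((⊤ : ℕ∞) : WithTop ℕ∞) κ := κ.contDiff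
  have κd : Continuous (fderiv ℝ κ) := κs.continuous_fderiv (by simp)
  obtain ⟨C, hC⟩ := κd.bounded_above_of_compact_support (κ.hasCompactSupport.fderiv (𝕜 := ℝ))
  have hC0 : 0 ≤ C := (norm_nonneg _).trans (hC 0)
  let r : ℕ → ℝ := fun k => 1 / ((k : ℝ) + 1)
  have hr0 : ∀ k, 0 < r k := fun k => by positivity
  have hr1 : ∀ k, r k ≤ 1 := fun k => by
    rw [div_le_one (by positivity)]
    linarith [(Nat.cast_nonneg k : (0 : ℝ) ≤ k)]
  have hrl : Tendsto r atTop (𝓝 0) := tendsto_one_div_add_atTop_nhds_zero_nat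
  let χ : ℕ → ℝ × ℝ → ℝ := fun k p => κ (r k • p)
  have χs : ∀ k, ContDiff ℝ ((⊤ : ℕ∞) : WithTop ℕ∞) (χ k) := fun k =>
    κs.comp (contDiff_const_smul (r k))
  have χc : ∀ k, HasCompactSupport (χ k) := fun k =>
    κ.hasCompactSupport.comp_smul (hr0 k).ne'
  have χd : ∀ k p, fderiv ℝ (χ k) p v = r k * fderiv ℝ κ (r k • p) v := by
    intro k p
    have e1 : HasFDerivAt (fun p : ℝ × ℝ => r k • p) (r k • ContinuousLinearMap.id ℝ (ℝ × ℝ)) p :=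
      (hasFDerivAt_id p).const_smul (r k)
    have e2 := ((κs.differentiable (by simp)).differentiableAt (x := r k • p)).hasFDerivAt.comp p e1
    have e3 : fderiv ℝ (χ k) p = _ := e2.fderiv
    rw [e3]
    simp
  have χ1 : ∀ k p, |χ k p| ≤ 1 := fun k p => by
    rw [abs_of_nonneg κ.nonneg]
    exact κ.le_one
  have χl : ∀ p, Tendsto (fun k => χ k p) atTop (𝓝 1) := by
    intro p
    have e1 : Tendsto (fun k => r k • p) atTop (𝓝 ((0 : ℝ) • p)) := hrl.smul_const p
    rw [zero_smul] at e1
    have e2 := (κs.continuous.tendsto 0).comp e1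
    rwa [κ.one_of_mem_closedBall (by simp [κ])] at e2
  have hi1 : Integrable fun p => fderiv ℝ φ p v * f p := hφ'.integrable_mul hf
  have hi2 : Integrable fun p => φ p * f p := hφ.integrable_mul hf
  have hi3 : Integrable fun p => φ p * g p := hφ.integrable_mul hg
  -- The product rule leaves an error with the factor `r k`, which tends to zero by domination since
  -- `φ f` is integrable.
  have key : ∀ k, ∫ p, ((r k * fderiv ℝ κ (r k • p) v : ℝ) * (φ p * f p) +
      (χ k p : ℂ) * (fderiv ℝ φ p v * f p)) = -∫ p, (χ k p : ℂ) * (φ p * g p) := by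
    intro k
    have e1 := h.integral_mul_of_hasCompactSupport hf hg (φ := fun p => χ k p • φ p)
      ((χs k).smul h1) (χc k).smul_right
      ((closure_mono (Function.support_smul_subset_right (χ k) φ)).trans h3)
    have e2 : ∀ p, fderiv ℝ (fun p => χ k p • φ p) p v =
        ((r k * fderiv ℝ κ (r k • p) v : ℝ) : ℂ) * φ p + (χ k p : ℂ) * fderiv ℝ φ p v := by
      intro p
      have := fderiv_fun_smul (((χs k).differentiable (by simp)).differentiableAt (x := p))
        ((h1.differentiable (by simp)).differentiableAt (x := p))
      rw [this]
      simp only [add_apply, smul_apply,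
        ContinuousLinearMap.smulRight_apply, χd, Complex.real_smul]
      ring
    simp_rw [e2, Complex.real_smul] at e1
    calc _ = _ := integral_congr_ae (ae_of_all _ fun p => by ring)
      _ = _ := e1
      _ = _ := by
        congr 1
        exact integral_congr_ae (ae_of_all _ fun p => by ring)
  have lim1 : Tendsto (fun k => ∫ p, ((r k * fderiv ℝ κ (r k • p) v : ℝ) * (φ p * f p) +
      (χ k p : ℂ) * (fderiv ℝ φ p v * f p))) atTop (𝓝 (∫ p, fderiv ℝ φ p v * f p)) := by
    refine tendsto_integral_of_dominated_convergence
      (fun p => C * ‖v‖ * ‖φ p * f p‖ + ‖fderiv ℝ φ p v * f p‖) (fun k => ?_)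
      ((hi2.norm.const_mul _).add hi1.norm) (fun k => ae_of_all _ fun p => ?_)
      (ae_of_all _ fun p => ?_)
    · refine ((Continuous.aestronglyMeasurable ?_).mul hi2.aestronglyMeasurable).add
        ((Continuous.aestronglyMeasurable ?_).mul hi1.aestronglyMeasurable)
      · exact Complex.continuous_ofReal.comp (continuous_const.mul
          ((κd.comp (continuous_const_smul (r k))).clm_apply continuous_const))
      · exact Complex.continuous_ofReal.comp (χs k).continuous
    · refine (norm_add_le _ _).trans (add_le_add ?_ ?_)
      · rw [norm_mul, Complex.norm_real, norm_mul, Real.norm_of_nonneg (hr0 k).le]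
        refine mul_le_mul_of_nonneg_right ?_ (norm_nonneg _)
        have e1 := (fderiv ℝ κ (r k • p)).le_of_opNorm_le (hC (r k • p)) v
        calc r k * ‖fderiv ℝ κ (r k • p) v‖ ≤ 1 * (C * ‖v‖) :=
              mul_le_mul (hr1 k) e1 (norm_nonneg _) zero_le_one
          _ = _ := one_mul _
      · rw [norm_mul, Complex.norm_real, Real.norm_eq_abs]
        exact mul_le_of_le_one_left (norm_nonneg _) (χ1 k p)
    · have e1 : Tendsto (fun k => r k * fderiv ℝ κ (r k • p) v) atTop (𝓝 0) := by
        refine squeeze_zero_norm (a := fun k => r k * (C * ‖v‖)) (fun k => ?_) ?_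
        · rw [norm_mul, Real.norm_of_nonneg (hr0 k).le]
          exact mul_le_mul_of_nonneg_left
            ((fderiv ℝ κ (r k • p)).le_of_opNorm_le (hC (r k • p)) v) (hr0 k).le
        · simpa using hrl.mul_const (C * ‖v‖)
      have e2 := ((Complex.continuous_ofReal.tendsto 0).comp e1).mul_const (φ p * f p)
      have e3 := ((Complex.continuous_ofReal.tendsto 1).comp (χl p)).mul_const
        (fderiv ℝ φ p v * f p)
      simpa using! e2.add e3
  have lim2 : Tendsto (fun k => -∫ p, (χ k p : ℂ) * (φ p * g p)) atTop
      (𝓝 (-∫ p, φ p * g p)) := by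
    refine Tendsto.neg (tendsto_integral_of_dominated_convergence
      (fun p => ‖φ p * g p‖) (fun k => ?_) hi3.norm (fun k => ae_of_all _ fun p => ?_)
      (ae_of_all _ fun p => ?_))
    · exact (Continuous.aestronglyMeasurable
        (Complex.continuous_ofReal.comp (χs k).continuous)).mul hi3.aestronglyMeasurable
    · rw [norm_mul, Complex.norm_real, Real.norm_eq_abs]
      exact mul_le_of_le_one_left (norm_nonneg _) (χ1 k p)
    · simpa using! ((Complex.continuous_ofReal.tendsto 1).comp (χl p)).mul_const (φ p * g p)
  simp_rw [key] at lim1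
  exact tendsto_nhds_unique lim1 lim2

/-- The exponential `exp(-sσx)`, smoothly cut off at distance of order `ε` from the origin. -/
def cutoffExp (σ : ℝ) (s : ℂ) (ε x : ℝ) : ℂ :=
  (Real.smoothTransition (3 * (σ * x) / ε - 1) : ℂ) * Complex.exp (-(s * (σ * x : ℝ)))

/-- The part of the derivative of `cutoffExp` in which the cutoff is differentiated. -/
def cutoffLayer (σ : ℝ) (s : ℂ) (ε x : ℝ) : ℂ :=
  ((3 * σ / ε * deriv Real.smoothTransition (3 * (σ * x) / ε - 1) : ℝ) : ℂ) *
    Complex.exp (-(s * (σ * x : ℝ)))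

lemma contDiff_cutoffExp (σ : ℝ) (s : ℂ) (ε : ℝ) :
    ContDiff ℝ ((⊤ : ℕ∞) : WithTop ℕ∞) (cutoffExp σ s ε) := by
  have h1 : ContDiff ℝ ((⊤ : ℕ∞) : WithTop ℕ∞)
      (fun x : ℝ => Real.smoothTransition (3 * (σ * x) / ε - 1)) :=
    Real.smoothTransition.contDiff.comp (by fun_prop)
  have h2 : ContDiff ℝ ((⊤ : ℕ∞) : WithTop ℕ∞) (fun x : ℝ => ((σ * x : ℝ) : ℂ)) :=
    Complex.ofRealCLM.contDiff.comp (contDiff_const.mul contDiff_id)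
  have h3 : ContDiff ℝ ((⊤ : ℕ∞) : WithTop ℕ∞)
      (fun x : ℝ => Complex.exp (-(s * (σ * x : ℝ)))) := (contDiff_const.mul h2).neg.cexp
  exact (Complex.ofRealCLM.contDiff.comp h1).mul h3

lemma differentiable_smoothTransition : Differentiable ℝ Real.smoothTransition :=
  (Real.smoothTransition.contDiff (n := 1)).differentiable (by simp)

lemma continuous_deriv_smoothTransition : Continuous (deriv Real.smoothTransition) :=
  (Real.smoothTransition.contDiff (n := 1)).continuous_deriv (by simp)

lemma deriv_smoothTransition_eq_zero {x : ℝ} (hx : x < 0 ∨ 1 < x) :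
    deriv Real.smoothTransition x = 0 := by
  rcases hx with hx | hx
  · have : Real.smoothTransition =ᶠ[𝓝 x] fun _ => 0 := by
      filter_upwards [Iio_mem_nhds hx] with z hz
      exact Real.smoothTransition.zero_of_nonpos (le_of_lt hz)
    rw [this.deriv_eq, deriv_const]
  · have : Real.smoothTransition =ᶠ[𝓝 x] fun _ => 1 := by
      filter_upwards [Ioi_mem_nhds hx] with z hz
      exact Real.smoothTransition.one_of_one_le (le_of_lt hz)
    rw [this.deriv_eq, deriv_const]

lemma exists_bound_deriv_smoothTransition :
    ∃ C : ℝ, 0 ≤ C ∧ ∀ x, ‖deriv Real.smoothTransition x‖ ≤ C := by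
  obtain ⟨C, hC⟩ := isCompact_Icc.exists_bound_of_continuousOn (s := Set.Icc (0 : ℝ) 1)
    continuous_deriv_smoothTransition.continuousOn
  have hC0 : 0 ≤ C := (norm_nonneg _).trans (hC 0 (by simp))
  refine ⟨C, hC0, fun x => ?_⟩
  by_cases hx : x ∈ Set.Icc (0 : ℝ) 1
  · exact hC x hx
  · rw [deriv_smoothTransition_eq_zero, norm_zero]
    · exact hC0
    · simpa only [Set.mem_Icc, not_and_or, not_le] using hx

lemma hasDerivAt_cutoffExp (σ : ℝ) (s : ℂ) (ε x : ℝ) :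
    HasDerivAt (cutoffExp σ s ε) (cutoffLayer σ s ε x - s * σ * cutoffExp σ s ε x) x := by
  have e0 : HasDerivAt (fun x : ℝ => 3 * (σ * x) / ε - 1) (3 * σ / ε) x := by
    simpa using ((((hasDerivAt_id x).const_mul σ).const_mul 3).div_const ε).sub_const 1
  have e1 := ((differentiable_smoothTransition _).hasDerivAt.comp x e0).ofReal_comp
  have e2 : HasDerivAt (fun z : ℝ => ((σ * z : ℝ) : ℂ)) (σ : ℂ) x := by
    simpa using ((hasDerivAt_id x).const_mul σ).ofReal_comp
  refine (e1.mul (e2.const_mul s).neg.cexp).congr_deriv ?_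
  simp only [cutoffLayer, cutoffExp, Function.comp_apply, Pi.neg_apply]
  push_cast
  ring

lemma continuous_cutoffExp (σ : ℝ) (s : ℂ) (ε : ℝ) : Continuous (cutoffExp σ s ε) :=
  (contDiff_cutoffExp σ s ε).continuous

lemma continuous_cutoffLayer (σ : ℝ) (s : ℂ) (ε : ℝ) : Continuous (cutoffLayer σ s ε) := by
  have := continuous_deriv_smoothTransition
  unfold cutoffLayer
  fun_prop

/-- The argument `3σx/ε - 1` runs through `[0, 1]` for `σx` between `ε/3` and `2ε/3`. The cutoff
exponential therefore vanishes near the line, and its layer lies inside the strip `0 < σx < ε` that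
defines the trace. -/
lemma cutoffExp_eq_zero {σ : ℝ} {s : ℂ} {ε x : ℝ} (hε : 0 < ε) (hx : σ * x ≤ ε / 3) :
    cutoffExp σ s ε x = 0 := by
  rw [cutoffExp, Real.smoothTransition.zero_of_nonpos, Complex.ofReal_zero, zero_mul]
  rw [sub_nonpos, div_le_one hε]
  linarith

lemma norm_cutoffExp_le {σ : ℝ} {s : ℂ} {ε : ℝ} (hε : 0 < ε) (x : ℝ) :
    ‖cutoffExp σ s ε x‖ ≤ ‖halfExp σ s x‖ := by
  by_cases hx : 0 < σ * x
  · rw [cutoffExp, halfExp, if_pos hx, norm_mul, Complex.norm_real,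
      Real.norm_of_nonneg (Real.smoothTransition.nonneg _)]
    exact mul_le_of_le_one_left (norm_nonneg _) (Real.smoothTransition.le_one _)
  · rw [cutoffExp_eq_zero hε (by linarith), norm_zero]
    positivity

lemma tendsto_cutoffExp (σ : ℝ) (s : ℂ) (x : ℝ) :
    Tendsto (fun ε => cutoffExp σ s ε x) (𝓝[>] 0) (𝓝 (halfExp σ s x)) := by
  refine tendsto_const_nhds.congr' ?_
  by_cases hx : 0 < σ * x
  · filter_upwards [self_mem_nhdsWithin, nhdsWithin_le_nhds (Iio_mem_nhds hx)] with ε hε hεx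
    rw [halfExp, if_pos hx, cutoffExp, Real.smoothTransition.one_of_one_le, Complex.ofReal_one,
      one_mul]
    simp only [Set.mem_Ioi, Set.mem_Iio] at hε hεx
    rw [le_sub_iff_add_le, le_div_iff₀ hε]
    linarith
  · filter_upwards [self_mem_nhdsWithin] with ε hε
    simp only [Set.mem_Ioi] at hε
    rw [halfExp, if_neg hx, cutoffExp_eq_zero hε (by linarith)]

lemma cutoffLayer_eq_zero {σ : ℝ} {s : ℂ} {ε x : ℝ} (hε : 0 < ε)
    (hx : ¬ (0 < σ * x ∧ σ * x < ε)) : cutoffLayer σ s ε x = 0 := by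
  rw [cutoffLayer, deriv_smoothTransition_eq_zero, mul_zero, Complex.ofReal_zero, zero_mul]
  rw [not_and_or, not_lt, not_lt] at hx
  rcases hx with hx | hx
  · left
    have : 3 * (σ * x) / ε ≤ 0 := div_nonpos_of_nonpos_of_nonneg (by linarith) hε.le
    linarith
  · right
    have : 3 ≤ 3 * (σ * x) / ε := by rw [le_div_iff₀ hε]; linarith
    linarith

/-- Differentiating the cutoff costs `3/ε`; the exponential is at most `1`, because the layer lies
on the side `σx > 0`. -/
lemma norm_cutoffLayer_le {σ : ℝ} (hσ : |σ| = 1) {s : ℂ} (hs : 0 < s.re) {C : ℝ}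
    (hC : ∀ x, ‖deriv Real.smoothTransition x‖ ≤ C) {ε : ℝ} (hε : 0 < ε) (x : ℝ) :
    ‖cutoffLayer σ s ε x‖ ≤ 3 * C * ε⁻¹ := by
  have hC0 : 0 ≤ C := (norm_nonneg _).trans (hC 0)
  by_cases hx : 0 < σ * x ∧ σ * x < ε
  · rw [cutoffLayer, norm_mul, Complex.norm_real, norm_mul, norm_div, norm_mul,
      Real.norm_eq_abs σ, hσ, Complex.norm_exp, Real.norm_of_nonneg hε.le]
    have h1 : Real.exp (-(s * (σ * x : ℝ))).re ≤ 1 := by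
      rw [Real.exp_le_one_iff, Complex.neg_re, Complex.re_mul_ofReal]
      have := mul_pos hs hx.1
      linarith
    have h2 := hC (3 * (σ * x) / ε - 1)
    calc _ ≤ (‖(3 : ℝ)‖ * 1 / ε * C) * 1 := by gcongr
      _ = _ := by rw [Real.norm_of_nonneg (by norm_num)]; ring
  · rw [cutoffLayer_eq_zero hε hx, norm_zero]
    positivity

lemma memLp_cutoffExp {σ : ℝ} (hσ : |σ| = 1) {s : ℂ} (hs : 0 < s.re) {ε : ℝ} (hε : 0 < ε) :
    MemLp (cutoffExp σ s ε) 2 :=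
  (memLp_halfExp hσ hs).mono (continuous_cutoffExp σ s ε).aestronglyMeasurable
    (ae_of_all _ (norm_cutoffExp_le hε))

lemma hasCompactSupport_cutoffLayer {σ : ℝ} (hσ : |σ| = 1) (s : ℂ) {ε : ℝ} (hε : 0 < ε) :
    HasCompactSupport (cutoffLayer σ s ε) := by
  refine HasCompactSupport.of_support_subset_isCompact (isCompact_closedBall (0 : ℝ) ε) ?_
  intro x hx
  by_contra h
  refine hx (cutoffLayer_eq_zero hε fun h1 => h ?_)
  rw [mem_closedBall_zero_iff, Real.norm_eq_abs, ← one_mul |x|, ← hσ, ← abs_mul, abs_of_pos h1.1]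
  exact h1.2.le

lemma memLp_cutoffLayer {σ : ℝ} (hσ : |σ| = 1) (s : ℂ) {ε : ℝ} (hε : 0 < ε) :
    MemLp (cutoffLayer σ s ε) 2 :=
  (continuous_cutoffLayer σ s ε).memLp_of_hasCompactSupport (hasCompactSupport_cutoffLayer hσ s hε)

lemma tsupport_tensor_cutoffExp (σ : ℝ) (s : ℂ) {ε : ℝ} (hε : 0 < ε) (b : ℝ → ℂ) :
    tsupport (tensor (cutoffExp σ s ε) b) ⊆ offLine := by
  have hc : IsClosed {p : ℝ × ℝ | ε / 3 ≤ σ * p.1} := isClosed_le (by fun_prop) (by fun_prop)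
  refine (closure_minimal (fun p hp => ?_) hc).trans fun p hp h0 => ?_
  · by_contra h
    refine hp ?_
    simp only [Set.mem_ofPred_eq, not_le] at h
    rw [tensor, cutoffExp_eq_zero hε h.le, zero_mul]
  · simp only [Set.mem_ofPred_eq] at hp h0
    rw [h0, mul_zero] at hp
    linarith

lemma contDiff_tensor {a b : ℝ → ℂ} {m : WithTop ℕ∞} (ha : ContDiff ℝ m a) (hb : ContDiff ℝ m b) :
    ContDiff ℝ m (tensor a b) :=
  (ha.comp contDiff_fst).mul (hb.comp contDiff_snd)

lemma fderiv_tensor {a b : ℝ → ℂ} {a' b' : ℂ} {p : ℝ × ℝ} (ha : HasDerivAt a a' p.1)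
    (hb : HasDerivAt b b' p.2) (v : ℝ × ℝ) :
    fderiv ℝ (tensor a b) p v = v.1 * (a' * b p.2) + v.2 * (a p.1 * b') := by
  have h1 := ha.hasFDerivAt.comp p (hasFDerivAt_fst (p := p))
  have h2 := hb.hasFDerivAt.comp p (hasFDerivAt_snd (p := p))
  have h3 : fderiv ℝ (tensor a b) p = _ := (h1.mul h2).fderiv
  rw [h3]
  simp
  ring

lemma tendsto_integral_cutoffExp {σ : ℝ} (hσ : |σ| = 1) {s : ℂ} (hs : 0 < s.re) {b : ℝ → ℂ}
    (hb : MemLp b 2) {f : ℝ × ℝ → ℂ} (hf : MemLp f 2) :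
    Tendsto (fun ε => ∫ p, tensor (cutoffExp σ s ε) b p * f p) (𝓝[>] 0)
      (𝓝 (∫ p, tensor (halfExp σ s) b p * f p)) := by
  refine tendsto_integral_filter_of_dominated_convergence
    (fun p => ‖tensor (halfExp σ s) b p * f p‖) (Eventually.of_forall fun ε => ?_) ?_
    (((memLp_tensor (memLp_halfExp hσ hs) hb).integrable_mul hf).norm) (ae_of_all _ fun p => ?_)
  · exact (aestronglyMeasurable_tensor (continuous_cutoffExp σ s ε).aestronglyMeasurable
      hb.aestronglyMeasurable).mul hf.aestronglyMeasurable
  · filter_upwards [self_mem_nhdsWithin] with ε hε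
    refine ae_of_all _ fun p => ?_
    simp only [tensor, norm_mul]
    gcongr
    exact norm_cutoffExp_le hε _
  · exact ((tendsto_cutoffExp σ s p.1).mul_const _).mul_const _

/-- Integration by parts in `y` against an exponential on a half-line times a function of `y`. -/
theorem HasWeakDeriv.integral_tensor_snd {f g : ℝ × ℝ → ℂ} (h : HasWeakDeriv (0, 1) f g)
    (hf : MemLp f 2) (hg : MemLp g 2) {σ : ℝ} (hσ : |σ| = 1) {s : ℂ} (hs : 0 < s.re)
    (q : Polynomial ℝ) :
    ∫ p, tensor (halfExp σ s) (polyGauss (gaussDeriv q)) p * f p =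
      -∫ p, tensor (halfExp σ s) (polyGauss q) p * g p := by
  refine tendsto_nhds_unique (tendsto_integral_cutoffExp hσ hs (memLp_polyGauss (gaussDeriv q)) hf)
    ((tendsto_integral_cutoffExp hσ hs (memLp_polyGauss q) hg).neg.congr' ?_)
  filter_upwards [self_mem_nhdsWithin] with ε hε
  have e : ∀ p, fderiv ℝ (tensor (cutoffExp σ s ε) (polyGauss q)) p (0, 1) =
      tensor (cutoffExp σ s ε) (polyGauss (gaussDeriv q)) p := by
    intro p
    rw [fderiv_tensor (hasDerivAt_cutoffExp σ s ε p.1) (hasDerivAt_polyGauss q p.2)]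
    simp [tensor]
  have := h.integral_mul hf hg (contDiff_tensor (contDiff_cutoffExp σ s ε) (contDiff_polyGauss q))
    (tsupport_tensor_cutoffExp σ s hε _)
    (memLp_tensor (memLp_cutoffExp hσ hs hε) (memLp_polyGauss q)) (by
      simp_rw [e]
      exact memLp_tensor (memLp_cutoffExp hσ hs hε) (memLp_polyGauss _))
  simp_rw [e] at this
  exact this.symm

lemma integral_halfExp {σ : ℝ} (hσ : σ = 1 ∨ σ = -1) {s : ℂ} (hs : 0 < s.re) :
    ∫ x, halfExp σ s x = 1 / s := by
  have h1 : ∫ x, halfExp 1 s x = 1 / s := by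
    have e : halfExp 1 s = (Set.Ioi (0 : ℝ)).indicator fun x : ℝ => Complex.exp (-s * x) := by
      ext x
      simp [halfExp, Set.indicator_apply]
    rw [e, integral_indicator measurableSet_Ioi, integral_exp_mul_complex_Ioi (by simpa using hs)]
    simp
  rcases hσ with rfl | rfl
  · exact h1
  · rw [← h1, ← integral_neg_eq_self]
    congr 1
    ext x
    simp [halfExp]

lemma integrable_halfExp {σ : ℝ} (hσ : |σ| = 1) {s : ℂ} (hs : 0 < s.re) :
    Integrable (halfExp σ s) :=
  (integrable_exp_neg_mul_abs hs).mono' (measurable_halfExp σ s).aestronglyMeasurable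
    (ae_of_all _ (norm_halfExp_le hσ s))

/-- The layer acts as `σ` times a delta function at the line. The derivative of `cutoffExp`
integrates to zero, so the mass of the layer is `sσ ∫ cutoffExp`, which tends to `sσ · (1/s) = σ`.
-/
lemma tendsto_integral_cutoffLayer {σ : ℝ} (hσ : σ = 1 ∨ σ = -1) {s : ℂ} (hs : 0 < s.re) :
    Tendsto (fun ε => ∫ x, cutoffLayer σ s ε x) (𝓝[>] 0) (𝓝 (σ : ℂ)) := by
  have hσ' := abs_eq_one_of_sign hσ
  have hi := integrable_halfExp hσ' hs
  have h1 : Tendsto (fun ε => ∫ x, cutoffExp σ s ε x) (𝓝[>] 0) (𝓝 (∫ x, halfExp σ s x)) := by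
    refine tendsto_integral_filter_of_dominated_convergence (fun x => ‖halfExp σ s x‖)
      (Eventually.of_forall fun ε => (continuous_cutoffExp σ s ε).aestronglyMeasurable) ?_
      hi.norm (ae_of_all _ fun x => tendsto_cutoffExp σ s x)
    filter_upwards [self_mem_nhdsWithin] with ε hε using ae_of_all _ (norm_cutoffExp_le hε)
  rw [integral_halfExp hσ hs] at h1
  have h2 := h1.const_mul (s * σ)
  have hs0 : s ≠ 0 := fun h => by simp [h] at hs
  rw [show s * σ * (1 / s) = σ by field_simp] at h2
  refine h2.congr' ?_
  filter_upwards [self_mem_nhdsWithin] with ε hε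
  have i1 : Integrable (cutoffExp σ s ε) :=
    hi.mono (continuous_cutoffExp σ s ε).aestronglyMeasurable
      (ae_of_all _ (norm_cutoffExp_le hε))
  have i2 : Integrable (cutoffLayer σ s ε) :=
    (continuous_cutoffLayer σ s ε).integrable_of_hasCompactSupport
      (hasCompactSupport_cutoffLayer hσ' s hε)
  have h3 := integral_eq_zero_of_hasDerivAt_of_integrable (hasDerivAt_cutoffExp σ s ε)
    (i2.sub (i1.const_mul _)) i1
  rw [integral_sub i2 (i1.const_mul _), integral_const_mul, sub_eq_zero] at h3
  exact h3.symm

lemma aestronglyMeasurable_snd {u : ℝ → ℂ} (hu : AEStronglyMeasurable u) :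
    AEStronglyMeasurable (fun p : ℝ × ℝ => u p.2) := by
  rw [Measure.volume_eq_prod]
  exact hu.comp_quasiMeasurePreserving Measure.quasiMeasurePreserving_snd

/-- Replacing `f` by its trace inside the layer costs nothing in the limit: the layer is of size
`1/ε` on a strip of width `ε`, and Cauchy–Schwarz on the strip leaves the square root of the average
in the definition of the trace. -/
lemma tendsto_lintegral_cutoffLayer_sub_trace {σ : ℝ} (hσ : σ = 1 ∨ σ = -1) {s : ℂ}
    (hs : 0 < s.re) {b u : ℝ → ℂ} (hb : MemLp b 2) {f : ℝ × ℝ → ℂ} (hf : MemLp f 2)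
    (hu : IsSideTrace σ f u) :
    Tendsto (fun ε => ∫⁻ p, ‖tensor (cutoffLayer σ s ε) b p * (f p - u p.2)‖ₑ) (𝓝[>] 0) (𝓝 0) := by
  have hσ' := abs_eq_one_of_sign hσ
  obtain ⟨C, hC0, hC⟩ := exists_bound_deriv_smoothTransition
  set K := ∫⁻ y, ‖b y‖ₑ ^ 2 with hK
  have hKt : K ≠ ⊤ := (lintegral_enorm_sq_lt_top hb).ne
  have hlim : Tendsto (fun ε : ℝ => ENNReal.ofReal (3 * C) * (K ^ (1 / 2 : ℝ) *
      (ENNReal.ofReal ε⁻¹ * ∫⁻ p in {x : ℝ | 0 < σ * x ∧ σ * x < ε} ×ˢ (Set.univ : Set ℝ),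
        ‖f p - u p.2‖ₑ ^ 2) ^ (1 / 2 : ℝ))) (𝓝[>] 0) (𝓝 0) := by
    have h1 := (ENNReal.continuous_rpow_const (y := (1 / 2 : ℝ))).tendsto (0 : ENNReal)
    rw [ENNReal.zero_rpow_of_pos (by norm_num)] at h1
    have h2 := ENNReal.Tendsto.const_mul (a := K ^ (1 / 2 : ℝ)) (h1.comp hu.2)
      (Or.inr (ENNReal.rpow_ne_top_of_nonneg (by norm_num) hKt))
    have h3 := ENNReal.Tendsto.const_mul (a := ENNReal.ofReal (3 * C)) h2
      (Or.inr ENNReal.ofReal_ne_top)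
    simpa using! h3
  refine tendsto_of_tendsto_of_tendsto_of_le_of_le' tendsto_const_nhds hlim
    (Eventually.of_forall fun _ => zero_le) ?_
  filter_upwards [self_mem_nhdsWithin] with ε hε
  simp only [Set.mem_Ioi] at hε
  set S := {x : ℝ | 0 < σ * x ∧ σ * x < ε} ×ˢ (Set.univ : Set ℝ) with hS
  have hSm : MeasurableSet S := (measurableSet_sideStrip σ ε).prod MeasurableSet.univ
  have hsub : AEMeasurable (fun p : ℝ × ℝ => ‖f p - u p.2‖ₑ) (volume.restrict S) :=
    (hf.aestronglyMeasurable.sub (aestronglyMeasurable_snd hu.1.aestronglyMeasurable)).enorm.restrict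
  have hbm : AEMeasurable (fun p : ℝ × ℝ => ‖b p.2‖ₑ) (volume.restrict S) :=
    (aestronglyMeasurable_snd hb.aestronglyMeasurable).enorm.restrict
  have hA0 : ENNReal.ofReal ε⁻¹ * ENNReal.ofReal ε = 1 := by
    rw [← ENNReal.ofReal_mul (by positivity), inv_mul_cancel₀ hε.ne', ENNReal.ofReal_one]
  calc ∫⁻ p, ‖tensor (cutoffLayer σ s ε) b p * (f p - u p.2)‖ₑ
      = ∫⁻ p in S, ‖tensor (cutoffLayer σ s ε) b p * (f p - u p.2)‖ₑ := by
        refine (setLIntegral_eq_of_support_subset fun p hp => ?_).symm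
        by_contra h
        refine hp ?_
        have : ¬ (0 < σ * p.1 ∧ σ * p.1 < ε) := fun h1 => h ⟨h1, trivial⟩
        simp [tensor, cutoffLayer_eq_zero hε this]
    _ ≤ ∫⁻ p in S, ENNReal.ofReal (3 * C * ε⁻¹) * (‖b p.2‖ₑ * ‖f p - u p.2‖ₑ) := by
        refine lintegral_mono fun p => ?_
        rw [tensor, enorm_mul, enorm_mul, mul_assoc]
        gcongr
        rw [← ofReal_norm]
        exact ENNReal.ofReal_le_ofReal (norm_cutoffLayer_le hσ' hs hC hε _)
    _ = ENNReal.ofReal (3 * C * ε⁻¹) * ∫⁻ p in S, (‖b p.2‖ₑ * ‖f p - u p.2‖ₑ) :=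
        lintegral_const_mul' _ _ ENNReal.ofReal_ne_top
    _ ≤ ENNReal.ofReal (3 * C * ε⁻¹) * ((∫⁻ p in S, ‖b p.2‖ₑ ^ (2 : ℝ)) ^ (1 / 2 : ℝ) *
          (∫⁻ p in S, ‖f p - u p.2‖ₑ ^ (2 : ℝ)) ^ (1 / 2 : ℝ)) := by
        gcongr
        exact ENNReal.lintegral_mul_le_Lp_mul_Lq _ Real.HolderConjugate.two_two hbm hsub
    _ = _ := by
        simp only [ENNReal.rpow_two]
        rw [lintegral_strip_snd hσ ε (g := fun y => ‖b y‖ₑ ^ 2)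
          (hb.aestronglyMeasurable.enorm.pow_const 2), ← hK,
          ENNReal.ofReal_mul (by positivity), mul_assoc]
        congr 1
        -- One half of `1/ε` cancels the width of the strip in the norm of `b`; the other half
        -- normalizes the integral of `|f - u|²`.
        have hhalf : ENNReal.ofReal ε⁻¹ =
            ENNReal.ofReal ε⁻¹ ^ (1 / 2 : ℝ) * ENNReal.ofReal ε⁻¹ ^ (1 / 2 : ℝ) := by
          rw [← ENNReal.rpow_add_of_nonneg _ _ (by norm_num) (by norm_num)]
          norm_num
        rw [ENNReal.mul_rpow_of_nonneg _ _ (by norm_num : (0 : ℝ) ≤ 1 / 2),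
          ENNReal.mul_rpow_of_nonneg _ _ (by norm_num : (0 : ℝ) ≤ 1 / 2)]
        have hone : ENNReal.ofReal ε⁻¹ ^ (1 / 2 : ℝ) * ENNReal.ofReal ε ^ (1 / 2 : ℝ) = 1 := by
          rw [← ENNReal.mul_rpow_of_nonneg _ _ (by norm_num : (0 : ℝ) ≤ 1 / 2), hA0,
            ENNReal.one_rpow]
        set A := ENNReal.ofReal ε⁻¹ ^ (1 / 2 : ℝ)
        set B := ENNReal.ofReal ε ^ (1 / 2 : ℝ)
        rw [hhalf]
        set I := (∫⁻ p in S, ‖f p - u p.2‖ₑ ^ 2) ^ (1 / 2 : ℝ)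
        set k := K ^ (1 / 2 : ℝ)
        calc A * A * (B * k * I) = (A * B) * (k * (A * I)) := by ring
          _ = _ := by rw [hone, one_mul]

/-- Integration by parts in `x` against an exponential on a half-line times a function of `y`; the
boundary term is given by the trace. -/
theorem HasWeakDeriv.integral_tensor_fst {f g : ℝ × ℝ → ℂ} (h : HasWeakDeriv (1, 0) f g)
    (hf : MemLp f 2) (hg : MemLp g 2) {σ : ℝ} (hσ : σ = 1 ∨ σ = -1) {s : ℂ} (hs : 0 < s.re)
    (q : Polynomial ℝ) {u : ℝ → ℂ} (hu : IsSideTrace σ f u) :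
    ∫ p, tensor (halfExp σ s) (polyGauss q) p * g p =
      s * σ * (∫ p, tensor (halfExp σ s) (polyGauss q) p * f p) -
        σ * ∫ y, polyGauss q y * u y := by
  have hσ' := abs_eq_one_of_sign hσ
  have hb := memLp_polyGauss q
  have l1 := tendsto_integral_cutoffExp hσ' hs hb hf
  have l2 := tendsto_integral_cutoffExp hσ' hs hb hg
  have hbu : Integrable fun y => polyGauss q y * u y := hb.integrable_mul hu.1
  -- First evaluation of the limit of the layer integral: `f` is split as `u + (f - u)`, and only
  -- the trace contributes.
  have l3 : Tendsto (fun ε => ∫ p, tensor (cutoffLayer σ s ε) (polyGauss q) p * f p) (𝓝[>] 0)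
      (𝓝 (σ * ∫ y, polyGauss q y * u y)) := by
    have e1 := (tendsto_integral_cutoffLayer hσ hs).mul_const (∫ y, polyGauss q y * u y)
    have e2 : Tendsto (fun ε => ∫ p, tensor (cutoffLayer σ s ε) (polyGauss q) p * (f p - u p.2))
        (𝓝[>] 0) (𝓝 0) := by
      rw [tendsto_zero_iff_enorm_tendsto_zero]
      exact tendsto_of_tendsto_of_tendsto_of_le_of_le tendsto_const_nhds
        (tendsto_lintegral_cutoffLayer_sub_trace hσ hs hb hf hu) (fun _ => zero_le)
        fun ε => enorm_integral_le_lintegral_enorm _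
    have e3 := e2.add e1
    rw [zero_add] at e3
    refine e3.congr' ?_
    filter_upwards [self_mem_nhdsWithin] with ε hε
    have i1 : Integrable fun p => tensor (cutoffLayer σ s ε) (polyGauss q) p * f p :=
      (memLp_tensor (memLp_cutoffLayer hσ' s hε) hb).integrable_mul hf
    have i2 : Integrable (cutoffLayer σ s ε) :=
      (continuous_cutoffLayer σ s ε).integrable_of_hasCompactSupport
        (hasCompactSupport_cutoffLayer hσ' s hε)
    have i3 : Integrable (fun p : ℝ × ℝ => cutoffLayer σ s ε p.1 * (polyGauss q p.2 * u p.2)) := by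
      rw [Measure.volume_eq_prod]
      exact i2.mul_prod hbu
    have e4 : ∫ p : ℝ × ℝ, cutoffLayer σ s ε p.1 * (polyGauss q p.2 * u p.2) =
        (∫ x, cutoffLayer σ s ε x) * ∫ y, polyGauss q y * u y := by
      rw [Measure.volume_eq_prod]
      exact integral_prod_mul (cutoffLayer σ s ε) fun y => polyGauss q y * u y
    rw [← e4, ← integral_add ?_ i3]
    · refine integral_congr_ae (ae_of_all _ fun p => ?_)
      simp only [tensor]
      ring
    · refine (i1.sub i3).congr (ae_of_all _ fun p => ?_)
      simp only [tensor, Pi.sub_apply]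
      ring
  -- Second evaluation, by integrating by parts at fixed `ε > 0`, where the test function vanishes
  -- near the line. Comparing the two limits gives the boundary term.
  have l4 : Tendsto (fun ε => ∫ p, tensor (cutoffLayer σ s ε) (polyGauss q) p * f p) (𝓝[>] 0)
      (𝓝 (s * σ * (∫ p, tensor (halfExp σ s) (polyGauss q) p * f p) -
        ∫ p, tensor (halfExp σ s) (polyGauss q) p * g p)) := by
    refine ((l1.const_mul (s * σ)).sub l2).congr' ?_
    filter_upwards [self_mem_nhdsWithin] with ε hε
    have i1 : Integrable fun p => tensor (cutoffLayer σ s ε) (polyGauss q) p * f p :=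
      (memLp_tensor (memLp_cutoffLayer hσ' s hε) hb).integrable_mul hf
    have i2 : Integrable fun p => tensor (cutoffExp σ s ε) (polyGauss q) p * f p :=
      (memLp_tensor (memLp_cutoffExp hσ' hs hε) hb).integrable_mul hf
    have e : ∀ p, fderiv ℝ (tensor (cutoffExp σ s ε) (polyGauss q)) p (1, 0) =
        tensor (cutoffLayer σ s ε) (polyGauss q) p -
          s * σ * tensor (cutoffExp σ s ε) (polyGauss q) p := by
      intro p
      rw [fderiv_tensor (hasDerivAt_cutoffExp σ s ε p.1) (hasDerivAt_polyGauss q p.2)]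
      simp [tensor]
      ring
    have hφ := memLp_tensor (memLp_cutoffExp hσ' hs hε) hb
    have key := h.integral_mul hf hg
      (contDiff_tensor (contDiff_cutoffExp σ s ε) (contDiff_polyGauss q))
      (tsupport_tensor_cutoffExp σ s hε _) hφ (by
        simp_rw [e]
        exact (memLp_tensor (memLp_cutoffLayer hσ' s hε) hb).sub (hφ.const_mul _))
    simp_rw [e, sub_mul, mul_assoc (s * σ)] at key
    rw [integral_sub i1 (i2.const_mul _), integral_const_mul] at key
    linear_combination -key
  have := tendsto_nhds_unique l3 l4
  linear_combination this

/-- Green's formula against an exponential on a half-line times a Hermite function. -/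
theorem IsUnmatchedPair.integral_expMode {Ψ G : L2Plane} {ur ul dr dl : ℝ → ℂ}
    (h : IsUnmatchedPair Ψ G ur ul dr dl) {σ : ℝ} (hσ : σ = 1 ∨ σ = -1) {s : ℂ} (hs : 0 < s.re)
    (n : ℕ) :
    ∫ p, tensor (halfExp σ s) (polyGauss (hermitePoly n)) p * G p =
      ((n : ℂ) + 1 / 2 - s ^ 2) *
          (∫ p, tensor (halfExp σ s) (polyGauss (hermitePoly n)) p * Ψ p) +
        (σ * ∫ y, polyGauss (hermitePoly n) y * (if σ = 1 then dr else dl) y) +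
        s * ∫ y, polyGauss (hermitePoly n) y * (if σ = 1 then ur else ul) y := by
  obtain ⟨fx, fy, fxx, fxy, fyy, h, hy, t1, t2, t3, t4, e⟩ := h
  have hσ' := abs_eq_one_of_sign hσ
  have hσσ : (σ : ℂ) ^ 2 = 1 := by rcases hσ with rfl | rfl <;> norm_num
  set q := hermitePoly n with hq
  have tu : IsSideTrace σ Ψ (if σ = 1 then ur else ul) := by
    rcases hσ with rfl | rfl
    · simpa using t1
    · simpa [show (-1 : ℝ) ≠ 1 by norm_num] using t2
  have td : IsSideTrace σ fx (if σ = 1 then dr else dl) := by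
    rcases hσ with rfl | rfl
    · simpa using t3
    · simpa [show (-1 : ℝ) ≠ 1 by norm_num] using t4
  have x1 := h.deriv_x.integral_tensor_fst h.memLp h.memLp_x hσ hs q tu
  have x2 := h.deriv_xx.integral_tensor_fst h.memLp_x h.memLp_xx hσ hs q td
  have y1 := h.deriv_y.integral_tensor_snd h.memLp h.memLp_y hσ' hs (gaussDeriv q)
  have y2 := h.deriv_yy.integral_tensor_snd h.memLp_y h.memLp_yy hσ' hs q
  have m0 := memLp_halfExp hσ' hs
  have iE : Integrable fun p => tensor (halfExp σ s) (polyGauss q) p * Ψ p :=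
    (memLp_tensor m0 (memLp_polyGauss q)).integrable_mul h.memLp
  have iy : Integrable fun p => tensor (halfExp σ s) (polyGauss q) p * ((p.2 : ℂ) ^ 2 * Ψ p) :=
    (memLp_tensor m0 (memLp_polyGauss q)).integrable_mul hy
  have ixx : Integrable fun p => tensor (halfExp σ s) (polyGauss q) p * fxx p :=
    (memLp_tensor m0 (memLp_polyGauss q)).integrable_mul h.memLp_xx
  have iyy : Integrable fun p => tensor (halfExp σ s) (polyGauss q) p * fyy p :=
    (memLp_tensor m0 (memLp_polyGauss q)).integrable_mul h.memLp_yy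
  have hode : ∫ p, tensor (halfExp σ s) (polyGauss (gaussDeriv (gaussDeriv q))) p * Ψ p =
      (∫ p, tensor (halfExp σ s) (polyGauss q) p * ((p.2 : ℂ) ^ 2 * Ψ p)) -
        (2 * n + 1) * ∫ p, tensor (halfExp σ s) (polyGauss q) p * Ψ p := by
    rw [← integral_const_mul, ← integral_sub iy (iE.const_mul _)]
    refine integral_congr_ae (ae_of_all _ fun p => ?_)
    simp only [tensor, hq, polyGauss_gaussDeriv_gaussDeriv_hermitePoly]
    ring
  have hG : ∫ p, tensor (halfExp σ s) (polyGauss q) p * G p =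
      -(∫ p, tensor (halfExp σ s) (polyGauss q) p * fxx p) +
        (-(1 / 2) * (∫ p, tensor (halfExp σ s) (polyGauss q) p * fyy p) +
        1 / 2 * ∫ p, tensor (halfExp σ s) (polyGauss q) p * ((p.2 : ℂ) ^ 2 * Ψ p)) := by
    have e1 : ∀ᵐ p, tensor (halfExp σ s) (polyGauss q) p * G p =
        -(tensor (halfExp σ s) (polyGauss q) p * fxx p) +
        (-(1 / 2) * (tensor (halfExp σ s) (polyGauss q) p * fyy p) +
        1 / 2 * (tensor (halfExp σ s) (polyGauss q) p * ((p.2 : ℂ) ^ 2 * Ψ p))) := by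
      filter_upwards [e] with p hp
      rw [hp]
      ring
    have i2 := (iyy.const_mul (-(1 / 2))).add (iy.const_mul (1 / 2))
    rw [integral_congr_ae e1, ← integral_const_mul, ← integral_const_mul, ← integral_neg,
      ← integral_add (iyy.const_mul _) (iy.const_mul _)]
    exact integral_add ixx.neg i2
  rw [hG]
  -- `x2` and `x1` move both `x`-derivatives onto the exponential, `y2` and `y1` both
  -- `y`-derivatives onto the Gaussian factor, where `hode` is the Hermite equation; `hσσ` removes
  -- `σ²`.
  linear_combination -x2 - s * σ * x1 - (1 / 2) * hode + (1 / 2) * y1 - (1 / 2) * y2 +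
    (s * (∫ y, polyGauss q y * (if σ = 1 then ur else ul) y) -
      s ^ 2 * ∫ p, tensor (halfExp σ s) (polyGauss q) p * Ψ p) * hσσ

/-! ### Finite combinations of modes, their boundary coefficients and symmetry. -/

/-- A finite combination of Hermite functions. -/
def hermiteSum : (ℕ →₀ ℂ) →ₗ[ℂ] (ℝ → ℂ) :=
  Finsupp.linearCombination ℂ fun n => polyGauss (hermitePoly n)

lemma hermiteSum_single (n : ℕ) (c : ℂ) :
    hermiteSum (Finsupp.single n c) = c • polyGauss (hermitePoly n) :=
  Finsupp.linearCombination_single ℂ c n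

lemma memLp_hermiteSum (c : ℕ →₀ ℂ) : MemLp (hermiteSum c) 2 := by
  induction c using Finsupp.induction_linear with
  | zero => rw [map_zero]; exact MemLp.zero
  | add f g hf hg => rw [map_add]; exact hf.add hg
  | single n a => rw [hermiteSum_single]; exact (memLp_polyGauss _).const_smul a

lemma conj_polyGauss (q : Polynomial ℝ) (y : ℝ) : conj (polyGauss q y) = polyGauss q y :=
  Complex.conj_ofReal _

lemma integral_polyGauss_mul_hermiteSum (n : ℕ) (c : ℕ →₀ ℂ) :
    ∫ y, polyGauss (hermitePoly n) y * hermiteSum c y = c n := by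
  induction c using Finsupp.induction_linear with
  | zero => simp
  | add f g hf hg =>
    have hi : ∀ e : ℕ →₀ ℂ, Integrable fun y => polyGauss (hermitePoly n) y * hermiteSum e y :=
      fun e => (memLp_polyGauss _).integrable_mul (memLp_hermiteSum e)
    rw [Finsupp.add_apply, ← hf, ← hg, ← integral_add (hi f) (hi g), map_add]
    refine integral_congr_ae (ae_of_all _ fun y => ?_)
    simp only [Pi.add_apply, mul_add]
  | single m a =>
    have e : ∀ y, polyGauss (hermitePoly n) y * hermiteSum (Finsupp.single m a) y =
        a * ((hermiteFun n y * hermiteFun m y : ℝ) : ℂ) := by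
      intro y
      simp only [hermiteSum_single, Pi.smul_apply, smul_eq_mul, polyGauss_hermitePoly]
      push_cast
      ring
    simp_rw [e]
    rw [integral_const_mul, integral_complex_ofReal, integral_hermiteFun_mul,
      Finsupp.single_apply]
    by_cases h : n = m
    · simp [h]
    · simp [h, Ne.symm h]

/-- Multiplication by `y` on the Hermite coefficients. -/
def hermiteShift : (ℕ →₀ ℂ) →ₗ[ℂ] (ℕ →₀ ℂ) :=
  Finsupp.linearCombination ℂ fun n => Finsupp.single (n + 1) (Real.sqrt ((n + 1) / 2) : ℂ) +
    Finsupp.single (n - 1) (Real.sqrt (n / 2) : ℂ)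

lemma hermiteSum_hermiteShift (c : ℕ →₀ ℂ) (y : ℝ) :
    hermiteSum (hermiteShift c) y = y * hermiteSum c y := by
  induction c using Finsupp.induction_linear with
  | zero => simp
  | add f g hf hg => simp only [map_add, Pi.add_apply, hf, hg, mul_add]
  | single m a =>
    have h := congrArg (fun x : ℝ => (x : ℂ)) (mul_hermiteFun m y)
    push_cast at h
    simp only [hermiteShift, Finsupp.linearCombination_single, map_smul, map_add,
      hermiteSum_single, Pi.smul_apply, Pi.add_apply, smul_eq_mul, polyGauss_hermitePoly]
    linear_combination -a * h

lemma hermiteShift_apply (c : ℕ →₀ ℂ) (n : ℕ) : hermiteShift c n =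
    Real.sqrt ((n + 1) / 2) * c (n + 1) + Real.sqrt (n / 2) * c (n - 1) := by
  induction c using Finsupp.induction_linear with
  | zero => simp
  | add f g hf hg => simp only [map_add, Finsupp.add_apply, hf, hg]; ring
  | single m a =>
    simp only [hermiteShift, Finsupp.linearCombination_single, Finsupp.smul_apply,
      Finsupp.add_apply, Finsupp.single_apply, smul_eq_mul]
    by_cases e1 : m = n + 1
    · subst e1
      simp [show n + 1 ≠ n - 1 by omega, show n + 1 + 1 ≠ n by omega]
      ring
    · rcases Nat.eq_zero_or_pos n with rfl | hn
      · rcases Nat.eq_zero_or_pos m with rfl | hm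
        · simp
        · simp [hm.ne', e1, show m - 1 ≠ 0 by omega]
      · by_cases e2 : m + 1 = n
        · subst e2
          rcases Nat.eq_zero_or_pos m with rfl | hm
          · simp [mul_comm]
          · simp [show m - 1 ≠ m + 1 by omega, mul_comm, show m ≠ m + 1 + 1 by omega]
        · have e3 : m ≠ n - 1 := by omega
          rcases Nat.eq_zero_or_pos m with rfl | hm
          · simp [hn.ne, e2, e3]
          · simp [e1, e2, e3, show m - 1 ≠ n by omega]

/-- `w` is a finite combination of modes, `k` its image under the differential expression, and
`a`, `b`, `c`, `d` are the Hermite coefficients of `w(0±)` and `∂ₓw(0±)`. Of the finiteness only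
Green's formula, against arbitrary functions, is retained. -/
def IsFinitePair (w k : L2Plane) (a b c d : ℕ →₀ ℂ) : Prop :=
  IsUnmatchedPair w k (hermiteSum a) (hermiteSum b) (hermiteSum c) (hermiteSum d) ∧
    ∀ (Ψ G : L2Plane) (ur ul dr dl : ℝ → ℂ), IsUnmatchedPair Ψ G ur ul dr dl →
      inner ℂ w G = inner ℂ k Ψ + ∫ y, (conj (hermiteSum a y) * dr y - conj (hermiteSum c y) * ur y
        - conj (hermiteSum b y) * dl y + conj (hermiteSum d y) * ul y)

lemma integrable_boundary (a b c d : ℕ →₀ ℂ) {ur ul dr dl : ℝ → ℂ} (hur : MemLp ur 2)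
    (hul : MemLp ul 2) (hdr : MemLp dr 2) (hdl : MemLp dl 2) :
    Integrable fun y => (conj (hermiteSum a y) * dr y - conj (hermiteSum c y) * ur y
        - conj (hermiteSum b y) * dl y + conj (hermiteSum d y) * ul y) := by
  have h : ∀ e : ℕ →₀ ℂ, MemLp (fun y => conj (hermiteSum e y)) 2 := fun e =>
    (memLp_hermiteSum e).star
  exact ((((h a).integrable_mul hdr).sub ((h c).integrable_mul hur)).sub
    ((h b).integrable_mul hdl)).add ((h d).integrable_mul hul)

lemma IsFinitePair.zero : IsFinitePair 0 0 0 0 0 0 := by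
  refine ⟨by simpa using IsUnmatchedPair.zero, fun Ψ G ur ul dr dl _ => ?_⟩
  simp

lemma IsFinitePair.add {w k w' k' : L2Plane} {a b c d a' b' c' d' : ℕ →₀ ℂ}
    (h : IsFinitePair w k a b c d) (h' : IsFinitePair w' k' a' b' c' d') :
    IsFinitePair (w + w') (k + k') (a + a') (b + b') (c + c') (d + d') := by
  refine ⟨by simpa using h.1.add h'.1, fun Ψ G ur ul dr dl hu => ?_⟩
  obtain ⟨m1, m2, m3, m4⟩ := hu.memLp_traces
  rw [inner_add_left, inner_add_left, h.2 _ _ _ _ _ _ hu, h'.2 _ _ _ _ _ _ hu,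
    add_add_add_comm, ← integral_add (integrable_boundary a b c d m1 m2 m3 m4)
    (integrable_boundary a' b' c' d' m1 m2 m3 m4)]
  congr 2
  ext y
  simp only [map_add, Pi.add_apply]
  ring

lemma IsFinitePair.const_smul {w k : L2Plane} {a b c d : ℕ →₀ ℂ}
    (h : IsFinitePair w k a b c d) (z : ℂ) :
    IsFinitePair (z • w) (z • k) (z • a) (z • b) (z • c) (z • d) := by
  refine ⟨by simpa using h.1.const_smul z, fun Ψ G ur ul dr dl hu => ?_⟩
  rw [inner_smul_left, inner_smul_left, h.2 _ _ _ _ _ _ hu, mul_add, ← integral_const_mul]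
  congr 2
  ext y
  simp only [map_smul, Pi.smul_apply, smul_eq_mul, map_mul]
  ring

lemma inner_expMode_left {σ : ℝ} (hσ : σ = 1 ∨ σ = -1) {s : ℂ} (hs : 0 < s.re) (n : ℕ)
    (F : L2Plane) : inner ℂ (expMode hσ hs n) F =
      ∫ p, tensor (halfExp σ (conj s)) (polyGauss (hermitePoly n)) p * F p := by
  rw [L2.inner_def]
  refine integral_congr_ae ?_
  filter_upwards [coeFn_expMode hσ hs n] with p hp
  simp only [RCLike.inner_apply, hp, tensor, map_mul, conj_halfExp, conj_polyGauss]
  ring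

/-- The inner product conjugates its left entry, so Green's formula is applied with the rate `conj
s`. -/
lemma isFinitePair_expMode {σ : ℝ} (hσ : σ = 1 ∨ σ = -1) {s : ℂ} (hs : 0 < s.re) (n : ℕ) :
    IsFinitePair (expMode hσ hs n) (((n : ℂ) + 1 / 2 - s ^ 2) • expMode hσ hs n)
      (Finsupp.single n (if σ = 1 then 1 else 0)) (Finsupp.single n (if σ = 1 then 0 else 1))
      (Finsupp.single n (if σ = 1 then -s else 0))
      (Finsupp.single n (if σ = 1 then 0 else s)) := by
  refine ⟨by simpa only [hermiteSum_single] using isUnmatchedPair_expMode hσ hs n,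
    fun Ψ G ur ul dr dl hu => ?_⟩
  have hs' : 0 < (conj s).re := by simpa using hs
  have h := hu.integral_expMode hσ hs' n
  obtain ⟨m1, m2, m3, m4⟩ := hu.memLp_traces
  have hi : ∀ e : ℝ → ℂ, MemLp e 2 → Integrable fun y => polyGauss (hermitePoly n) y * e y :=
    fun e he => (memLp_polyGauss _).integrable_mul he
  rw [inner_smul_left, inner_expMode_left, inner_expMode_left, h, add_assoc]
  have h2 : conj (2 : ℂ) = 2 := Complex.conj_ofNat 2
  congr 1
  · simp [h2]
  · simp only [hermiteSum_single, Pi.smul_apply, smul_eq_mul, map_mul, conj_polyGauss]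
    rcases hσ with rfl | rfl
    · simp only [if_true, map_one, map_zero, map_neg, Complex.ofReal_one, one_mul, zero_mul,
        sub_zero, add_zero]
      rw [← integral_const_mul, ← integral_add (hi _ m3) ((hi _ m1).const_mul _)]
      refine integral_congr_ae (ae_of_all _ fun y => ?_)
      ring
    · have hne : ¬ ((-1 : ℝ) = 1) := by norm_num
      simp only [if_neg hne, map_one, map_zero, one_mul, zero_mul, sub_zero]
      rw [← integral_const_mul, ← integral_const_mul, ← integral_add
        ((hi _ m4).const_mul _) ((hi _ m2).const_mul _)]
      refine integral_congr_ae (ae_of_all _ fun y => ?_)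
      push_cast
      ring

/-- The finite pairs that satisfy the matching conditions. -/
def finiteGraph (β : ℝ) : Submodule ℂ (L2Plane × L2Plane) where
  carrier := {q | ∃ a b c : ℕ →₀ ℂ, IsFinitePair q.1 q.2 a b c c ∧
    hermiteShift (a - b) = (β : ℂ) • c}
  zero_mem' := ⟨0, 0, 0, IsFinitePair.zero, by simp⟩
  add_mem' := by
    rintro q q' ⟨a, b, c, h, e⟩ ⟨a', b', c', h', e'⟩
    refine ⟨a + a', b + b', c + c', h.add h', ?_⟩
    rw [add_sub_add_comm, map_add, e, e', smul_add]
  smul_mem' := by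
    rintro z q ⟨a, b, c, h, e⟩
    refine ⟨z • a, z • b, z • c, h.const_smul z, ?_⟩
    rw [← smul_sub, map_smul, e, smul_comm]

/-- The matching condition multiplied by `y` is an identity of finite coefficient sequences;
division by `y` recovers the pointwise form away from `y = 0`. -/
lemma hermiteSum_sub_of_hermiteShift {β : ℝ} {a b c : ℕ →₀ ℂ}
    (e : hermiteShift (a - b) = (β : ℂ) • c) {y : ℝ} (hy : y ≠ 0) :
    hermiteSum a y - hermiteSum b y = (β / y : ℂ) * hermiteSum c y := by
  have h := hermiteSum_hermiteShift (a - b) y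
  rw [e, map_smul, map_sub, Pi.smul_apply, Pi.sub_apply, smul_eq_mul] at h
  have hy' : (y : ℂ) ≠ 0 := by exact_mod_cast hy
  field_simp
  linear_combination -h

lemma finiteGraph_le (β : ℝ) : finiteGraph β ≤ (hamiltonianCore β).graph := by
  rintro ⟨w, k⟩ ⟨a, b, c, h, e⟩
  rw [mem_graph_hamiltonianCore, isHamiltonianPair_iff]
  refine ⟨_, _, _, _, h.1, ?_, ae_of_all _ fun y => rfl⟩
  filter_upwards [Measure.ae_ne volume (0 : ℝ)] with y hy
  exact hermiteSum_sub_of_hermiteShift e hy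

/-- Both elements have a continuous normal derivative and a jump equal to the same real multiple `β
/ y` of it, so the boundary integrand in Green's formula cancels pointwise. -/
lemma finiteGraph_symmetric (β : ℝ) : ∀ q ∈ (hamiltonianCore β).graph, ∀ p ∈ finiteGraph β,
    inner ℂ p.1 q.2 = inner ℂ p.2 q.1 := by
  rintro ⟨Ψ, G⟩ hq ⟨w, k⟩ ⟨a, b, c, h, e⟩
  rw [mem_graph_hamiltonianCore, isHamiltonianPair_iff] at hq
  obtain ⟨ur, ul, dr, dl, hu, e1, e2⟩ := hq
  rw [h.2 _ _ _ _ _ _ hu, integral_eq_zero_of_ae, add_zero]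
  filter_upwards [e1, e2, Measure.ae_ne volume (0 : ℝ)] with y h1 h2 hy
  have h3 := congrArg conj (hermiteSum_sub_of_hermiteShift e hy)
  simp only [map_sub, map_mul, map_div₀, Complex.conj_ofReal] at h3
  rw [← h2, Pi.zero_apply]
  linear_combination dr y * h3 - conj (hermiteSum c y) * h1

/-- The rates `k + 1`, `k + 2`, `k + 3` are real, so the conjugation in the inner product has no
effect on them. -/
lemma eq_zero_of_inner_expMode {F : L2Plane}
    (h : ∀ (σ : ℝ) (hσ : σ = 1 ∨ σ = -1) (n k : ℕ),
      inner ℂ (expMode hσ (s := (k : ℂ) + 1) (by simp; positivity) n -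
        (2 : ℂ) • expMode hσ (s := (k : ℂ) + 2) (by simp; positivity) n +
        expMode hσ (s := (k : ℂ) + 3) (by simp; positivity) n) F = (0 : ℂ)) : F = 0 := by
  refine Lp.eq_zero_iff_ae_eq_zero.2 (ae_eq_zero_of_halfExp_hermite (Lp.memLp F)
    fun σ hσ n k => ?_)
  have h2 : conj (2 : ℂ) = 2 := Complex.conj_ofNat 2
  have h3 : conj (3 : ℂ) = 3 := Complex.conj_ofNat 3
  have h0 := h σ hσ n k
  have hi : ∀ s : ℂ, 0 < s.re →
      Integrable fun p => tensor (halfExp σ s) (polyGauss (hermitePoly n)) p * F p := fun s hs =>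
    (memLp_tensor (memLp_halfExp (abs_eq_one_of_sign hσ) hs) (memLp_polyGauss _)).integrable_mul
      (Lp.memLp F)
  have i1 := hi ((k : ℂ) + 1) (by simp; positivity)
  have i2 := hi ((k : ℂ) + 2) (by simp; positivity)
  have i3 := hi ((k : ℂ) + 3) (by simp; positivity)
  have i12 : Integrable fun p =>
      tensor (halfExp σ ((k : ℂ) + 1)) (polyGauss (hermitePoly n)) p * F p -
      2 * (tensor (halfExp σ ((k : ℂ) + 2)) (polyGauss (hermitePoly n)) p * F p) :=
    i1.sub (i2.const_mul _)
  rw [inner_add_left, inner_sub_left, inner_smul_left, inner_expMode_left, inner_expMode_left,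
    inner_expMode_left] at h0
  simp only [map_add, map_natCast, map_one, h2, h3] at h0
  rw [← h0, ← integral_const_mul, ← integral_sub i1 (i2.const_mul _),
    ← integral_add i12 i3]
  refine integral_congr_ae (ae_of_all _ fun p => ?_)
  simp only [tensor]
  ring

/-- The weights `1, -2, 1` annihilate both the values and the derivatives at the line, the latter
because the rates are in arithmetic progression. Such second differences have zero boundary data,
hence satisfy the matching conditions for every `β`, and they are complete. -/
lemma finiteGraph_dense_domain (β : ℝ) (F : L2Plane)
    (h : ∀ p ∈ finiteGraph β, inner ℂ p.1 F = (0 : ℂ)) : F = 0 := by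
  refine eq_zero_of_inner_expMode fun σ hσ n k => ?_
  have p1 := isFinitePair_expMode hσ (s := (k : ℂ) + 1) (by simp; positivity) n
  have p2 := isFinitePair_expMode hσ (s := (k : ℂ) + 2) (by simp; positivity) n
  have p3 := isFinitePair_expMode hσ (s := (k : ℂ) + 3) (by simp; positivity) n
  have hp := (p1.add (p2.const_smul (-2))).add p3
  have e : ∀ x y z : ℂ, x + -2 * y + z = 0 → Finsupp.single n x + (-2 : ℂ) • Finsupp.single n y +
      Finsupp.single n z = 0 := by
    intro x y z hx
    rw [Finsupp.smul_single, ← Finsupp.single_add, ← Finsupp.single_add, smul_eq_mul, hx,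
      Finsupp.single_zero]
  rw [e _ _ _ (by split_ifs <;> ring), e _ _ _ (by split_ifs <;> ring),
    e _ _ _ (by split_ifs <;> ring), e _ _ _ (by split_ifs <;> ring)] at hp
  have h1 := h (_, _) ⟨0, 0, 0, hp, by simp⟩
  rwa [neg_smul, ← sub_eq_add_neg] at h1

/-! ### The modes, their boundary data and the operator `T`. -/

/-- `(n + 1/2)^(1/4)`, the amplitude of the `n`-th mode. -/
def amplitude (n : ℕ) : ℝ := ((n : ℝ) + 1 / 2) ^ (1 / 4 : ℝ)

lemma amplitude_pos (n : ℕ) : 0 < amplitude n := by unfold amplitude; positivity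

/-- The off-diagonal entries are those of multiplication by `y` in the Hermite basis, scaled by `√2`
and weighted on both sides with the amplitudes. -/
lemma jacobiD_succ (n : ℕ) :
    jacobiD (n + 1) = Real.sqrt 2 * Real.sqrt ((n + 1) / 2) * amplitude (n + 1) * amplitude n := by
  rw [jacobiD, if_neg n.succ_ne_zero, amplitude, amplitude, ← Real.sqrt_mul (by norm_num),
    Real.sqrt_eq_rpow]
  push_cast
  congr 2
  · congr 2
    ring
  · ring

lemma jacobiY_eq (n : ℕ) (Λ : ℂ) : jacobiY n Λ = (amplitude n : ℂ) ^ 2 * zeta n Λ := by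
  rw [jacobiY, amplitude, ← Complex.ofReal_pow, ← Real.rpow_natCast, ← Real.rpow_mul (by positivity)]
  norm_num

/-- Multiplication of a finite sequence by a fixed sequence. -/
def diagFin (f : ℕ → ℂ) : (ℕ →₀ ℂ) →ₗ[ℂ] (ℕ →₀ ℂ) :=
  Finsupp.linearCombination ℂ fun n => Finsupp.single n (f n)

lemma diagFin_single (f : ℕ → ℂ) (n : ℕ) (a : ℂ) :
    diagFin f (Finsupp.single n a) = Finsupp.single n (a * f n) := by
  rw [diagFin, Finsupp.linearCombination_single, Finsupp.smul_single, smul_eq_mul]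

lemma diagFin_apply (f : ℕ → ℂ) (C : ℕ →₀ ℂ) (n : ℕ) : diagFin f C n = f n * C n := by
  induction C using Finsupp.induction_linear with
  | zero => simp
  | add f g hf hg => rw [map_add, Finsupp.add_apply, hf, hg, Finsupp.add_apply, mul_add]
  | single m a =>
    rw [diagFin_single, Finsupp.single_apply, Finsupp.single_apply]
    split_ifs with h
    · rw [h, mul_comm]
    · rw [mul_zero]

/-- The two functions differ on the line `x = 0`, where `eta` takes its left branch and `halfExp` is
zero; this is a null set. -/
lemma mode_eq {Λ : ℂ} (hΛ : Λ.im ≠ 0) (n : ℕ) : mode hΛ n = (amplitude n : ℂ) •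
    (expMode (σ := 1) (Or.inl rfl) (zeta_re_pos hΛ n) n -
      expMode (σ := -1) (Or.inr rfl) (zeta_re_pos hΛ n) n) := by
  refine Lp.ext ?_
  filter_upwards [(memLp_modeFun hΛ n).coeFn_toLp, Lp.coeFn_smul (amplitude n : ℂ)
    (expMode (σ := 1) (Or.inl rfl) (zeta_re_pos hΛ n) n -
      expMode (σ := -1) (Or.inr rfl) (zeta_re_pos hΛ n) n),
    Lp.coeFn_sub (expMode (σ := 1) (Or.inl rfl) (zeta_re_pos hΛ n) n)
      (expMode (σ := -1) (Or.inr rfl) (zeta_re_pos hΛ n) n),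
    coeFn_expMode (σ := 1) (Or.inl rfl) (zeta_re_pos hΛ n) n,
    coeFn_expMode (σ := -1) (Or.inr rfl) (zeta_re_pos hΛ n) n, ae_mem_offLine]
    with p h1 h2 h3 h4 h5 (h6 : p.1 ≠ 0)
  rw [mode, h1, h2, Pi.smul_apply, h3, Pi.sub_apply, h4, h5]
  simp only [modeFun, eta, tensor, halfExp, polyGauss_hermitePoly, amplitude, smul_eq_mul]
  rcases lt_or_gt_of_ne h6 with h | h
  · simp [h, not_lt.2 h.le]
    ring
  · simp [h, not_lt.2 h.le]
    ring

/-- Since `ζ_n² = n + 1/2 - Λ`, a mode solves the equation at `Λ` off the line. Being odd in `x`, it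
has opposite traces and equal normal derivatives. -/
lemma isFinitePair_mode {Λ : ℂ} (hΛ : Λ.im ≠ 0) (n : ℕ) :
    IsFinitePair (mode hΛ n) (Λ • mode hΛ n) (Finsupp.single n (amplitude n : ℂ))
      (-Finsupp.single n (amplitude n : ℂ)) (Finsupp.single n (-(amplitude n * zeta n Λ)))
      (Finsupp.single n (-(amplitude n * zeta n Λ))) := by
  have e1 := isFinitePair_expMode (σ := 1) (Or.inl rfl) (zeta_re_pos hΛ n) n
  have e2 := isFinitePair_expMode (σ := -1) (Or.inr rfl) (zeta_re_pos hΛ n) n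
  have h := (e1.add (e2.const_smul (-1))).const_smul (amplitude n : ℂ)
  have hz : (n : ℂ) + 1 / 2 - zeta n Λ ^ 2 = Λ := by rw [sq, zeta_mul_self hΛ]; ring
  have hne : ¬ ((-1 : ℝ) = 1) := by norm_num
  simp only [hz, hne, if_true, if_false, Finsupp.smul_single, ← Finsupp.single_add,
    smul_eq_mul] at h
  convert h using 1
  · rw [mode_eq hΛ, neg_one_smul, ← sub_eq_add_neg]
  · rw [mode_eq hΛ]
    module
  · congr 1; ring
  · rw [← Finsupp.single_neg]; congr 1; ring
  · congr 1; ring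
  · congr 1; ring

lemma opT_finSeq {Λ : ℂ} (hΛ : Λ.im ≠ 0) (C : ℕ →₀ ℂ) :
    opT hΛ (finSeq C) = ∑ n ∈ C.support, C n • mode hΛ n := by
  have h : opT hΛ (finSeq C) = ∑' n, finSeq C n • mode hΛ n := rfl
  rw [h, tsum_eq_sum (s := C.support)]
  · simp only [finSeq_apply]
  · intro n hn
    rw [finSeq_apply, Finsupp.notMem_support_iff.1 hn, zero_smul]

lemma opT_finSeq_single {Λ : ℂ} (hΛ : Λ.im ≠ 0) (n : ℕ) (a : ℂ) :
    opT hΛ (finSeq (Finsupp.single n a)) = a • mode hΛ n := by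
  rw [opT_finSeq, Finset.sum_subset Finsupp.support_single_subset, Finset.sum_singleton,
    Finsupp.single_eq_same]
  intro m _ hm
  rw [Finsupp.notMem_support_iff.1 hm, zero_smul]

lemma isFinitePair_opT {Λ : ℂ} (hΛ : Λ.im ≠ 0) (C : ℕ →₀ ℂ) :
    IsFinitePair (opT hΛ (finSeq C)) (Λ • opT hΛ (finSeq C))
      (diagFin (fun n => amplitude n) C) (-diagFin (fun n => amplitude n) C)
      (diagFin (fun n => -(amplitude n * zeta n Λ)) C)
      (diagFin (fun n => -(amplitude n * zeta n Λ)) C) := by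
  induction C using Finsupp.induction_linear with
  | zero => simpa using IsFinitePair.zero
  | add f g hf hg => simpa only [map_add, smul_add, neg_add] using hf.add hg
  | single n a =>
    have h := (isFinitePair_mode hΛ n).const_smul a
    simp only [smul_neg, Finsupp.smul_single, smul_eq_mul] at h
    rwa [opT_finSeq_single, smul_comm, diagFin_single, diagFin_single]

lemma adjoint_opT_apply {Λ : ℂ} (hΛ : Λ.im ≠ 0) (v : L2Plane) (n : ℕ) :
    ContinuousLinearMap.adjoint (opT hΛ) v n = inner ℂ (mode hΛ n) v := by
  have h := lp.inner_single_left (𝕜 := ℂ) n (1 : ℂ) (ContinuousLinearMap.adjoint (opT hΛ) v)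
  rw [ContinuousLinearMap.adjoint_inner_right, ← finSeq_single, opT_finSeq_single, one_smul] at h
  rw [h]
  simp

/-! ### Explicit free solutions and density of the ranges. -/

/-- The values at `H₀ - Λ` of finite combinations of modes that are smooth across the line. -/
def freeRange (Λ : ℂ) : Submodule ℂ L2Plane where
  carrier := {v | ∃ (w : L2Plane) (p q : ℕ →₀ ℂ), IsFinitePair w (v + Λ • w) p p q q}
  zero_mem' := ⟨0, 0, 0, by simpa using IsFinitePair.zero⟩
  add_mem' := by
    rintro v v' ⟨w, p, q, h⟩ ⟨w', p', q', h'⟩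
    refine ⟨w + w', p + p', q + q', ?_⟩
    have := h.add h'
    rwa [add_add_add_comm, ← smul_add] at this
  smul_mem' := by
    rintro z v ⟨w, p, q, h⟩
    refine ⟨z • w, z • p, z • q, ?_⟩
    have := h.const_smul z
    rwa [smul_add, smul_comm] at this

/-- Half-line ODE: a particular solution `κ exp(-sσx)` is corrected on its own side by `(B - κ)
exp(-ζσx)` and continued to the other side by the decaying solution with coefficient `B`, so that
value and derivative agree at the line. -/
lemma expMode_mem_freeRange_of_sq_eq {Λ : ℂ} {σ : ℝ} (hσ : σ = 1 ∨ σ = -1) {s ζ : ℂ}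
    (hs : 0 < s.re) (hζ : 0 < ζ.re) (n : ℕ) (hz : (n : ℂ) + 1 / 2 - ζ ^ 2 = Λ)
    (hne : s ^ 2 ≠ ζ ^ 2) : expMode hσ hs n ∈ freeRange Λ := by
  have hσ' : -σ = 1 ∨ -σ = -1 := by
    rcases hσ with rfl | rfl
    · exact Or.inr rfl
    · exact Or.inl (neg_neg 1)
  have e1 := isFinitePair_expMode hσ hs n
  have e2 := isFinitePair_expMode hσ hζ n
  have e3 := isFinitePair_expMode hσ' hζ n
  rw [hz] at e2 e3
  have h0 : ζ ≠ 0 := fun h => by simp [h] at hζ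
  have h1 : ζ + s ≠ 0 := fun h => by
    have := congrArg Complex.re h
    simp only [Complex.add_re, Complex.zero_re] at this
    linarith
  have h2 : ζ - s ≠ 0 := fun h => hne (by rw [← sub_eq_zero.1 h])
  have hd : (n : ℂ) + 1 / 2 - s ^ 2 = (ζ + s) * (ζ - s) + Λ := by rw [← hz]; ring
  -- On a rate `s`, subtracting `Λ` leaves the factor `ζ² - s²`; `κ` is its inverse.
  obtain ⟨κ, hκ⟩ : ∃ κ : ℂ, κ * ((ζ + s) * (ζ - s)) = 1 :=
    ⟨1 / ((ζ + s) * (ζ - s)), by field_simp⟩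
  -- Equality of the values at the line is built into the ansatz; equality of the derivatives is
  -- `2ζB = κ(ζ - s)`.
  obtain ⟨B, hB⟩ : ∃ B : ℂ, 2 * ζ * B = κ * (ζ - s) := ⟨κ * (ζ - s) / (2 * ζ), by field_simp⟩
  have h := ((e1.const_smul κ).add (e2.const_smul (B - κ))).add (e3.const_smul B)
  refine ⟨κ • expMode hσ hs n + (B - κ) • expMode hσ hζ n + B • expMode hσ' hζ n,
    Finsupp.single n B, Finsupp.single n (σ * (ζ * B)), ?_⟩
  simp only [Finsupp.smul_single, ← Finsupp.single_add, smul_eq_mul] at h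
  convert h using 1
  · rw [hd, ← sub_eq_zero]
    trans (1 - κ * ((ζ + s) * (ζ - s))) • expMode hσ hs n
    · module
    · rw [hκ, sub_self, zero_smul]
  all_goals
    congr 1
    rcases hσ with rfl | rfl <;>
    simp only [show ¬ ((-1 : ℝ) = 1) by norm_num, neg_neg, if_true, if_false,
      Complex.ofReal_neg, Complex.ofReal_one] <;>
    first
    | ring1
    | linear_combination hB
    | linear_combination -hB

lemma expMode_mem_freeRange {Λ : ℂ} (hΛ : Λ.im ≠ 0) {σ : ℝ} (hσ : σ = 1 ∨ σ = -1) {s : ℂ}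
    (hs : 0 < s.re) (n : ℕ) (hne : s ^ 2 ≠ (n : ℂ) + 1 / 2 - Λ) :
    expMode hσ hs n ∈ freeRange Λ := by
  have hz : zeta n Λ ^ 2 = (n : ℂ) + 1 / 2 - Λ := by rw [sq, zeta_mul_self hΛ]
  exact expMode_mem_freeRange_of_sq_eq hσ hs (zeta_re_pos hΛ n) n (by rw [hz]; ring)
    (by rwa [hz])

/-- For the integer rates in the completeness theorem `s²` is real while `n + 1/2 - Λ` is not, so no
resonance occurs. -/
lemma dense_freeRange {Λ : ℂ} (hΛ : Λ.im ≠ 0) : Dense (freeRange Λ : Set L2Plane) := by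
  rw [Submodule.dense_iff_topologicalClosure_eq_top, Submodule.topologicalClosure_eq_top_iff, Submodule.eq_bot_iff]
  intro F hF
  rw [Submodule.mem_orthogonal] at hF
  refine eq_zero_of_inner_expMode fun σ hσ n k => hF _ ?_
  have hk : ∀ j : ℕ, ((k : ℂ) + j) ^ 2 ≠ (n : ℂ) + 1 / 2 - Λ := by
    intro j h
    have h1 := congrArg Complex.im h
    have h12 : (1 / 2 : ℂ).im = 0 := by norm_num
    rw [← Nat.cast_add, ← Nat.cast_pow, Complex.natCast_im, Complex.sub_im, Complex.add_im,
      Complex.natCast_im, h12] at h1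
    exact hΛ (by linarith)
  refine add_mem (sub_mem ?_ (Submodule.smul_mem _ _ ?_)) ?_
  · exact expMode_mem_freeRange hΛ hσ _ n (by simpa using hk 1)
  · exact expMode_mem_freeRange hΛ hσ _ n (by simpa using hk 2)
  · exact expMode_mem_freeRange hΛ hσ _ n (by simpa using hk 3)

/-- The squared rate `n + 1/2 - conj Λ` is never resonant at `Λ`. This lets the modes at `conj Λ`
serve as corrections in `dense_jacobiRange`. -/
lemma mode_conj_mem_freeRange {Λ : ℂ} (hΛ : Λ.im ≠ 0) (n : ℕ) :
    mode (conj_im_ne_zero hΛ) n ∈ freeRange Λ := by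
  have hne : zeta n (conj Λ) ^ 2 ≠ (n : ℂ) + 1 / 2 - Λ := by
    rw [sq, zeta_mul_self (conj_im_ne_zero hΛ)]
    intro h
    have h1 := congrArg Complex.im h
    simp only [Complex.sub_im, Complex.conj_im] at h1
    exact hΛ (by linarith)
  rw [mode_eq]
  exact Submodule.smul_mem _ _ (sub_mem (expMode_mem_freeRange hΛ _ _ n hne)
    (expMode_mem_freeRange hΛ _ _ n hne))

/-- In Green's formula against a mode at `conj Λ` the terms `Λ⟨mode, w⟩` cancel. The values `p` drop
out because the mode has no jump in the derivative; the derivatives `q` count twice because of its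
jump `2 a_n`. -/
lemma adjoint_opT_eq_finSeq {Λ : ℂ} (hΛ : Λ.im ≠ 0) {v w : L2Plane} {p q : ℕ →₀ ℂ}
    (h : IsFinitePair w (v + Λ • w) p p q q) :
    ContinuousLinearMap.adjoint (opT (conj_im_ne_zero hΛ)) v =
      finSeq (diagFin (fun n => 2 * amplitude n) q) := by
  ext n
  rw [adjoint_opT_apply, finSeq_apply, diagFin_apply]
  have h1 := (isFinitePair_mode (conj_im_ne_zero hΛ) n).2 _ _ _ _ _ _ h.1
  rw [inner_add_right, inner_smul_right, inner_smul_left, Complex.conj_conj, add_comm,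
    add_right_inj] at h1
  have h2 : ∀ y, conj (hermiteSum (Finsupp.single n (amplitude n : ℂ)) y) * hermiteSum q y -
      conj (hermiteSum (Finsupp.single n (-(amplitude n * zeta n (conj Λ)))) y) * hermiteSum p y -
      conj (hermiteSum (-Finsupp.single n (amplitude n : ℂ)) y) * hermiteSum q y +
      conj (hermiteSum (Finsupp.single n (-(amplitude n * zeta n (conj Λ)))) y) * hermiteSum p y =
      2 * amplitude n * (polyGauss (hermitePoly n) y * hermiteSum q y) := by
    intro y
    simp only [map_neg, hermiteSum_single, Pi.smul_apply, Pi.neg_apply, smul_eq_mul, map_mul,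
      conj_polyGauss, Complex.conj_ofReal]
    ring
  simp_rw [h2] at h1
  rw [h1, integral_const_mul, integral_polyGauss_mul_hermiteSum]

/-- A bounded right inverse of `T(conj Λ)*` on finite sequences, with values in `freeRange`. The
modes are orthogonal, so each is divided by its squared norm `(n + 1/2)^(1/2) / Re ζ_n`, which the
upper bound on `Re ζ_n` keeps away from zero. -/
lemma exists_adjoint_opT_eq_finSeq {Λ : ℂ} (hΛ : Λ.im ≠ 0) :
    ∃ K : ℝ, 0 ≤ K ∧ ∀ e : ℕ →₀ ℂ, ∃ g ∈ freeRange Λ,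
      ContinuousLinearMap.adjoint (opT (conj_im_ne_zero hΛ)) g = finSeq e ∧
        ‖g‖ ^ 2 ≤ K * ‖finSeq e‖ ^ 2 := by
  have hΛ' := conj_im_ne_zero hΛ
  obtain ⟨K, hK, hb⟩ := zeta_re_upper hΛ'
  have hpos : ∀ n, 0 < ‖mode hΛ' n‖ ^ 2 := fun n => by
    rw [norm_mode_sq]
    have := zeta_re_pos hΛ' n
    positivity
  have hle : ∀ n, (‖mode hΛ' n‖ ^ 2)⁻¹ ≤ K := fun n => by
    rw [norm_mode_sq, inv_div, div_le_iff₀ (by positivity)]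
    exact hb n
  refine ⟨K, hK.le, fun e => ⟨∑ n ∈ e.support, (e n * ((‖mode hΛ' n‖ ^ 2)⁻¹ : ℝ)) • mode hΛ' n,
    sum_mem fun n _ => Submodule.smul_mem _ _ (mode_conj_mem_freeRange hΛ n), ?_, ?_⟩⟩
  · ext m
    rw [adjoint_opT_apply, finSeq_apply, inner_sum, Finset.sum_eq_single m]
    · rw [inner_smul_right, inner_self_eq_norm_sq_to_K]
      have h := (hpos m).ne'
      have h' : ((‖mode hΛ' m‖ : ℂ)) ^ 2 ≠ 0 := by exact_mod_cast h
      push_cast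
      simp only [Complex.coe_algebraMap]
      rw [mul_assoc, inv_mul_cancel₀ h', mul_one]
    · intro n _ hn
      rw [inner_smul_right, inner_mode hΛ' hn.symm, mul_zero]
    · intro hm
      rw [Finsupp.notMem_support_iff.1 hm, zero_mul, zero_smul, inner_zero_right]
  · have hs : ∑ n ∈ e.support, ‖e n‖ ^ 2 ≤ ‖finSeq e‖ ^ 2 := by
      have h := lp.sum_rpow_le_norm_rpow (p := 2) (by norm_num) (finSeq e) e.support
      simpa [finSeq_apply] using h
    rw [norm_sum_mode hΛ' e.support fun n => e n * ((‖mode hΛ' n‖ ^ 2)⁻¹ : ℝ)]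
    refine le_trans ?_ (mul_le_mul_of_nonneg_left hs hK.le)
    rw [Finset.mul_sum]
    refine Finset.sum_le_sum fun n _ => ?_
    have h := hpos n
    rw [norm_mul, Complex.norm_real, Real.norm_of_nonneg (by positivity), mul_pow]
    calc ‖e n‖ ^ 2 * (‖mode hΛ' n‖ ^ 2)⁻¹ ^ 2 * ‖mode hΛ' n‖ ^ 2
        = (‖mode hΛ' n‖ ^ 2)⁻¹ * ‖e n‖ ^ 2 := by field_simp
      _ ≤ K * ‖e n‖ ^ 2 := mul_le_mul_of_nonneg_right (hle n) (sq_nonneg _)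

/-- The elements of `freeRange Λ` for which the Jacobi equation has a finite solution. -/
def jacobiRange {Λ : ℂ} (hΛ : Λ.im ≠ 0) (μ : ℝ) : Set L2Plane :=
  {v | v ∈ freeRange Λ ∧ ∃ C : ℕ →₀ ℂ, finSeq (jacobiFin Λ μ C) =
    (μ : ℂ) • ContinuousLinearMap.adjoint (opT (conj_im_ne_zero hΛ)) v}

/-- For `v` in `freeRange` the right side of the Jacobi equation is finite, but its solution need
not be. A finite `C` solves it approximately, and the small residual is absorbed into `v` through
the right inverse of `T(conj Λ)*`. -/
lemma dense_jacobiRange {Λ : ℂ} (hΛ : Λ.im ≠ 0) {μ : ℝ} (hμ : 0 < μ) :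
    Dense (jacobiRange hΛ μ) := by
  obtain ⟨K, hK, hg⟩ := exists_adjoint_opT_eq_finSeq hΛ
  have hμ' : (μ : ℂ) ≠ 0 := by exact_mod_cast hμ.ne'
  have key : (freeRange Λ : Set L2Plane) ⊆ closure (jacobiRange hΛ μ) := by
    rintro v ⟨w, p, q, hv⟩
    rw [Metric.mem_closure_iff]
    intro ε hε
    set e := diagFin (fun n => 2 * amplitude n) q with he
    have hve := adjoint_opT_eq_finSeq hΛ hv
    -- After division by `μ` and application of the right inverse, of norm at most `√K`, this
    -- tolerance leaves less than `ε`; the `+ 1` covers `K = 0`.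
    obtain ⟨C, hC⟩ := Metric.denseRange_iff.1 (denseRange_jacobiFin hΛ hμ)
      ((μ : ℂ) • finSeq e) (μ * ε / (Real.sqrt K + 1)) (by positivity)
    obtain ⟨g, hg1, hg2, hg3⟩ := hg ((μ : ℂ)⁻¹ • jacobiFin Λ μ C - e)
    have h1 : finSeq ((μ : ℂ)⁻¹ • jacobiFin Λ μ C - e) =
        (μ : ℂ)⁻¹ • (finSeq (jacobiFin Λ μ C) - (μ : ℂ) • finSeq e) := by
      rw [map_sub, map_smul, smul_sub, inv_smul_smul₀ hμ']
    refine ⟨v + g, ⟨add_mem ⟨w, p, q, hv⟩ hg1, C, ?_⟩, ?_⟩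
    · rw [map_add, hve, hg2, h1, smul_add, smul_inv_smul₀ hμ']
      abel
    · rw [dist_self_add_right]
      have h2 : ‖g‖ ≤ Real.sqrt K * ‖finSeq ((μ : ℂ)⁻¹ • jacobiFin Λ μ C - e)‖ := by
        refine le_of_sq_le_sq ?_ (by positivity)
        rwa [mul_pow, Real.sq_sqrt hK]
      rw [h1, norm_smul, norm_inv, Complex.norm_real, Real.norm_of_nonneg hμ.le,
        norm_sub_rev, ← dist_eq_norm] at h2
      refine h2.trans_lt ?_
      have hs := Real.sqrt_nonneg K
      calc _ ≤ Real.sqrt K * (μ⁻¹ * (μ * ε / (Real.sqrt K + 1))) := by gcongr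
        _ = ε * (Real.sqrt K / (Real.sqrt K + 1)) := by field_simp
        _ < ε * 1 := by
          refine mul_lt_mul_of_pos_left ?_ hε
          rw [div_lt_one (by positivity)]
          linarith
        _ = ε := mul_one ε
  exact dense_closure.1 ((dense_freeRange hΛ).mono key)

/-- The Jacobi equation is the matching condition for `w + T(Λ) C`: the left side is `y` times the
jump, the right side `β` times the normal derivative, with `β = 2√2 μ`. -/
lemma hermiteShift_eq_of_jacobiSeq {Λ : ℂ} {μ : ℝ} {q C : ℕ →₀ ℂ}
    (h : ∀ n, jacobiSeq Λ μ C n = μ * (2 * amplitude n * q n)) :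
    hermiteShift ((2 : ℂ) • diagFin (fun n => amplitude n) C) =
      ((μ * (2 * Real.sqrt 2) : ℝ) : ℂ) •
        (q + diagFin (fun n => -(amplitude n * zeta n Λ)) C) := by
  ext n
  have h2 : (Real.sqrt 2 : ℂ) * Real.sqrt 2 = 2 := by
    rw [← Complex.ofReal_mul, Real.mul_self_sqrt (by norm_num)]
    norm_num
  have ha : (amplitude n : ℂ) ≠ 0 := by exact_mod_cast (amplitude_pos n).ne'
  have hs : (Real.sqrt 2 : ℂ) ≠ 0 := by exact_mod_cast (Real.sqrt_pos.2 two_pos).ne'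
  have hj := h n
  have hd : jacobiD n = Real.sqrt 2 * Real.sqrt (n / 2) * amplitude n * amplitude (n - 1) := by
    cases n with
    | zero => simp
    | succ n => rw [jacobiD_succ]; push_cast; rfl
  rw [jacobiSeq, jacobiY_eq, jacobiD_succ, hd] at hj
  rw [hermiteShift_apply]
  simp only [Finsupp.smul_apply, Finsupp.add_apply, diagFin_apply, smul_eq_mul]
  push_cast at hj ⊢
  -- Row `n` of the matching condition times `√2 a_n` is twice row `n` of the Jacobi equation.
  refine mul_left_cancel₀ (mul_ne_zero ha hs) ?_
  linear_combination 2 * hj - 2 * amplitude n * μ *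
    (q n - amplitude n * zeta n Λ * C n) * h2

/-- On `jacobiRange`, both resolvents and their difference are explicit. -/
lemma exists_mem_finiteGraph {Λ : ℂ} (hΛ : Λ.im ≠ 0) {μ : ℝ} {v : L2Plane} {C : ℕ →₀ ℂ}
    (hv : v ∈ freeRange Λ) (hC : finSeq (jacobiFin Λ μ C) =
      (μ : ℂ) • ContinuousLinearMap.adjoint (opT (conj_im_ne_zero hΛ)) v) :
    ∃ w : L2Plane, (w, v + Λ • w) ∈ finiteGraph 0 ∧
      (w + opT hΛ (finSeq C), v + Λ • (w + opT hΛ (finSeq C))) ∈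
        finiteGraph (μ * (2 * Real.sqrt 2)) := by
  obtain ⟨w, p, q, h⟩ := hv
  refine ⟨w, ⟨p, p, q, h, by simp⟩, ?_⟩
  have h1 := h.add (isFinitePair_opT hΛ C)
  rw [add_assoc, ← smul_add] at h1
  refine ⟨_, _, _, h1, ?_⟩
  rw [add_sub_add_left_eq_sub, sub_neg_eq_add, ← two_smul ℂ, hermiteShift_eq_of_jacobiSeq]
  intro n
  rw [adjoint_opT_eq_finSeq hΛ h] at hC
  have h2 := congrArg (fun X : SeqL2 => X n) hC
  simp only [lp.coeFn_smul, Pi.smul_apply, finSeq_apply, diagFin_apply, smul_eq_mul] at h2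
  rw [← h2, jacobiFin_apply]

lemma dense_range_finiteGraph_zero {z : ℂ} (hz : z.im ≠ 0) :
    Dense ((fun q : L2Plane × L2Plane => q.2 - z • q.1) '' (finiteGraph 0 : Set _)) := by
  refine (dense_freeRange hz).mono ?_
  rintro v ⟨w, p, q, h⟩
  exact ⟨(w, v + z • w), ⟨p, p, q, h, by simp⟩, add_sub_cancel_right _ _⟩

lemma dense_range_finiteGraph {μ : ℝ} (hμ : 0 < μ) {z : ℂ} (hz : z.im ≠ 0) :
    Dense ((fun q : L2Plane × L2Plane => q.2 - z • q.1) ''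
      (finiteGraph (μ * (2 * Real.sqrt 2)) : Set _)) := by
  refine (dense_jacobiRange hz hμ).mono ?_
  rintro v ⟨hv, C, hC⟩
  obtain ⟨w, -, hw⟩ := exists_mem_finiteGraph hz hv hC
  exact ⟨_, hw, add_sub_cancel_right _ _⟩

theorem resolvent_sub_resolvent {Λ : ℂ} (hΛ : Λ.im ≠ 0) {μ : ℝ} (hμ : 0 < μ) :
    ∃ (R R0 : L2Plane →L[ℂ] L2Plane) (Jinv : SeqL2 →L[ℂ] SeqL2),
      IsResolventAt (hamiltonian (μ * (2 * Real.sqrt 2))) Λ R ∧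
      IsResolventAt (hamiltonian 0) Λ R0 ∧ IsResolventAt (jacobi Λ μ) 0 Jinv ∧
      R - R0 = opT hΛ ∘L ((μ : ℂ) • Jinv) ∘L
        ContinuousLinearMap.adjoint (opT (conj_im_ne_zero hΛ)) := by
  obtain ⟨R, hR, hR'⟩ := exists_isResolventAt_closure _ _
    (finiteGraph_le (μ * (2 * Real.sqrt 2))) (finiteGraph_symmetric _) (finiteGraph_dense_domain _)
    (fun z hz => dense_range_finiteGraph hμ hz) hΛ
  obtain ⟨R0, hR0, hR0'⟩ := exists_isResolventAt_closure _ _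
    (finiteGraph_le 0) (finiteGraph_symmetric _) (finiteGraph_dense_domain _)
    (fun z hz => dense_range_finiteGraph_zero hz) hΛ
  obtain ⟨Jinv, hJ, hJ'⟩ := exists_jacobi_inverse hΛ hμ
  refine ⟨R, R0, Jinv, hR, hR0, hJ, ?_⟩
  -- Both sides are bounded, so it suffices to compare them on a dense set. There the two resolvents
  -- of `v` differ by `T(Λ) C` with `C` finite, and the inverse Jacobi operator returns this `C`.
  refine DFunLike.coe_injective (Continuous.ext_on (dense_jacobiRange hΛ hμ)
    (ContinuousLinearMap.continuous _) (ContinuousLinearMap.continuous _) ?_)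
  rintro v ⟨hv, C, hC⟩
  obtain ⟨w, hw0, hw⟩ := exists_mem_finiteGraph hΛ hv hC
  have h1 := hR' _ (finiteGraph_le _ hw)
  have h0 := hR0' _ (finiteGraph_le _ hw0)
  simp only [add_sub_cancel_right] at h1 h0
  have hX := hJ' C
  rw [hC, map_smul] at hX
  rw [sub_apply, h1, h0, add_sub_cancel_left]
  simp only [ContinuousLinearMap.comp_apply, smul_apply]
  rw [hX]

end

end SmilanskyDeltaPrime

theorem theorem5 (β : ℝ) (hβ : 0 < β) (Λ : ℂ) (hΛ : Λ.im ≠ 0) :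
    ∃ (Rβ R0 : SmilanskyDeltaPrime.L2Plane →L[ℂ] SmilanskyDeltaPrime.L2Plane)
      (Jinv : SmilanskyDeltaPrime.SeqL2 →L[ℂ] SmilanskyDeltaPrime.SeqL2),
      SmilanskyDeltaPrime.IsResolventAt (SmilanskyDeltaPrime.hamiltonian β) Λ Rβ ∧
      SmilanskyDeltaPrime.IsResolventAt (SmilanskyDeltaPrime.hamiltonian 0) Λ R0 ∧
      SmilanskyDeltaPrime.IsResolventAt
        (SmilanskyDeltaPrime.jacobi Λ (β / (2 * Real.sqrt 2))) 0 Jinv ∧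
      Rβ - R0 =
        SmilanskyDeltaPrime.opT hΛ ∘L
          (((β / (2 * Real.sqrt 2) : ℝ) : ℂ) • Jinv) ∘L
            ContinuousLinearMap.adjoint
              (SmilanskyDeltaPrime.opT (SmilanskyDeltaPrime.conj_im_ne_zero hΛ)) := by
  have hμ : 0 < β / (2 * Real.sqrt 2) := by positivity
  obtain ⟨R, R0, Jinv, h1, h2, h3, h4⟩ := SmilanskyDeltaPrime.resolvent_sub_resolvent hΛ hμ
  rw [div_mul_cancel₀ β (by positivity)] at h1
  exact ⟨R, R0, Jinv, h1, h2, h3, h4⟩
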